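/- Let $\mathcal W\subset\mathbb R^2$ be the closed region bounded by a simple polygon, let $\mathcal D_r(x)$ be the open disc of radius $r$ about $x$, and let $\mathcal F=\{x\in\mathbb R^2:\mathcal D_1(x)\subseteq\mathcal W\}$ be the free space of a unit-disc robot in $\mathcal W$. An instance of unlabeled multi-robot motion planning consists of such a $\mathcal W$ and finite sets $S,T\subset\mathcal F$ of start and target positions with $|S|=|T|=m$, such that every connected component of $\mathcal F$ contains equally many elements of $S$ and of $T$. A solution consists of continuous paths $\pi_1,\dots,\pi_m:[0,1]\to\mathcal F$ starting at the $m$ distinct elements of $S$, with $\{\pi_i(1):1\le i\le m\}=T$ and $\pi_j(\tau)\notin\mathcal D_2(\pi_i(\tau))$ for all $\tau\in[0,1]$ and all $i\ne j$. The instance has monochromatic separation $\mu$ if any two distinct elements of $S$, and any two distinct elements of $T$, are at distance at least $\mu$. It has bichromatic separation $\beta$ if every $s\in S$ and $t\in T$ are at distance at least $\beta$. Then for every $0<\varepsilon\le 3$ there is an instance with monochromatic separation $4$ and bichromatic separation $\beta=3-\varepsilon$ (with $|st|=3-\varepsilon$ attained by some $s\in S$, $t\in T$) such that $\mathcal F$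 has exactly two connected components $F\neq F'$, each containing exactly one start and exactly one target position, and that has no solution. Moreover, in this instance a robot in $F$ always blocks the motion in $F'$: if $s',t'$ are the start and the target position in $F'$, then for all continuous paths $\gamma:[0,1]\to F$ and $\gamma':[0,1]\to F'$ with $\gamma'(0)=s'$ and $\gamma'(1)=t'$ there is a $\tau\in[0,1]$ with $\gamma'(\tau)\in\mathcal D_2(\gamma(\tau))$. Hence $\beta=3$ is necessary: if $\beta\in\mathbb R$ is such that every instance with monochromatic separation $4$ and bichromatic separation $\beta$ has a solution, then $\beta\ge 3$. -/

import Mathlib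

open Set Metric

namespace UnlabeledMRMP

/-- The Euclidean plane. -/
abbrev Plane : Type := EuclideanSpace ℝ (Fin 2)

/-- A closed polygonal chain is simple if it has at least three vertices, its edges are
nondegenerate, consecutive edges share only their common vertex, and non-consecutive edges are
disjoint. Here `finRotate n i` is the cyclic successor of `i`. -/
structure IsSimple {n : ℕ} (P : Polygon Plane n) : Prop where
  three_le : 3 ≤ n
  nondegenerate : P.HasNondegenerateEdges
  consecutive : ∀ i : Fin n,
    P.edgeSet ℝ i ∩ P.edgeSet ℝ (finRotate n i) = {P (finRotate n i)}
  nonconsecutive : ∀ i j : Fin n, j ≠ i → j ≠ finRotate n i → i ≠ finRotate n j →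
    Disjoint (P.edgeSet ℝ i) (P.edgeSet ℝ j)

/-- The closed region enclosed by a polygon: its boundary curve, together with all points whose
connected component in the complement of that curve is bounded. -/
def region {n : ℕ} (P : Polygon Plane n) : Set Plane :=
  P.boundary ℝ ∪
    {x | x ∉ P.boundary ℝ ∧ Bornology.IsBounded (connectedComponentIn (P.boundary ℝ)ᶜ x)}

/-- The free space of a workspace `W`: the positions at which an open unit disc does not meet the
obstacle space `Wᶜ`. -/
def freeSpace (W : Set Plane) : Set Plane :=
  {x | ball x 1 ∩ Wᶜ = ∅}

/-- The connected components of the free space of `W`. -/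
def freeComponents (W : Set Plane) : Set (Set Plane) :=
  {K | ∃ x ∈ freeSpace W, K = connectedComponentIn (freeSpace W) x}

/-- An instance of the unlabeled motion-planning problem for unit-disc robots in a simple polygon:
equally many start and target positions in the free space, with equally many start and target
positions in every free-space component. -/
structure Instance where
  n : ℕ
  polygon : Polygon Plane n
  simple : IsSimple polygon
  starts : Finset Plane
  targets : Finset Plane
  card_eq : starts.card = targets.card
  starts_free : (starts : Set Plane) ⊆ freeSpace (region polygon)
  targets_free : (targets : Set Plane) ⊆ freeSpace (region polygon)
  charge_eq_zero : ∀ K ∈ freeComponents (region polygon),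
    ((starts : Set Plane) ∩ K).ncard = ((targets : Set Plane) ∩ K).ncard

namespace Instance

/-- The workspace of an instance. -/
def workspace (I : Instance) : Set Plane := region I.polygon

/-- Monochromatic separation (at least) `μ`: any two distinct start positions, and any two distinct
target positions, are at distance at least `μ`. -/
def MonochromaticSeparation (I : Instance) (μ : ℝ) : Prop :=
  (∀ x ∈ I.starts, ∀ y ∈ I.starts, x ≠ y → μ ≤ dist x y) ∧
  (∀ x ∈ I.targets, ∀ y ∈ I.targets, x ≠ y → μ ≤ dist x y)

/-- Bichromatic separation (at least) `β`: every start position is at distance at least `β` from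
every target position. -/
def BichromaticSeparation (I : Instance) (β : ℝ) : Prop :=
  ∀ s ∈ I.starts, ∀ t ∈ I.targets, β ≤ dist s t

/-- A collision-free motion plan: one continuous path in the free space for each robot (robots are
indexed by their start positions), ending with the set of occupied positions equal to the set of
targets, such that at no time a robot lies in the aura (open disc of radius two) of another. -/
structure IsMotionPlan (I : Instance) (π : I.starts → C(unitInterval, Plane)) : Prop where
  free : ∀ s τ, π s τ ∈ freeSpace I.workspace
  start : ∀ s, π s 0 = (s : Plane)
  target : Set.range (fun s => π s 1) = (I.targets : Set Plane)
  collision_free : ∀ s s', s ≠ s' → ∀ τ, π s' τ ∉ ball (π s τ) 2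

/-- The instance has a solution. -/
def Solvable (I : Instance) : Prop :=
  ∃ π : I.starts → C(unitInterval, Plane), I.IsMotionPlan π

end Instance

/-- A robot in `K` always blocks the motion from `p` to `q` in `K'`: however one robot moves (or
stays) in `K`, another robot that moves from `p` to `q` in `K'` enters its aura at some time. -/
def AlwaysBlocks (K K' : Set Plane) (p q : Plane) : Prop :=
  ∀ γ γ' : C(unitInterval, Plane), (∀ τ, γ τ ∈ K) → (∀ τ, γ' τ ∈ K') →
    γ' 0 = p → γ' 1 = q → ∃ τ, γ' τ ∈ ball (γ τ) 2

end UnlabeledMRMP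

/-! The workspace is symmetric in the first coordinate axis. Write `a`, `b` for the cosine and sine
of θ, and `a'`, `b'` for those of φ, where φ < θ < π/6. Two spikes have their tips at (c, ±2b). The
tips are 4b < 2 apart, so no unit disc passes between them, and they cut the free space into a left
and a right component. A third spike has its tip at (c + 2a, 0), at distance exactly 2 from the
other two. The right component consists of two corridors of width 2 and a chamber between the three
tips, joined at two gates. Each gate has a single free position, the midpoint (c + a, ±b) of two
tips. The left component is a channel bent around the two left tips. Around the upper tip its outer
wall is circumscribed about the circle of radius 2, so a robot there is held close to the unit
circle about the tip, at an angle of at most φ above the horizontal.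

Blocking: the gate position lies on the unit circle about the tip, and the only point of that circle
at distance 2 from it is the antipode, at angle θ, which the channel does not reach. So a robot in
the upper half of the left component blocks the upper gate (`dist_gate_lt`), by symmetry one in the
lower half blocks the lower gate, and one on the axis blocks everything between the gates
(`dist_axis_lt`). A robot passing from the upper to the lower corridor would require the other one
to change from the lower to the upper half without being on the axis in between; the intermediate
value theorem forbids this (`exists_crossing`, `alwaysBlocks`).

Distances: the left channel contains two mirror positions at distance 2(2b + b'), which tends to 3
as both angles tend to π/6. Connectedness then provides a target at distance exactly 3 - ε
(`exists_target`, `exists_params`). Replacing the circular wall by a polygonal one costs a small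
error, absorbed by the gap between φ and θ.

Topology: the polygon is star-shaped about the origin, so its simplicity, its region and its free
space are all read off from rays (`isSimple`, `mem_region_iff`, `mem_freeSpace_iff`). The components
follow from a classification of the free positions (`free_cases`) and explicit connections to two
base points (`freeComponents_eq`). -/

namespace UnlabeledMRMP

/-! ### Coordinates in the plane -/

/-- The point of the plane with the given coordinates. -/
def pt (x y : ℝ) : Plane := !₂[x, y]

@[simp] lemma pt_zero (x y : ℝ) : pt x y 0 = x := rfl

@[simp] lemma pt_one (x y : ℝ) : pt x y 1 = y := rfl

lemma plane_ext {x y : Plane} (h0 : x 0 = y 0) (h1 : x 1 = y 1) : x = y := by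
  ext i
  fin_cases i
  · exact h0
  · exact h1

lemma dist_sq_eq (x y : Plane) : dist x y ^ 2 = (x 0 - y 0) ^ 2 + (x 1 - y 1) ^ 2 := by
  rw [EuclideanSpace.dist_eq, Real.sq_sqrt (by positivity), Fin.sum_univ_two, Real.dist_eq,
    Real.dist_eq, sq_abs, sq_abs]

lemma le_dist_iff {r : ℝ} (hr : 0 ≤ r) (x y : Plane) :
    r ≤ dist x y ↔ r ^ 2 ≤ (x 0 - y 0) ^ 2 + (x 1 - y 1) ^ 2 := by
  rw [← dist_sq_eq, sq_le_sq₀ hr dist_nonneg]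

lemma dist_lt_iff {r : ℝ} (hr : 0 ≤ r) (x y : Plane) :
    dist x y < r ↔ (x 0 - y 0) ^ 2 + (x 1 - y 1) ^ 2 < r ^ 2 := by
  rw [← dist_sq_eq, sq_lt_sq₀ dist_nonneg hr]

/-- The planar cross product. -/
def cross (x y : Plane) : ℝ := x 0 * y 1 - x 1 * y 0

/-- The reflection in the first coordinate axis. -/
def mirror (x : Plane) : Plane := pt (x 0) (-x 1)

@[simp] lemma mirror_apply_zero (x : Plane) : mirror x 0 = x 0 := rfl

@[simp] lemma mirror_apply_one (x : Plane) : mirror x 1 = -x 1 := rfl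

@[simp] lemma mirror_mirror (x : Plane) : mirror (mirror x) = x :=
  plane_ext (by simp) (by simp)

lemma mirror_smul (t : ℝ) (x : Plane) : mirror (t • x) = t • mirror x :=
  plane_ext (by simp) (by simp)

lemma dist_mirror (x y : Plane) : dist (mirror x) (mirror y) = dist x y := by
  rw [← sq_eq_sq₀ dist_nonneg dist_nonneg, dist_sq_eq, dist_sq_eq]
  simp only [mirror_apply_zero, mirror_apply_one]
  ring

lemma continuous_mirror : Continuous mirror :=
  (LipschitzWith.of_dist_le_mul (K := 1) fun x y => by simp [dist_mirror]).continuous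

lemma mirror_eq_self {x : Plane} (h : x 1 = 0) : mirror x = x :=
  plane_ext (by simp) (by simp [h])

lemma mem_segment_coord {x y z : Plane} (h : z ∈ segment ℝ x y) :
    ∃ s : ℝ, 0 ≤ s ∧ s ≤ 1 ∧ z 0 = x 0 + s * (y 0 - x 0) ∧ z 1 = x 1 + s * (y 1 - x 1) := by
  obtain ⟨r, s, hr, hs, hrs, rfl⟩ := h
  obtain rfl : r = 1 - s := by linarith
  refine ⟨s, hs, by linarith, ?_, ?_⟩ <;> simp <;> ring

lemma mem_segment_of_coord {x y z : Plane} {s : ℝ} (hs : 0 ≤ s) (hs1 : s ≤ 1)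
    (h0 : z 0 = x 0 + s * (y 0 - x 0)) (h1 : z 1 = x 1 + s * (y 1 - x 1)) :
    z ∈ segment ℝ x y := by
  refine ⟨1 - s, s, by linarith, hs, by ring, plane_ext ?_ ?_⟩
  · simp [h0]; ring
  · simp [h1]; ring

lemma mirror_mem_segment {x y z : Plane} (h : z ∈ segment ℝ x y) :
    mirror z ∈ segment ℝ (mirror x) (mirror y) := by
  obtain ⟨s, hs, hs1, h0, h1⟩ := mem_segment_coord h
  exact mem_segment_of_coord hs hs1 (by simp [h0]) (by simp [h1]; ring)

lemma dist_le_dist_mirror {x y : Plane} (hx : 0 ≤ x 1) (hy : 0 ≤ y 1) :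
    dist x y ≤ dist x (mirror y) := by
  rw [← sq_le_sq₀ dist_nonneg dist_nonneg, dist_sq_eq, dist_sq_eq]
  simp only [mirror_apply_zero, mirror_apply_one]
  nlinarith [mul_nonneg hx hy]

/-- A vector in the cone spanned by two vectors in positive position has a positive multiple on
the segment between them. -/
lemma exists_pos_smul_mem_segment {x y z : Plane} (hxy : 0 < cross x y) (hx : 0 ≤ cross x z)
    (hy : 0 ≤ cross z y) (hz : z ≠ 0) : ∃ r : ℝ, 0 < r ∧ r • z ∈ segment ℝ x y := by
  -- Cramer's rule: `z` is a combination of `x` and `y` with weights `cross z y` and `cross x z`.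
  -- Dividing by the sum of the weights lands on the segment.
  have e0 : cross x y * z 0 = cross z y * x 0 + cross x z * y 0 := by
    simp only [cross]; ring
  have e1 : cross x y * z 1 = cross z y * x 1 + cross x z * y 1 := by
    simp only [cross]; ring
  have hpos : 0 < cross z y + cross x z := by
    by_contra! hle
    have h1 : cross z y = 0 := by linarith
    have h2 : cross x z = 0 := by linarith
    rw [h1, h2] at e0 e1
    refine hz (plane_ext ?_ ?_)
    · simpa [hxy.ne'] using e0
    · simpa [hxy.ne'] using e1
  refine ⟨cross x y / (cross z y + cross x z), by positivity, cross z y / (cross z y + cross x z),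
    cross x z / (cross z y + cross x z), by positivity, by positivity, by field_simp,
    plane_ext ?_ ?_⟩
  · simp only [PiLp.add_apply, PiLp.smul_apply, smul_eq_mul]
    field_simp
    linarith
  · simp only [PiLp.add_apply, PiLp.smul_apply, smul_eq_mul]
    field_simp
    linarith

/-! ### Symmetric star-shaped polygons -/

/-- A chain of vertices in the closed upper half-plane that winds counterclockwise around the
origin from the positive to the negative horizontal half-axis. -/
structure IsUpperChain (m : ℕ) (V : ℕ → Plane) : Prop where
  two_le : 2 ≤ m
  first_pos : 0 < V 0 0
  first_one : V 0 1 = 0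
  last_neg : V m 0 < 0
  last_one : V m 1 = 0
  upper : ∀ i, 0 < i → i < m → 0 < V i 1
  turn : ∀ i < m, 0 < cross (V i) (V (i + 1))

/-- The `i`-th edge of a chain. -/
def chainEdge (V : ℕ → Plane) (i : ℕ) : Set Plane := segment ℝ (V i) (V (i + 1))

/-- The polygon consisting of a chain and its mirror image. -/
def symmPolygon (m : ℕ) (V : ℕ → Plane) : Polygon Plane (2 * m) where
  -- The two ends of the chain lie on the axis and are their own mirror images, so there are only `2
  -- * m` vertices.
  vertices k := if (k : ℕ) ≤ m then V k else mirror (V (2 * m - k))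

lemma val_finRotate {n : ℕ} (k : Fin n) :
    (finRotate n k : ℕ) = if (k : ℕ) + 1 = n then 0 else (k : ℕ) + 1 := by
  cases n with
  | zero => exact k.elim0
  | succ n =>
    rw [coe_finRotate]
    simp only [Fin.ext_iff, Fin.val_last, Nat.add_right_cancel_iff]

namespace IsUpperChain

variable {m : ℕ} {V : ℕ → Plane}

lemma nonneg (h : IsUpperChain m V) {i : ℕ} (hi : i ≤ m) : 0 ≤ V i 1 := by
  rcases Nat.eq_zero_or_pos i with rfl | h0
  · exact h.first_one.ge
  rcases hi.eq_or_lt with rfl | h1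
  · exact h.last_one.ge
  · exact (h.upper i h0 h1).le

lemma edge_nonneg (h : IsUpperChain m V) {i : ℕ} (hi : i < m) {x : Plane}
    (hx : x ∈ chainEdge V i) : 0 ≤ x 1 := by
  obtain ⟨s, hs, hs1, -, e⟩ := mem_segment_coord hx
  have h1 := h.nonneg hi.le
  have h2 := h.nonneg (Nat.succ_le_of_lt hi)
  rw [e]
  nlinarith [mul_nonneg hs h2, mul_nonneg (sub_nonneg.2 hs1) h1]

lemma edge_eq_zero (h : IsUpperChain m V) {i : ℕ} (hi : i < m) {x : Plane}
    (hx : x ∈ chainEdge V i) (h0 : x 1 = 0) : (i = 0 ∧ x = V 0) ∨ (i + 1 = m ∧ x = V m) := by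
  obtain ⟨s, hs, hs1, e0, e⟩ := mem_segment_coord hx
  have h1 := h.nonneg hi.le
  have h2 := h.nonneg (Nat.succ_le_of_lt hi)
  have hm := h.two_le
  rcases Nat.eq_zero_or_pos i with rfl | hi0
  · left
    have h3 : 0 < V (0 + 1) 1 := h.upper _ (by omega) (by omega)
    rw [h0, h.first_one] at e
    have : s = 0 := by
      have : s * V (0 + 1) 1 = 0 := by linarith
      rcases mul_eq_zero.1 this with h | h
      · exact h
      · linarith
    subst this
    exact ⟨rfl, plane_ext (by linarith) (by rw [h0, h.first_one])⟩
  · right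
    have h3 : 0 < V i 1 := h.upper _ hi0 hi
    have hs' : s = 1 := by
      by_contra hne
      have : s < 1 := lt_of_le_of_ne hs1 hne
      nlinarith [mul_nonneg hs h2, mul_pos (sub_pos.2 this) h3]
    subst hs'
    have h4 : V (i + 1) 1 = 0 := by linarith
    have h5 : i + 1 = m := by
      by_contra hne
      exact (h.upper (i + 1) (by omega) (by omega)).ne' h4
    exact ⟨h5, plane_ext (by rw [← h5]; linarith) (by rw [← h5]; linarith)⟩

/-- The argument increases along the chain. The ends `0` and `m` must be excluded, since they point
in opposite directions and have cross product zero. -/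
lemma cross_pos (h : IsUpperChain m V) {i : ℕ} (hi : 0 < i) {j : ℕ} (hij : i < j) (hj : j < m) :
    0 < cross (V i) (V j) := by
  induction j, hij using Nat.le_induction with
  | base => exact h.turn i (by omega)
  | succ j hij ih =>
    have h1 := ih (by omega)
    have h2 := h.turn j (by omega)
    have hi' := h.upper i hi (by omega)
    have hj' := h.upper j (by omega) (by omega)
    have hk' := h.upper (j + 1) (by omega) hj
    -- Linear dependence of three plane vectors; all second coordinates are positive, so positivity
    -- passes from two consecutive turns to their sum.
    have e : cross (V i) (V (j + 1)) * V j 1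
        = cross (V i) (V j) * V (j + 1) 1 + cross (V j) (V (j + 1)) * V i 1 := by
      simp only [cross]; ring
    have : 0 < cross (V i) (V (j + 1)) * V j 1 := by rw [e]; positivity
    exact pos_of_mul_pos_left this hj'.le

/-- The cross product with the initial vertex is linear along the edge, so the argument strictly
increases there. -/
lemma edge_cross_left (h : IsUpperChain m V) {i : ℕ} (hi : i < m) {x : Plane}
    (hx : x ∈ chainEdge V i) : 0 ≤ cross (V i) x ∧ (cross (V i) x = 0 → x = V i) := by
  obtain ⟨s, hs, hs1, e0, e1⟩ := mem_segment_coord hx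
  have ht := h.turn i hi
  have e : cross (V i) x = s * cross (V i) (V (i + 1)) := by
    simp only [cross, e0, e1]; ring
  refine ⟨by rw [e]; positivity, fun h0 => ?_⟩
  obtain rfl : s = 0 := by
    rw [e] at h0
    exact (mul_eq_zero.1 h0).resolve_right ht.ne'
  exact plane_ext (by linarith) (by linarith)

lemma edge_cross_right (h : IsUpperChain m V) {i : ℕ} (hi : i < m) {x : Plane}
    (hx : x ∈ chainEdge V i) :
    0 ≤ cross x (V (i + 1)) ∧ (cross x (V (i + 1)) = 0 → x = V (i + 1)) := by
  obtain ⟨s, hs, hs1, e0, e1⟩ := mem_segment_coord hx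
  have ht := h.turn i hi
  have e : cross x (V (i + 1)) = (1 - s) * cross (V i) (V (i + 1)) := by
    simp only [cross, e0, e1]; ring
  refine ⟨by rw [e]; exact mul_nonneg (by linarith) ht.le, fun h0 => ?_⟩
  obtain rfl : s = 1 := by
    rw [e] at h0
    linarith [(mul_eq_zero.1 h0).resolve_right ht.ne']
  exact plane_ext (by linarith) (by linarith)

/-- A half-line from the origin meets the chain in one point only, which lies on one edge or is
the common vertex of two consecutive edges. -/
lemma ray_unique_of_le (h : IsUpperChain m V) {i j : ℕ} (hij : i ≤ j) (hj : j < m) {x : Plane}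
    {r : ℝ} (hr : 0 < r) (hx : x ∈ chainEdge V i) (hy : r • x ∈ chainEdge V j) :
    r • x = x ∧ (i = j ∨ (j = i + 1 ∧ x = V j)) := by
  rcases hij.eq_or_lt with rfl | hlt
  · refine ⟨?_, Or.inl rfl⟩
    obtain ⟨s, hs, hs1, e0, e1⟩ := mem_segment_coord hx
    obtain ⟨t, ht, ht1, f0, f1⟩ := mem_segment_coord hy
    simp only [PiLp.smul_apply, smul_eq_mul] at f0 f1
    have htn := h.turn i hj
    -- On the line through an edge the linear function `cross (V i) · + cross · (V (i + 1))` has a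
    -- constant nonzero value, so a multiple of `x` on the same line must be `x`.
    have key : (r - 1) * cross (V i) (V (i + 1)) = 0 := by
      have a : r * cross (V i) x + r * cross x (V (i + 1)) = r * cross (V i) (V (i + 1)) := by
        simp only [cross, e0, e1]; ring
      have b : r * cross (V i) x + r * cross x (V (i + 1)) = cross (V i) (V (i + 1)) := by
        have : r * cross (V i) x + r * cross x (V (i + 1))
          = (V i 0 * (r * x 1) - V i 1 * (r * x 0))
            + ((r * x 0) * V (i + 1) 1 - (r * x 1) * V (i + 1) 0) := by
          simp only [cross]; ring
        rw [this, f0, f1]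
        simp only [cross]; ring
      linarith
    have : r = 1 := by linarith [(mul_eq_zero.1 key).resolve_right htn.ne']
    rw [this, one_smul]
  · have hi : i < m := hlt.trans hj
    obtain ⟨a1, a2⟩ := h.edge_cross_right hi hx
    obtain ⟨b1, b2⟩ := h.edge_cross_left hj hy
    have hb : cross (V j) (r • x) = r * cross (V j) x := by
      simp only [cross, PiLp.smul_apply, smul_eq_mul]; ring
    rw [hb] at b1 b2
    have b1' : 0 ≤ cross (V j) x := nonneg_of_mul_nonneg_right b1 hr
    rcases Nat.lt_or_eq_of_le hlt with hlt' | rfl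
    -- Edges that are not adjacent are separated by a positive angle. A common ray could then only
    -- lie on the axis, where the chain has just its two ends, on opposite sides of the origin.
    · exfalso
      have hc := h.cross_pos (i := i + 1) (by omega) hlt' hj
      have e : cross (V (i + 1)) (V j) * x 1
          = -(cross x (V (i + 1)) * V j 1) - cross (V j) x * V (i + 1) 1 := by
        simp only [cross]; ring
      have h1 := h.upper (i + 1) (by omega) (by omega)
      have h2 := h.upper j (by omega) hj
      have hx1 : x 1 = 0 := by
        refine le_antisymm ?_ (h.edge_nonneg hi hx)
        by_contra! hpos
        nlinarith [mul_pos hc hpos, mul_nonneg a1 h2.le, mul_nonneg b1' h1.le]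
      rcases h.edge_eq_zero hi hx hx1 with ⟨-, rfl⟩ | ⟨h3, -⟩
      · rcases h.edge_eq_zero hj hy (by simp [hx1]) with ⟨h4, -⟩ | ⟨-, h4⟩
        · omega
        · have := congrArg (fun z : Plane => z 0) h4
          simp only [PiLp.smul_apply, smul_eq_mul] at this
          nlinarith [mul_pos hr h.first_pos, h.last_neg]
      · omega
    · have e : cross (V (i + 1)) x = -cross x (V (i + 1)) := by simp only [cross]; ring
      have hc : cross x (V (i + 1)) = 0 := by
        have := b1'; rw [Nat.succ_eq_add_one, e] at this; linarith
      have hx' := a2 hc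
      have hy' := b2 (by rw [Nat.succ_eq_add_one, e, hc]; simp)
      exact ⟨hy'.trans hx'.symm, Or.inr ⟨rfl, hx'⟩⟩

lemma ray_unique (h : IsUpperChain m V) {i j : ℕ} (hi : i < m) (hj : j < m) {x : Plane}
    {r : ℝ} (hr : 0 < r) (hx : x ∈ chainEdge V i) (hy : r • x ∈ chainEdge V j) :
    r • x = x ∧ (i = j ∨ (j = i + 1 ∧ x = V j) ∨ (i = j + 1 ∧ x = V i)) := by
  rcases le_total i j with hij | hij
  · obtain ⟨h1, h2⟩ := h.ray_unique_of_le hij hj hr hx hy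
    exact ⟨h1, by tauto⟩
  · obtain ⟨h1, h2⟩ := h.ray_unique_of_le hij hi (r := r⁻¹) (by positivity) hy
      (by rwa [smul_smul, inv_mul_cancel₀ hr.ne', one_smul])
    rw [smul_smul, inv_mul_cancel₀ hr.ne', one_smul] at h1
    refine ⟨h1.symm, ?_⟩
    rw [← h1] at h2
    rcases h2 with h2 | h2
    · exact Or.inl h2.symm
    · exact Or.inr (Or.inr h2)

/-- A half-line meeting the chain and its mirror image does so at an end of the chain. -/
lemma ray_mirror (h : IsUpperChain m V) {i j : ℕ} (hi : i < m) (hj : j < m) {x : Plane}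
    {r : ℝ} (hr : 0 < r) (hx : x ∈ chainEdge V i) (hy : mirror (r • x) ∈ chainEdge V j) :
    r • x = x ∧ i = j ∧ ((i = 0 ∧ x = V 0) ∨ (i + 1 = m ∧ x = V m)) := by
  have h1 := h.edge_nonneg hi hx
  have h2 := h.edge_nonneg hj hy
  simp only [mirror_apply_one, PiLp.smul_apply, smul_eq_mul] at h2
  have hx1 : x 1 = 0 := le_antisymm (by nlinarith) h1
  rw [mirror_eq_self (by simp [hx1])] at hy
  have hr0 : (r • x) 0 = r * x 0 := by simp
  rcases h.edge_eq_zero hi hx hx1 with ⟨a1, a2⟩ | ⟨a1, a2⟩ <;>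
  rcases h.edge_eq_zero hj hy (by simp [hx1]) with ⟨b1, b2⟩ | ⟨b1, b2⟩
  · exact ⟨b2.trans a2.symm, by omega, Or.inl ⟨a1, a2⟩⟩
  · rw [a2] at hr0 b2
    rw [b2] at hr0
    nlinarith [mul_pos hr h.first_pos, h.last_neg]
  · rw [a2] at hr0 b2
    rw [b2] at hr0
    nlinarith [mul_neg_of_pos_of_neg hr h.last_neg, h.first_pos]
  · exact ⟨b2.trans a2.symm, by omega, Or.inr ⟨a1, a2⟩⟩

/-- The closed upper half-plane is covered by the cones over the edges of the chain. -/
lemma exists_smul_mem_edge (h : IsUpperChain m V) {x : Plane} (hx : 0 ≤ x 1) (hx0 : x ≠ 0) :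
    ∃ i < m, ∃ r : ℝ, 0 < r ∧ r • x ∈ chainEdge V i := by
  classical
  have hm := h.two_le
  have hP0 : 0 ≤ cross (V 0) x := by
    simp only [cross, h.first_one]
    nlinarith [mul_nonneg h.first_pos.le hx]
  -- The last of the vertices `0` to `m - 1` whose direction does not lie beyond `x`; the next
  -- vertex does, or is the end on the negative half-axis.
  let i := Nat.findGreatest (fun i => 0 ≤ cross (V i) x) (m - 1)
  have hi : 0 ≤ cross (V i) x :=
    Nat.findGreatest_spec (P := fun i => 0 ≤ cross (V i) x) (Nat.zero_le (m - 1)) hP0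
  have him : i ≤ m - 1 := Nat.findGreatest_le _
  refine ⟨i, by omega, exists_pos_smul_mem_segment (h.turn i (by omega)) hi ?_ hx0⟩
  rcases him.eq_or_lt with he | hlt
  · have : i + 1 = m := by omega
    rw [this]
    simp only [cross, h.last_one]
    nlinarith [mul_nonneg hx (neg_nonneg.2 h.last_neg.le)]
  · have := Nat.findGreatest_is_greatest (P := fun i => 0 ≤ cross (V i) x) (n := m - 1)
      (k := i + 1) (Nat.lt_succ_self _) (by omega)
    simp only [cross] at this ⊢
    linarith

/-! ### Edges and simplicity of the symmetric polygon -/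

/-- The first half of the edges of the symmetric polygon. -/
lemma edgeSet_upper (k : Fin (2 * m)) (hk : (k : ℕ) < m) :
    (symmPolygon m V).edgeSet ℝ k = chainEdge V k := by
  have h1 := val_finRotate k
  rw [if_neg (by omega)] at h1
  rw [Polygon.edgeSet, affineSegment_eq_segment, chainEdge]
  simp only [symmPolygon, h1]
  rw [if_pos hk.le, if_pos (by omega)]

/-- The second half of the edges of the symmetric polygon. -/
lemma edgeSet_lower (h : IsUpperChain m V) (k : Fin (2 * m)) (hk : m ≤ (k : ℕ)) :
    (symmPolygon m V).edgeSet ℝ k = mirror ⁻¹' chainEdge V (2 * m - 1 - k) := by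
  have hm := h.two_le
  have h1 := val_finRotate k
  have hv : (symmPolygon m V).vertices k = mirror (V (2 * m - k)) := by
    simp only [symmPolygon]
    split_ifs with hle
    · have : (k : ℕ) = m := le_antisymm hle hk
      rw [this, show 2 * m - m = m by omega, mirror_eq_self h.last_one]
    · rfl
  have hv' : (symmPolygon m V).vertices (finRotate (2 * m) k) = mirror (V (2 * m - 1 - k)) := by
    simp only [symmPolygon, h1]
    by_cases hA : (k : ℕ) + 1 = 2 * m
    · rw [if_pos hA, if_pos (Nat.zero_le _), show 2 * m - 1 - (k : ℕ) = 0 by omega,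
        mirror_eq_self h.first_one]
    · rw [if_neg hA, if_neg (by omega), show 2 * m - ((k : ℕ) + 1) = 2 * m - 1 - k by omega]
  -- The mirrored half is traversed backwards, hence the reversal of the segment.
  rw [Polygon.edgeSet, affineSegment_eq_segment, hv, hv', segment_symm]
  have h2 : 2 * m - (k : ℕ) = 2 * m - 1 - k + 1 := by omega
  rw [h2]
  ext x
  simp only [mem_preimage, chainEdge]
  constructor
  · intro hx
    simpa using mirror_mem_segment hx
  · intro hx
    simpa using mirror_mem_segment hx

lemma mem_boundary_iff (h : IsUpperChain m V) (x : Plane) :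
    x ∈ (symmPolygon m V).boundary ℝ ↔
      ∃ i < m, x ∈ chainEdge V i ∨ mirror x ∈ chainEdge V i := by
  rw [Polygon.boundary, mem_iUnion]
  constructor
  · rintro ⟨k, hk⟩
    rcases lt_or_ge (k : ℕ) m with h1 | h1
    · rw [edgeSet_upper k h1] at hk
      exact ⟨k, h1, Or.inl hk⟩
    · rw [h.edgeSet_lower k h1] at hk
      exact ⟨2 * m - 1 - k, by omega, Or.inr hk⟩
  · rintro ⟨i, hi, hx | hx⟩
    · exact ⟨⟨i, by omega⟩, by rwa [edgeSet_upper _ hi]⟩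
    · refine ⟨⟨2 * m - 1 - i, by omega⟩, ?_⟩
      rw [h.edgeSet_lower _ (by simp only; omega)]
      simpa [show 2 * m - 1 - (2 * m - 1 - i) = i by omega] using hx

lemma ne_succ (h : IsUpperChain m V) {i : ℕ} (hi : i < m) : V i ≠ V (i + 1) := by
  intro he
  have := h.turn i hi
  rw [he, cross] at this
  nlinarith

lemma left_mem (V : ℕ → Plane) (i : ℕ) : V i ∈ chainEdge V i := left_mem_segment ℝ _ _

lemma vertex_of_le (k : Fin (2 * m)) (hk : (k : ℕ) ≤ m) : (symmPolygon m V).vertices k = V k :=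
  if_pos hk

lemma vertex_of_ge (h : IsUpperChain m V) (k : Fin (2 * m)) (hk : m ≤ (k : ℕ)) :
    (symmPolygon m V).vertices k = mirror (V (2 * m - k)) := by
  rcases hk.eq_or_lt with he | hlt
  · rw [vertex_of_le k he.ge, ← he, show 2 * m - m = m by omega, mirror_eq_self h.last_one]
  · exact if_neg (by omega)

lemma vertex_mem_edgeSet (P : Polygon Plane m) (k : Fin m) :
    P k ∈ P.edgeSet ℝ k ∧ P (finRotate m k) ∈ P.edgeSet ℝ k := by
  rw [Polygon.edgeSet, affineSegment_eq_segment]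
  exact ⟨left_mem_segment ℝ _ _, right_mem_segment ℝ _ _⟩

/-- Two distinct edges of the symmetric polygon meet only if they are consecutive, and then only
in the common vertex. -/
lemma edgeSet_inter (h : IsUpperChain m V) {k l : Fin (2 * m)} (hkl : (k : ℕ) < l) {x : Plane}
    (hx : x ∈ (symmPolygon m V).edgeSet ℝ k) (hy : x ∈ (symmPolygon m V).edgeSet ℝ l) :
    (l = finRotate (2 * m) k ∧ x = (symmPolygon m V).vertices l) ∨
      (k = finRotate (2 * m) l ∧ x = (symmPolygon m V).vertices k) := by
  have hrk := val_finRotate k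
  have hrl := val_finRotate l
  simp only [Fin.ext_iff, hrk, hrl]
  rcases lt_or_ge (k : ℕ) m with hk | hk <;> rcases lt_or_ge (l : ℕ) m with hl | hl
  · rw [edgeSet_upper k hk] at hx
    rw [edgeSet_upper l hl] at hy
    obtain ⟨-, h2⟩ := h.ray_unique_of_le hkl.le hl one_pos hx (by rwa [one_smul])
    rcases h2 with h2 | ⟨h2, h3⟩
    · omega
    · left
      rw [if_neg (by omega), vertex_of_le l hl.le]
      exact ⟨h2, h3⟩
  · rw [edgeSet_upper k hk] at hx
    rw [h.edgeSet_lower l hl] at hy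
    -- An upper and a mirrored edge meet only on the axis: edges 0 and `2 * m - 1` at `V 0`, edges
    -- `m - 1` and `m` at `V m`.
    obtain ⟨-, h1, h2⟩ := h.ray_mirror (j := 2 * m - 1 - l) hk (by omega) one_pos hx
      (by rwa [one_smul])
    rcases h2 with ⟨h2, h3⟩ | ⟨h2, h3⟩
    · right
      rw [if_pos (by omega), vertex_of_le k hk.le]
      exact ⟨h2, by rw [h2]; exact h3⟩
    · left
      rw [if_neg (by omega), vertex_of_le l (by omega), show (l : ℕ) = m by omega]
      exact ⟨by omega, h3⟩
  · omega
  · rw [h.edgeSet_lower k hk] at hx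
    rw [h.edgeSet_lower l hl] at hy
    obtain ⟨-, h2⟩ := h.ray_unique_of_le (i := 2 * m - 1 - l) (j := 2 * m - 1 - k) (by omega)
      (by omega) one_pos hy (by rw [one_smul]; exact hx)
    rcases h2 with h2 | ⟨h2, h3⟩
    · omega
    · left
      rw [if_neg (by omega), h.vertex_of_ge l (by omega), show 2 * m - (l : ℕ) = 2 * m - 1 - k by
        omega, ← h3, mirror_mirror]
      exact ⟨by omega, rfl⟩

/-- Everything comes from `edgeSet_inter`. It remains to exclude that two edges are successors of
each other, which cannot happen because there are at least four. -/
theorem isSimple (h : IsUpperChain m V) : IsSimple (symmPolygon m V) := by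
  have hm := h.two_le
  refine ⟨by omega, fun k => ?_, fun k => ?_, fun k l h1 h2 h3 => ?_⟩
  · have hr := val_finRotate k
    rcases lt_or_ge (k : ℕ) m with h1 | h1
    · rw [if_neg (by omega)] at hr
      rw [vertex_of_le k h1.le, vertex_of_le _ (by omega), hr]
      exact h.ne_succ h1
    · intro he
      have hne := h.ne_succ (i := 2 * m - 1 - k) (by omega)
      rw [h.vertex_of_ge k h1] at he
      split_ifs at hr with hA
      · rw [vertex_of_le _ (by omega), hr, ← mirror_eq_self h.first_one] at he
        have := congrArg mirror he
        rw [mirror_mirror, mirror_mirror] at this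
        rw [show 2 * m - 1 - (k : ℕ) = 0 by omega, ← this, show 2 * m - (k : ℕ) = 0 + 1 by omega]
          at hne
        exact hne rfl
      · rw [h.vertex_of_ge _ (by omega), hr] at he
        have := congrArg mirror he
        rw [mirror_mirror, mirror_mirror] at this
        rw [show 2 * m - ((k : ℕ) + 1) = 2 * m - 1 - k by omega,
          show 2 * m - (k : ℕ) = 2 * m - 1 - k + 1 by omega] at this
        exact hne this.symm
  · have hr := val_finRotate k
    refine Subset.antisymm ?_ ?_
    · rintro x ⟨hx, hy⟩
      rw [mem_singleton_iff]
      have hne : (k : ℕ) ≠ finRotate (2 * m) k := by split_ifs at hr <;> omega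
      rcases lt_or_gt_of_ne hne with hlt | hlt
      · rcases h.edgeSet_inter hlt hx hy with ⟨-, h2⟩ | ⟨h1, -⟩
        · exact h2
        · have hr' := val_finRotate (finRotate (2 * m) k)
          rw [← h1] at hr'
          split_ifs at hr hr' <;> omega
      · rcases h.edgeSet_inter hlt hy hx with ⟨h1, -⟩ | ⟨-, h2⟩
        · have hr' := val_finRotate (finRotate (2 * m) k)
          rw [← h1] at hr'
          split_ifs at hr hr' <;> omega
        · exact h2
    · rintro x rfl
      exact ⟨(vertex_mem_edgeSet _ _).2, (vertex_mem_edgeSet _ _).1⟩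
  · rw [Set.disjoint_left]
    intro x hx hy
    have hne : (k : ℕ) ≠ l := fun he => h1 (Fin.ext he.symm)
    rcases lt_or_gt_of_ne hne with hlt | hlt
    · rcases h.edgeSet_inter hlt hx hy with ⟨h4, -⟩ | ⟨h4, -⟩
      · exact h2 h4
      · exact h3 h4
    · rcases h.edgeSet_inter hlt hy hx with ⟨h4, -⟩ | ⟨h4, -⟩
      · exact h3 h4
      · exact h2 h4

/-! ### The region of a star-shaped polygon -/

lemma isCompact_boundary {n : ℕ} (P : Polygon Plane n) : IsCompact (P.boundary ℝ) := by
  refine isCompact_iUnion fun k => ?_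
  rw [Polygon.edgeSet_eq_image_edgePath]
  exact isCompact_Icc.image (AffineMap.continuous_of_finiteDimensional _)

lemma mirror_mem_boundary (h : IsUpperChain m V) {x : Plane}
    (hx : x ∈ (symmPolygon m V).boundary ℝ) : mirror x ∈ (symmPolygon m V).boundary ℝ := by
  rw [h.mem_boundary_iff] at hx ⊢
  simp only [mirror_mirror]
  obtain ⟨i, hi, h1⟩ := hx
  exact ⟨i, hi, h1.symm⟩

/-- A half-line from the origin meets the boundary at most once. -/
lemma boundary_ray_unique (h : IsUpperChain m V) {x : Plane} {r : ℝ} (hr : 0 < r)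
    (hx : x ∈ (symmPolygon m V).boundary ℝ) (hy : r • x ∈ (symmPolygon m V).boundary ℝ) :
    r • x = x := by
  rw [h.mem_boundary_iff] at hx hy
  obtain ⟨i, hi, hx⟩ := hx
  obtain ⟨j, hj, hy⟩ := hy
  rcases hx with hx | hx <;> rcases hy with hy | hy
  · exact (h.ray_unique hi hj hr hx hy).1
  · exact (h.ray_mirror hi hj hr hx hy).1
  · have := (h.ray_mirror hi hj hr hx (by rwa [← mirror_smul, mirror_mirror])).1
    rw [← mirror_smul] at this
    simpa using congrArg mirror this
  · rw [mirror_smul] at hy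
    have := (h.ray_unique hi hj hr hx hy).1
    rw [← mirror_smul] at this
    simpa using congrArg mirror this

lemma zero_notMem_boundary (h : IsUpperChain m V) : (0 : Plane) ∉ (symmPolygon m V).boundary ℝ := by
  rw [h.mem_boundary_iff]
  rintro ⟨i, hi, hx⟩
  have hx : (0 : Plane) ∈ chainEdge V i := by
    rcases hx with hx | hx
    · exact hx
    · rwa [mirror_eq_self (by simp)] at hx
  rcases h.edge_eq_zero hi hx (by simp) with ⟨-, h1⟩ | ⟨-, h1⟩
  · have := h.first_pos
    rw [← h1] at this
    simp at this
  · have := h.last_neg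
    rw [← h1] at this
    simp at this

lemma exists_smul_mem_boundary (h : IsUpperChain m V) {x : Plane} (hx : x ≠ 0) :
    ∃ r : ℝ, 0 < r ∧ r • x ∈ (symmPolygon m V).boundary ℝ := by
  simp only [h.mem_boundary_iff]
  rcases le_total 0 (x 1) with h0 | h0
  · obtain ⟨i, hi, r, hr, h1⟩ := h.exists_smul_mem_edge h0 hx
    exact ⟨r, hr, i, hi, Or.inl h1⟩
  · obtain ⟨i, hi, r, hr, h1⟩ := h.exists_smul_mem_edge (x := mirror x) (by simpa using h0)
      (fun he => hx (by rw [← mirror_mirror x, he, mirror_eq_self (by simp)]))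
    exact ⟨r, hr, i, hi, Or.inr (by rwa [mirror_smul])⟩

/-- The star hull `W` of the boundary and the set `Z` of points that shrink onto the boundary are
closed, cover `s`, and meet only in the boundary because each ray meets it once. A connected set
avoiding the boundary cannot meet both. -/
lemma mem_starHull_of_preconnected (h : IsUpperChain m V) {s : Set Plane} (hs : IsPreconnected s)
    (hB : ∀ x ∈ s, x ∉ (symmPolygon m V).boundary ℝ) {y : Plane} (hy : y ∈ s)
    (hyW : ∃ t ∈ Icc (0 : ℝ) 1, ∃ b ∈ (symmPolygon m V).boundary ℝ, y = t • b) :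
    ∀ x ∈ s, ∃ t ∈ Icc (0 : ℝ) 1, ∃ b ∈ (symmPolygon m V).boundary ℝ, x = t • b := by
  set B := (symmPolygon m V).boundary ℝ
  have hBc : IsCompact B := isCompact_boundary _
  let W : Set Plane := {x | ∃ t ∈ Icc (0 : ℝ) 1, ∃ b ∈ B, x = t • b}
  let Z : Set Plane := {x | ∃ t ∈ Icc (0 : ℝ) 1, t • x ∈ B}
  have hW : IsClosed W := by
    have : W = (fun p : ℝ × Plane => p.1 • p.2) '' (Icc (0 : ℝ) 1 ×ˢ B) := by
      ext x
      simp only [W, mem_ofPred_eq, mem_image, mem_prod, Prod.exists]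
      constructor
      · rintro ⟨t, ht, b, hb, rfl⟩
        exact ⟨t, b, ⟨ht, hb⟩, rfl⟩
      · rintro ⟨t, b, ⟨ht, hb⟩, rfl⟩
        exact ⟨t, ht, b, hb, rfl⟩
    rw [this]
    exact ((isCompact_Icc.prod hBc).image (by fun_prop)).isClosed
  -- The shrinking factors lie in a compact interval, so a subsequence of them converges.
  have hZ : IsClosed Z := by
    rw [← isSeqClosed_iff_isClosed]
    intro u x hu hux
    choose v hv hvB using hu
    obtain ⟨t, ht, φ, hφ, htφ⟩ := isCompact_Icc.tendsto_subseq hv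
    exact ⟨t, ht, hBc.isClosed.mem_of_tendsto (htφ.smul (hux.comp hφ.tendsto_atTop))
      (Filter.Eventually.of_forall fun n => hvB _)⟩
  have hcov : s ⊆ W ∪ Z := by
    intro x hx
    obtain ⟨b0, t0, ht0, hyb⟩ : ∃ b0 ∈ B, True := by
      obtain ⟨t, ht, b, hb, -⟩ := hyW
      exact ⟨b, hb, trivial⟩
    by_cases hx0 : x = 0
    · exact Or.inl ⟨0, by simp, b0, t0, by simp [hx0]⟩
    obtain ⟨r, hr, hrb⟩ := h.exists_smul_mem_boundary hx0
    rcases le_total r 1 with hr1 | hr1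
    · exact Or.inr ⟨r, ⟨hr.le, hr1⟩, hrb⟩
    · refine Or.inl ⟨r⁻¹, ⟨by positivity, inv_le_one_of_one_le₀ hr1⟩, _, hrb, ?_⟩
      rw [smul_smul, inv_mul_cancel₀ hr.ne', one_smul]
  have hdisj : ∀ x ∈ W ∩ Z, x ∈ B := by
    rintro x ⟨⟨t, ht, b, hb, rfl⟩, r, hr, hrb⟩
    rw [smul_smul] at hrb
    have hrt : 0 < r * t := by
      refine lt_of_le_of_ne (mul_nonneg hr.1 ht.1) fun he => ?_
      rw [← he, zero_smul] at hrb
      exact h.zero_notMem_boundary hrb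
    have := h.boundary_ray_unique hrt hb hrb
    have hb0 : b ≠ 0 := fun he => h.zero_notMem_boundary (he ▸ hb)
    have h1 : (r * t - 1) • b = 0 := by rw [sub_smul, one_smul, this, sub_self]
    have h2 : r * t = 1 := by
      rcases smul_eq_zero.1 h1 with h1 | h1
      · linarith
      · exact absurd h1 hb0
    have h3 : t = 1 := by nlinarith [hr.1, hr.2, ht.1, ht.2]
    rw [h3, one_smul]
    exact hb
  intro x hx
  by_contra hxW
  have hxZ : x ∈ Z := (hcov hx).resolve_left hxW
  obtain ⟨z, hz, hzW⟩ := isPreconnected_closed_iff.1 hs W Z hW hZ hcov ⟨y, hy, hyW⟩ ⟨x, hx, hxZ⟩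
  exact hB z hz (hdisj z hzW)

/-- The region bounded by a symmetric star-shaped polygon is the star hull of its boundary. -/
lemma mem_region_iff (h : IsUpperChain m V) (x : Plane) :
    x ∈ region (symmPolygon m V) ↔
      ∃ t ∈ Icc (0 : ℝ) 1, ∃ b ∈ (symmPolygon m V).boundary ℝ, x = t • b := by
  have hBc : IsCompact ((symmPolygon m V).boundary ℝ) := isCompact_boundary _
  constructor
  · rintro (hx | ⟨hx, hbd⟩)
    · exact ⟨1, by simp, x, hx, by simp⟩
    · by_contra hW
      have hx0 : x ≠ 0 := by
        rintro rfl
        refine hW ⟨0, by simp, V 0, ?_, by simp⟩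
        rw [h.mem_boundary_iff]
        exact ⟨0, by have := h.two_le; omega, Or.inl (left_mem V 0)⟩
      -- Outside the hull the outward ray from `x` misses the boundary, so the component of `x` is
      -- unbounded.
      have hsub : (fun r : ℝ => r • x) '' Ici 1 ⊆
          connectedComponentIn ((symmPolygon m V).boundary ℝ)ᶜ x := by
        refine IsPreconnected.subset_connectedComponentIn ?_ ⟨1, by simp, by simp⟩ ?_
        · exact isPreconnected_Ici.image _ (by fun_prop)
        · rintro _ ⟨r, hr, rfl⟩ hmem
          have hr : (1 : ℝ) ≤ r := hr
          refine hW ⟨r⁻¹, ⟨by positivity, inv_le_one_of_one_le₀ hr⟩, _, hmem, ?_⟩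
          simp only [smul_smul]
          rw [inv_mul_cancel₀ (by positivity), one_smul]
      obtain ⟨C, hC⟩ := (hbd.subset hsub).exists_norm_le
      have hn : 0 < ‖x‖ := norm_pos_iff.2 hx0
      have := hC ((1 + |C| / ‖x‖ + 1) • x) ⟨_, by
        show (1 : ℝ) ≤ 1 + |C| / ‖x‖ + 1
        have : 0 ≤ |C| / ‖x‖ := by positivity
        linarith, rfl⟩
      rw [norm_smul, Real.norm_of_nonneg (by positivity)] at this
      have h2 : (1 + |C| / ‖x‖ + 1) * ‖x‖ = 2 * ‖x‖ + |C| := by field_simp; ring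
      have := le_abs_self C
      linarith
  · intro hW
    by_cases hx : x ∈ (symmPolygon m V).boundary ℝ
    · exact Or.inl hx
    refine Or.inr ⟨hx, ?_⟩
    -- Conversely, the component of a point of the hull stays in the hull, which is as bounded as
    -- the boundary is.
    obtain ⟨C, hC⟩ := hBc.isBounded.exists_norm_le
    refine isBounded_iff_forall_norm_le.2 ⟨C, fun y hy => ?_⟩
    obtain ⟨t, ht, b, hb, rfl⟩ := h.mem_starHull_of_preconnected
      isPreconnected_connectedComponentIn
      (fun z hz => connectedComponentIn_subset _ _ hz) (mem_connectedComponentIn hx) hW y hy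
    rw [norm_smul, Real.norm_of_nonneg ht.1]
    have := hC b hb
    nlinarith [ht.1, ht.2, norm_nonneg b]

lemma subset_region_of_preconnected (h : IsUpperChain m V) {s : Set Plane} (hs : IsPreconnected s)
    (hB : ∀ x ∈ s, x ∉ (symmPolygon m V).boundary ℝ) {y : Plane} (hy : y ∈ s)
    (hyW : y ∈ region (symmPolygon m V)) : s ⊆ region (symmPolygon m V) := by
  intro x hx
  rw [h.mem_region_iff] at hyW ⊢
  exact h.mem_starHull_of_preconnected hs hB hy hyW x hx

/-- The free space consists of the points of the region at distance at least one from the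
boundary. -/
lemma mem_freeSpace_iff (h : IsUpperChain m V) (x : Plane) :
    x ∈ freeSpace (region (symmPolygon m V)) ↔ x ∈ region (symmPolygon m V) ∧
      ∀ b ∈ (symmPolygon m V).boundary ℝ, 1 ≤ dist x b := by
  have hsub : x ∈ freeSpace (region (symmPolygon m V)) ↔
      ball x 1 ⊆ region (symmPolygon m V) := by
    simp only [freeSpace, mem_ofPred_eq, ← disjoint_iff_inter_eq_empty,
      Set.disjoint_compl_right_iff_subset]
  rw [hsub]
  constructor
  · intro hx
    refine ⟨hx (mem_ball_self one_pos), fun b hb => ?_⟩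
    by_contra! hlt
    -- A boundary point `b` in the open disc could be pushed outwards to `r • b` with `r > 1`, still
    -- in the disc and hence in the region; but the ray through `b` leaves the region at `b`.
    have hcont : Filter.Tendsto (fun r : ℝ => dist (r • b) x) (nhdsWithin 1 (Ioi 1))
        (nhds (dist ((1 : ℝ) • b) x)) :=
      ((by fun_prop : Continuous fun r : ℝ => dist (r • b) x).tendsto 1).mono_left
        nhdsWithin_le_nhds
    rw [one_smul, dist_comm] at hcont
    obtain ⟨r, hr, hr1 : 1 < r⟩ :=
      ((hcont.eventually_lt_const hlt).and self_mem_nhdsWithin).exists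
    obtain ⟨t, ht, b', hb', he⟩ := (h.mem_region_iff _).1 (hx (mem_ball.2 hr))
    have hb0 : b ≠ 0 := fun he => h.zero_notMem_boundary (he ▸ hb)
    have ht0 : 0 < t := by
      refine lt_of_le_of_ne ht.1 fun h0 => ?_
      rw [← h0, zero_smul, smul_eq_zero] at he
      rcases he with he | he
      · linarith
      · exact hb0 he
    have hbb : (r⁻¹ * t) • b' = b := by
      rw [← smul_smul, ← he, smul_smul, inv_mul_cancel₀ (by positivity), one_smul]
    have hru := h.boundary_ray_unique (r := r⁻¹ * t) (by positivity) hb' (by rwa [hbb])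
    rw [hbb] at hru
    rw [← hru] at he
    have h1 : (r - t) • b = 0 := by rw [sub_smul, he, sub_self]
    rcases smul_eq_zero.1 h1 with h1 | h1
    · linarith [ht.2]
    · exact hb0 h1
  · rintro ⟨hx, hB⟩
    refine h.subset_region_of_preconnected (convex_ball x 1).isPreconnected (fun z hz hzB => ?_)
      (mem_ball_self one_pos) hx
    have := hB z hzB
    rw [mem_ball, dist_comm] at hz
    linarith

/-- A preconnected set that keeps distance one from the boundary and meets the region lies in the
free space. -/
lemma subset_freeSpace (h : IsUpperChain m V) {s : Set Plane} (hs : IsPreconnected s)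
    (hB : ∀ x ∈ s, ∀ b ∈ (symmPolygon m V).boundary ℝ, 1 ≤ dist x b) {y : Plane} (hy : y ∈ s)
    (hyW : y ∈ region (symmPolygon m V)) : s ⊆ freeSpace (region (symmPolygon m V)) := by
  intro x hx
  rw [h.mem_freeSpace_iff]
  refine ⟨h.subset_region_of_preconnected hs (fun z hz hzB => ?_) hy hyW hx, hB x hx⟩
  have := hB z hz z hzB
  rw [dist_self] at this
  linarith

lemma mirror_mem_region (h : IsUpperChain m V) {x : Plane}
    (hx : x ∈ region (symmPolygon m V)) : mirror x ∈ region (symmPolygon m V) := by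
  rw [h.mem_region_iff] at hx ⊢
  obtain ⟨t, ht, b, hb, rfl⟩ := hx
  exact ⟨t, ht, mirror b, h.mirror_mem_boundary hb, mirror_smul t b⟩

lemma mirror_mem_freeSpace (h : IsUpperChain m V) {x : Plane}
    (hx : x ∈ freeSpace (region (symmPolygon m V))) :
    mirror x ∈ freeSpace (region (symmPolygon m V)) := by
  rw [h.mem_freeSpace_iff] at hx ⊢
  refine ⟨h.mirror_mem_region hx.1, fun b hb => ?_⟩
  rw [← dist_mirror, mirror_mirror]
  exact hx.2 _ (h.mirror_mem_boundary hb)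

/-- For a point of the upper half-plane, only the upper edges matter. -/
lemma one_le_dist_boundary (h : IsUpperChain m V) {x : Plane} (hx : 0 ≤ x 1)
    (hd : ∀ i < m, ∀ b ∈ chainEdge V i, 1 ≤ dist x b) :
    ∀ b ∈ (symmPolygon m V).boundary ℝ, 1 ≤ dist x b := by
  intro b hb
  rw [h.mem_boundary_iff] at hb
  obtain ⟨i, hi, hb | hb⟩ := hb
  · exact hd i hi b hb
  · refine (hd i hi _ hb).trans ?_
    have := dist_le_dist_mirror hx (h.edge_nonneg hi hb)
    rwa [mirror_mirror] at this

lemma one_le_dist_edge (h : IsUpperChain m V) {x : Plane}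
    (hx : x ∈ freeSpace (region (symmPolygon m V))) {i : ℕ} (hi : i < m) {b : Plane}
    (hb : b ∈ chainEdge V i) : 1 ≤ dist x b :=
  ((h.mem_freeSpace_iff x).1 hx).2 b ((h.mem_boundary_iff b).2 ⟨i, hi, Or.inl hb⟩)

/-- The part of the region in the upper half-plane is the union of the triangles spanned by the
origin and the edges of the chain. -/
lemma exists_smul_of_mem_region (h : IsUpperChain m V) {x : Plane} (hx : 0 ≤ x 1)
    (hxW : x ∈ region (symmPolygon m V)) :
    ∃ i < m, ∃ t ∈ Icc (0 : ℝ) 1, ∃ b ∈ chainEdge V i, x = t • b := by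
  rw [h.mem_region_iff] at hxW
  obtain ⟨t, ht, b, hb, rfl⟩ := hxW
  rw [h.mem_boundary_iff] at hb
  obtain ⟨i, hi, hb | hb⟩ := hb
  · exact ⟨i, hi, t, ht, b, hb, rfl⟩
  · rcases ht.1.eq_or_lt with rfl | ht0
    · exact ⟨i, hi, 0, by simp, mirror b, hb, by simp⟩
    have h1 := h.edge_nonneg hi hb
    simp only [mirror_apply_one, PiLp.smul_apply, smul_eq_mul] at h1 hx
    have hb1 : b 1 = 0 := le_antisymm (by linarith) (nonneg_of_mul_nonneg_right hx ht0)
    rw [mirror_eq_self hb1] at hb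
    exact ⟨i, hi, t, ht, b, hb, rfl⟩

end IsUpperChain
end UnlabeledMRMP

namespace UnlabeledMRMP

noncomputable section

/-! ### The workspace -/

/-- The parameters of the workspace: two angles close to `π / 6` and the number of edges of a
polygonal approximation to a circular arc. -/
structure Params where
  θ : ℝ
  φ : ℝ
  N : ℕ
  φ_pos : 0 < φ
  φ_lt : φ < θ
  θ_lt : θ < Real.pi / 6
  -- Makes 16 sin θ exceed 4, so that the far ends of the corridors are at distance at least 4 from
  -- the left component.
  le_sin_φ : 1 / 4 ≤ Real.sin φ
  N_pos : 0 < N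
  -- Law of cosines: the left-hand side is the squared distance of two points at distances `R - 1`
  -- and 1 from the tip that enclose the angle π - (θ - φ). Being below 4 means that the robots
  -- collide.
  radius_bound : (2 / Real.cos (φ / N / 2) - 1) ^ 2 + 1
    + 2 * (2 / Real.cos (φ / N / 2) - 1) * Real.cos (θ - φ) < 4

namespace Params

variable (P : Params)

/-- Cosine of the larger angle. -/
def a : ℝ := Real.cos P.θ
/-- Sine of the larger angle. -/
def b : ℝ := Real.sin P.θ
/-- Cosine of the smaller angle. -/
def a' : ℝ := Real.cos P.φ
/-- Sine of the smaller angle. -/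
def b' : ℝ := Real.sin P.φ
/-- The first coordinate of the tips of the two spikes that separate the free-space components. -/
def c : ℝ := 2 * P.b * P.b' / P.a
/-- The angular step of the polygonal arc. -/
def Δ : ℝ := P.φ / P.N
/-- The circumradius of the polygonal arc. -/
def R : ℝ := 2 / Real.cos (P.Δ / 2)
/-- Half the edge length of the polygonal arc. -/
def T : ℝ := P.R * Real.sin (P.Δ / 2)
/-- The angles of the contact points of the polygonal arc. -/
def ψ (j : ℕ) : ℝ := P.φ - j * P.Δ

lemma sq_add_sq : P.a ^ 2 + P.b ^ 2 = 1 := Real.cos_sq_add_sin_sq _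

lemma sq_add_sq' : P.a' ^ 2 + P.b' ^ 2 = 1 := Real.cos_sq_add_sin_sq _

lemma θ_pos : 0 < P.θ := P.φ_pos.trans P.φ_lt

lemma b_lt_half : P.b < 1 / 2 := by
  rw [← Real.sin_pi_div_six]
  have := P.θ_lt
  exact Real.sin_lt_sin_of_lt_of_le_pi_div_two (by linarith [P.θ_pos, Real.pi_pos])
    (by linarith [Real.pi_pos]) this

lemma b'_lt : P.b' < P.b :=
  Real.sin_lt_sin_of_lt_of_le_pi_div_two (by linarith [P.φ_pos, Real.pi_pos])
    (by linarith [Real.pi_pos, P.θ_lt]) P.φ_lt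

lemma le_b' : 1 / 4 ≤ P.b' := P.le_sin_φ

lemma a_pos : 0 < P.a :=
  Real.cos_pos_of_mem_Ioo ⟨by linarith [P.θ_pos, Real.pi_pos], by linarith [P.θ_lt, Real.pi_pos]⟩

lemma a_lt : P.a < P.a' :=
  Real.cos_lt_cos_of_nonneg_of_le_pi_div_two P.φ_pos.le (by linarith [Real.pi_pos, P.θ_lt]) P.φ_lt

lemma b'_pos : 0 < P.b' := by linarith [P.le_b']

lemma b_pos : 0 < P.b := P.b'_pos.trans P.b'_lt

lemma a'_pos : 0 < P.a' := P.a_pos.trans P.a_lt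

lemma a'_lt_one : P.a' < 1 := by nlinarith [P.sq_add_sq', P.b'_pos, P.a'_pos]

lemma a_lt_one : P.a < 1 := P.a_lt.trans P.a'_lt_one

lemma sq_a : 3 / 4 < P.a ^ 2 := by nlinarith [P.sq_add_sq, P.b_pos, P.b_lt_half]

lemma lt_a : 86 / 100 < P.a := by nlinarith [P.sq_a, P.a_pos]

lemma sin_diff_pos : 0 < P.b * P.a' - P.a * P.b' := by
  have : P.b * P.a' - P.a * P.b' = Real.sin (P.θ - P.φ) := by rw [Real.sin_sub]; rfl
  rw [this]
  exact Real.sin_pos_of_pos_of_lt_pi (by linarith [P.φ_lt])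
    (by linarith [P.φ_pos, P.θ_lt, Real.pi_pos])

lemma c_mul_a : P.c * P.a = 2 * P.b * P.b' := by
  rw [c, div_mul_cancel₀ _ P.a_pos.ne']

lemma c_pos : 0 < P.c := by
  have := P.b_pos; have := P.b'_pos; have := P.a_pos
  rw [c]; positivity

lemma c_lt_one : P.c < 1 := by
  have h : P.c * P.a < 1 * P.a := by
    rw [c_mul_a]
    nlinarith [P.b_lt_half, P.b'_lt, P.b'_pos, P.lt_a]
  exact lt_of_mul_lt_mul_right h P.a_pos.le

lemma Δ_pos : 0 < P.Δ := div_pos P.φ_pos (by exact_mod_cast P.N_pos)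

lemma Δ_mul_N : P.N * P.Δ = P.φ := by
  have : (P.N : ℝ) ≠ 0 := by exact_mod_cast P.N_pos.ne'
  rw [Δ]; field_simp

lemma Δ_le : P.Δ ≤ P.φ := div_le_self P.φ_pos.le (by exact_mod_cast P.N_pos)

lemma cos_half_pos : 0 < Real.cos (P.Δ / 2) :=
  Real.cos_pos_of_mem_Ioo ⟨by linarith [P.Δ_pos, Real.pi_pos],
    by linarith [P.Δ_pos, P.Δ_le, P.φ_lt, P.θ_lt, Real.pi_pos]⟩

lemma R_mul_cos : P.R * Real.cos (P.Δ / 2) = 2 := div_mul_cancel₀ _ P.cos_half_pos.ne'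

lemma two_le_R : 2 ≤ P.R := by
  have h1 := P.R_mul_cos
  have h2 := P.cos_half_pos
  have h3 := Real.cos_le_one (P.Δ / 2)
  by_contra! h
  nlinarith

lemma T_pos : 0 < P.T :=
  mul_pos (by linarith [P.two_le_R]) (Real.sin_pos_of_pos_of_lt_pi (by linarith [P.Δ_pos])
    (by linarith [P.Δ_pos, P.Δ_le, P.φ_lt, P.θ_lt, Real.pi_pos]))

lemma R_sq : P.R ^ 2 = 4 + P.T ^ 2 := by
  have h1 := P.R_mul_cos
  have h2 := Real.cos_sq_add_sin_sq (P.Δ / 2)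
  have : P.R ^ 2 = (P.R * Real.cos (P.Δ / 2)) ^ 2 + (P.R * Real.sin (P.Δ / 2)) ^ 2 := by
    linear_combination -P.R ^ 2 * h2
  rw [this, h1, T]; ring

lemma cos_diff_nonneg : 0 ≤ Real.cos (P.θ - P.φ) :=
  Real.cos_nonneg_of_mem_Icc ⟨by linarith [P.φ_lt, Real.pi_pos],
    by linarith [P.φ_pos, P.θ_lt, Real.pi_pos]⟩

lemma bound : (P.R - 1) ^ 2 + 1 + 2 * (P.R - 1) * Real.cos (P.θ - P.φ) < 4 := P.radius_bound

lemma R_sub_one_sq : (P.R - 1) ^ 2 ≤ 3 := by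
  have h1 : 0 ≤ P.R - 1 := by linarith [P.two_le_R]
  nlinarith [P.bound, mul_nonneg h1 P.cos_diff_nonneg]

lemma R_lt : P.R < 3 := by nlinarith [P.R_sub_one_sq, P.two_le_R]

lemma ψ_nonneg {j : ℕ} (hj : j ≤ P.N) : 0 ≤ P.ψ j := by
  have h1 : (j : ℝ) ≤ P.N := by exact_mod_cast hj
  have := P.Δ_mul_N
  rw [ψ]; nlinarith [P.Δ_pos]

lemma ψ_le (j : ℕ) : P.ψ j ≤ P.φ := by
  rw [ψ]; nlinarith [P.Δ_pos]

lemma ψ_zero : P.ψ 0 = P.φ := by simp [ψ]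

lemma ψ_N : P.ψ P.N = 0 := by rw [ψ, Δ_mul_N, sub_self]

lemma ψ_succ (j : ℕ) : P.ψ (j + 1) = P.ψ j - P.Δ := by simp only [ψ]; push_cast; ring

lemma sin_ψ_nonneg {j : ℕ} (hj : j ≤ P.N) : 0 ≤ Real.sin (P.ψ j) :=
  Real.sin_nonneg_of_nonneg_of_le_pi (P.ψ_nonneg hj)
    (by linarith [P.ψ_le j, P.φ_lt, P.θ_lt, Real.pi_pos])

/-- The upper chain of vertices of the workspace. -/
def V : ℕ → Plane
  -- Vertices 0 to 3 are the right spike, the far end of the corridor and the upper tip: a rectangle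
  -- of width 2 and length 17 in direction (b, a).
  | 0 => pt (P.c + 2 * P.a) 0
  | 1 => pt (P.c + 2 * P.a + 17 * P.b) (17 * P.a)
  | 2 => pt (P.c + 17 * P.b) (2 * P.b + 17 * P.a)
  | 3 => pt P.c (2 * P.b)
  -- A cap of depth 1 and width 2 closes the channel above the tip, in the slightly steeper
  -- direction (b', a').
  | 4 => pt (P.c + P.b') (2 * P.b + P.a')
  | 5 => pt (P.c + P.b' - 2 * P.a') (2 * P.b + P.a' + 2 * P.b')
  -- Consecutive tangents meet halfway between their contact angles, at distance `R` from the tip.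
  -- The last contact angle is 0, so the final edge is vertical and ends on the axis.
  | k + 6 => if k < P.N then
      pt (P.c - P.R * Real.cos (P.ψ k - P.Δ / 2)) (2 * P.b + P.R * Real.sin (P.ψ k - P.Δ / 2))
    else pt (P.c - 2) 0

/-- The points of the tangent to the circle of radius two about the tip, at the `j`-th contact
point of the polygonal arc. -/
def tangent (j : ℕ) (τ : ℝ) : Plane :=
  pt (P.c - 2 * Real.cos (P.ψ j) - τ * Real.sin (P.ψ j))
    (2 * P.b + 2 * Real.sin (P.ψ j) - τ * Real.cos (P.ψ j))

/-- Edge `j + 5` lies on the tangent at angle `ψ j`, between the offsets `-T` and `T`. Exceptions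
are the first edge, which begins at offset -1 at the cap, and the last, which runs down to the axis
at offset `2 * b`. -/
lemma V_arc_right {j : ℕ} (hj : j ≤ P.N) :
    P.V (j + 5 + 1) = P.tangent j (if j = P.N then 2 * P.b else P.T) := by
  rw [show j + 5 + 1 = j + 6 by rfl, V]
  split_ifs with h1 h2 h2
  · omega
  · have h := P.R_mul_cos
    rw [tangent, Real.cos_sub, Real.sin_sub, T]
    refine plane_ext ?_ ?_
    · simp only [pt_zero]; linear_combination -Real.cos (P.ψ j) * h
    · simp only [pt_one]; linear_combination Real.sin (P.ψ j) * h
  · rw [tangent, h2, ψ_N]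
    refine plane_ext ?_ ?_ <;> simp
  · omega

lemma V_arc_left {j : ℕ} (hj : j ≤ P.N) :
    P.V (j + 5) = P.tangent j (if j = 0 then -1 else -P.T) := by
  rcases j with _ | j
  · rw [tangent, ψ_zero, if_pos rfl]
    show pt _ _ = _
    refine plane_ext ?_ ?_
    · simp only [pt_zero, b', a']; ring
    · simp only [pt_one, b', a']; ring
  · rw [if_neg (by omega), show j + 1 + 5 = j + 6 by rfl, V, if_pos (by omega), tangent, ψ_succ]
    have h := P.R_mul_cos
    rw [show P.ψ j - P.Δ / 2 = (P.ψ j - P.Δ) + P.Δ / 2 by ring, Real.cos_add, Real.sin_add, T]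
    refine plane_ext ?_ ?_
    · simp only [pt_zero]; linear_combination -Real.cos (P.ψ j - P.Δ) * h
    · simp only [pt_one]; linear_combination Real.sin (P.ψ j - P.Δ) * h

/-- The number of edges of the upper chain. -/
def m : ℕ := P.N + 6

lemma V_arc_coord {k : ℕ} (hk : k < P.N) :
    P.V (k + 6) 0 ≤ P.c ∧ 2 * P.b ≤ P.V (k + 6) 1 := by
  have h0 : 0 < P.ψ k - P.Δ / 2 := by
    have := P.ψ_nonneg (j := k + 1) hk
    rw [ψ_succ] at this
    linarith [P.Δ_pos]
  have h1 : P.ψ k - P.Δ / 2 ≤ Real.pi / 2 := by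
    linarith [P.ψ_le k, P.φ_lt, P.θ_lt, Real.pi_pos, P.Δ_pos]
  have h2 := Real.cos_nonneg_of_mem_Icc (x := P.ψ k - P.Δ / 2) ⟨by linarith [Real.pi_pos], h1⟩
  have h3 := Real.sin_nonneg_of_nonneg_of_le_pi (x := P.ψ k - P.Δ / 2) h0.le
    (by linarith [Real.pi_pos])
  have hR : 0 ≤ P.R := by linarith [P.two_le_R]
  rw [V, if_pos hk]
  simp only [pt_zero, pt_one]
  constructor <;> nlinarith [mul_nonneg hR h2, mul_nonneg hR h3]

lemma V_last : P.V P.m = pt (P.c - 2) 0 := by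
  rw [m, V, if_neg (lt_irrefl _)]

lemma cross_tangent (j : ℕ) (σ τ : ℝ) : cross (P.tangent j σ) (P.tangent j τ) =
    (τ - σ) * (2 - P.c * Real.cos (P.ψ j) + 2 * P.b * Real.sin (P.ψ j)) := by
  simp only [cross, tangent, pt_zero, pt_one]
  linear_combination 2 * (τ - σ) * Real.cos_sq_add_sin_sq (P.ψ j)

theorem isUpperChain : IsUpperChain P.m P.V := by
  have ha := P.a_pos
  have hb := P.b_pos
  have ha' := P.a'_pos
  have hb' := P.b'_pos
  have hc := P.c_pos
  have hc1 := P.c_lt_one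
  have hca := P.c_mul_a
  have h1 := P.sq_add_sq
  have h2 := P.sq_add_sq'
  have hbb := P.b'_lt
  have haa := P.a_lt
  refine ⟨by simp [m], ?_, rfl, ?_, ?_, ?_, ?_⟩
  · simp only [V, pt_zero]; positivity
  · rw [V_last, pt_zero]; linarith
  · rw [V_last, pt_one]
  · intro i hi him
    match i, hi with
    | 1, _ => simp only [V, pt_one]; positivity
    | 2, _ => simp only [V, pt_one]; positivity
    | 3, _ => simp only [V, pt_one]; positivity
    | 4, _ => simp only [V, pt_one]; positivity
    | 5, _ => simp only [V, pt_one]; positivity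
    | k + 6, _ =>
      have := (P.V_arc_coord (k := k) (by simp only [m] at him; omega)).2
      linarith
  · intro i him
    match i with
    | 0 =>
      simp only [V, cross, pt_one, pt_zero]
      nlinarith [mul_pos hc ha, mul_pos ha ha]
    | 1 =>
      simp only [V, cross, pt_one, pt_zero]
      nlinarith [mul_pos hc hb, mul_pos ha hb]
    -- Here and in the next case the value of `c` matters. Since 2bb'/a' < c < 2b²/a, the lines
    -- through the upper tip in directions (b, a) and (b', a') meet the axis on different sides of
    -- the origin, so the origin sees both sides of the spike.
    | 2 =>
      simp only [V, cross, pt_one, pt_zero]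
      nlinarith [mul_pos hb (sub_pos.2 hbb)]
    | 3 =>
      simp only [V, cross, pt_one, pt_zero]
      nlinarith [mul_pos hc (sub_pos.2 haa)]
    | 4 =>
      simp only [V, cross, pt_one, pt_zero]
      nlinarith [mul_pos hc hb', mul_pos hb ha']
    | j + 5 =>
      have hj : j ≤ P.N := by simp only [m] at him; omega
      rw [P.V_arc_left hj, P.V_arc_right hj, cross_tangent]
      have hT := P.T_pos
      refine mul_pos (by split_ifs <;> linarith) ?_
      have := Real.cos_le_one (P.ψ j)
      nlinarith [mul_nonneg hb.le (P.sin_ψ_nonneg hj)]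

/-- The polygon bounding the workspace. -/
def polygon : Polygon Plane (2 * P.m) := symmPolygon P.m P.V

/-- The free space of the workspace. -/
def free : Set Plane := freeSpace (region P.polygon)

lemma mem_arcEdge {j : ℕ} (hj : j ≤ P.N) {z : Plane} (hz : z ∈ chainEdge P.V (j + 5)) :
    ∃ τ : ℝ, z = P.tangent j τ ∧ (if j = 0 then -1 else -P.T) ≤ τ ∧
      τ ≤ if j = P.N then 2 * P.b else P.T := by
  rw [chainEdge, P.V_arc_left hj, P.V_arc_right hj] at hz
  have hT := P.T_pos
  have hb := P.b_pos
  have hlt : (if j = 0 then -1 else -P.T) < if j = P.N then 2 * P.b else P.T := by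
    split_ifs <;> linarith
  generalize (if j = 0 then -1 else -P.T) = σ at *
  generalize (if j = P.N then 2 * P.b else P.T) = τ at *
  obtain ⟨s, hs, hs1, e0, e1⟩ := mem_segment_coord hz
  refine ⟨σ + s * (τ - σ), plane_ext ?_ ?_, by nlinarith, by nlinarith⟩
  · rw [e0]; simp only [tangent, pt_zero]; ring
  · rw [e1]; simp only [tangent, pt_one]; ring

/-- Pythagoras at the contact point; hence the arc stays outside the circle of radius 2 about the
tip. -/
lemma tangent_norm_sq (j : ℕ) (τ : ℝ) :
    (P.tangent j τ 0 - P.c) ^ 2 + (P.tangent j τ 1 - 2 * P.b) ^ 2 = 4 + τ ^ 2 := by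
  simp only [tangent, pt_zero, pt_one]
  linear_combination (4 + τ ^ 2) * Real.cos_sq_add_sin_sq (P.ψ j)

lemma four_le_arcEdge {j : ℕ} (hj : j ≤ P.N) {z : Plane} (hz : z ∈ chainEdge P.V (j + 5)) :
    4 ≤ (z 0 - P.c) ^ 2 + (z 1 - 2 * P.b) ^ 2 := by
  obtain ⟨τ, rfl, -⟩ := P.mem_arcEdge hj hz
  rw [tangent_norm_sq]
  nlinarith [sq_nonneg τ]

lemma arcEdge_coord {j : ℕ} (hj : j < P.N) {z : Plane} (hz : z ∈ chainEdge P.V (j + 5)) :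
    z 0 ≤ P.c ∧ 2 * P.b ≤ z 1 := by
  have h1 : P.V (j + 5) 0 ≤ P.c ∧ 2 * P.b ≤ P.V (j + 5) 1 := by
    rcases j with _ | j
    · simp only [V, pt_zero, pt_one]
      have := P.a_lt; have := P.lt_a; have := P.b'_lt; have := P.b_lt_half; have := P.b'_pos
      constructor <;> linarith
    · exact P.V_arc_coord (by omega)
  have h2 := P.V_arc_coord hj
  obtain ⟨s, hs, hs1, e0, e1⟩ := mem_segment_coord hz
  rw [e0, e1]
  constructor <;> nlinarith [h1.1, h1.2, h2.1, h2.2]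

lemma lastEdge_coord {z : Plane} (hz : z ∈ chainEdge P.V (P.N + 5)) : z 0 = P.c - 2 := by
  obtain ⟨τ, rfl, -⟩ := P.mem_arcEdge le_rfl hz
  simp [tangent, ψ_N]

end Params

end
end UnlabeledMRMP

/-! ### Positions at distance one from the boundary -/

namespace UnlabeledMRMP
noncomputable section
namespace Params

variable (P : Params)

/-- The point with the given coordinates relative to the upper tip. -/
def tipPt (w₁ w₂ : ℝ) : Plane := pt (P.c + w₁) (2 * P.b + w₂)

lemma tipPt_eq (x : Plane) : P.tipPt (x 0 - P.c) (x 1 - 2 * P.b) = x :=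
  plane_ext (by simp [tipPt]) (by simp [tipPt])

@[simp] lemma tipPt_zero (w₁ w₂ : ℝ) : P.tipPt w₁ w₂ 0 = P.c + w₁ := rfl

@[simp] lemma tipPt_one (w₁ w₂ : ℝ) : P.tipPt w₁ w₂ 1 = 2 * P.b + w₂ := rfl

/-- The point with the given coordinates relative to the upper tip keeps distance one from the
boundary. -/
def Clear (w₁ w₂ : ℝ) : Prop := ∀ z ∈ P.polygon.boundary ℝ, 1 ≤ dist (P.tipPt w₁ w₂) z

lemma one_le_dist_tipPt (w₁ w₂ : ℝ) (z : Plane) : 1 ≤ dist (P.tipPt w₁ w₂) z ↔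
    1 ≤ (w₁ - (z 0 - P.c)) ^ 2 + (w₂ - (z 1 - 2 * P.b)) ^ 2 := by
  rw [le_dist_iff zero_le_one, tipPt_zero, tipPt_one, one_pow]
  ring_nf

lemma mem_edge0_iff (z : Plane) : z ∈ chainEdge P.V 0 ↔
    ∃ s : ℝ, 0 ≤ s ∧ s ≤ 17 ∧ z = P.tipPt (2 * P.a + s * P.b) (-2 * P.b + s * P.a) := by
  constructor
  · intro hz
    obtain ⟨s, hs, hs1, e0, e1⟩ := mem_segment_coord hz
    simp only [V, pt_zero, pt_one] at e0 e1
    exact ⟨17 * s, by linarith, by linarith, plane_ext (by rw [e0, tipPt_zero]; ring)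
      (by rw [e1, tipPt_one]; ring)⟩
  · rintro ⟨s, hs, hs1, rfl⟩
    refine mem_segment_of_coord (s := s / 17) (by positivity) (by linarith) ?_ ?_
    · simp only [V, tipPt_zero, pt_zero]; ring
    · simp only [V, tipPt_one, pt_one]; ring

lemma mem_edge1_iff (z : Plane) : z ∈ chainEdge P.V 1 ↔
    ∃ s : ℝ, 0 ≤ s ∧ s ≤ 2 ∧ z = P.tipPt (17 * P.b + s * P.a) (17 * P.a - s * P.b) := by
  constructor
  · intro hz
    obtain ⟨s, hs, hs1, e0, e1⟩ := mem_segment_coord hz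
    simp only [V, pt_zero, pt_one] at e0 e1
    exact ⟨2 * (1 - s), by linarith, by linarith, plane_ext (by rw [e0, tipPt_zero]; ring)
      (by rw [e1, tipPt_one]; ring)⟩
  · rintro ⟨s, hs, hs1, rfl⟩
    refine mem_segment_of_coord (s := 1 - s / 2) (by linarith) (by linarith) ?_ ?_
    · simp only [V, tipPt_zero, pt_zero]; ring
    · simp only [V, tipPt_one, pt_one]; ring

lemma mem_edge2_iff (z : Plane) : z ∈ chainEdge P.V 2 ↔
    ∃ s : ℝ, 0 ≤ s ∧ s ≤ 17 ∧ z = P.tipPt (s * P.b) (s * P.a) := by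
  constructor
  · intro hz
    obtain ⟨s, hs, hs1, e0, e1⟩ := mem_segment_coord hz
    simp only [V, pt_zero, pt_one] at e0 e1
    exact ⟨17 * (1 - s), by linarith, by linarith, plane_ext (by rw [e0, tipPt_zero]; ring)
      (by rw [e1, tipPt_one]; ring)⟩
  · rintro ⟨s, hs, hs1, rfl⟩
    refine mem_segment_of_coord (s := 1 - s / 17) (by linarith) (by linarith) ?_ ?_
    · simp only [V, tipPt_zero, pt_zero]; ring
    · simp only [V, tipPt_one, pt_one]; ring

lemma mem_edge3_iff (z : Plane) : z ∈ chainEdge P.V 3 ↔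
    ∃ s : ℝ, 0 ≤ s ∧ s ≤ 1 ∧ z = P.tipPt (s * P.b') (s * P.a') := by
  constructor
  · intro hz
    obtain ⟨s, hs, hs1, e0, e1⟩ := mem_segment_coord hz
    simp only [V, pt_zero, pt_one] at e0 e1
    exact ⟨s, hs, hs1, plane_ext (by rw [e0, tipPt_zero]; ring) (by rw [e1, tipPt_one]; ring)⟩
  · rintro ⟨s, hs, hs1, rfl⟩
    refine mem_segment_of_coord hs hs1 ?_ ?_
    · simp only [V, tipPt_zero, pt_zero]; ring
    · simp only [V, tipPt_one, pt_one]; ring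

lemma mem_edge4_iff (z : Plane) : z ∈ chainEdge P.V 4 ↔
    ∃ s : ℝ, 0 ≤ s ∧ s ≤ 2 ∧ z = P.tipPt (P.b' - s * P.a') (P.a' + s * P.b') := by
  constructor
  · intro hz
    obtain ⟨s, hs, hs1, e0, e1⟩ := mem_segment_coord hz
    simp only [V, pt_zero, pt_one] at e0 e1
    exact ⟨2 * s, by linarith, by linarith, plane_ext (by rw [e0, tipPt_zero]; ring)
      (by rw [e1, tipPt_one]; ring)⟩
  · rintro ⟨s, hs, hs1, rfl⟩
    refine mem_segment_of_coord (s := s / 2) (by linarith) (by linarith) ?_ ?_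
    · simp only [V, tipPt_zero, pt_zero]; ring
    · simp only [V, tipPt_one, pt_one]; ring

lemma tangent_mem_arcEdge {j : ℕ} (hj : j ≤ P.N) {τ : ℝ}
    (h1 : (if j = 0 then -1 else -P.T) ≤ τ) (h2 : τ ≤ if j = P.N then 2 * P.b else P.T) :
    P.tangent j τ ∈ chainEdge P.V (j + 5) := by
  rw [chainEdge, P.V_arc_left hj, P.V_arc_right hj]
  have hT := P.T_pos
  have hb := P.b_pos
  have hlt : (if j = 0 then -1 else -P.T) < if j = P.N then 2 * P.b else P.T := by
    split_ifs <;> linarith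
  generalize (if j = 0 then -1 else -P.T) = σ at *
  generalize (if j = P.N then 2 * P.b else P.T) = ρ at *
  have hne : ρ - σ ≠ 0 := by linarith
  refine mem_segment_of_coord (s := (τ - σ) / (ρ - σ)) (div_nonneg (by linarith) (by linarith))
    ((div_le_one (by linarith)).2 (by linarith)) ?_ ?_
  · simp only [tangent, pt_zero]
    field_simp
    ring
  · simp only [tangent, pt_one]
    field_simp
    ring

/-- A criterion for keeping distance one from the boundary. -/
lemma clear_of {w₁ w₂ : ℝ} (h : 0 ≤ 2 * P.b + w₂)
    (h0 : ∀ s, 0 ≤ s → s ≤ 17 →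
      1 ≤ (w₁ - (2 * P.a + s * P.b)) ^ 2 + (w₂ - (-2 * P.b + s * P.a)) ^ 2)
    (h1 : ∀ s, 0 ≤ s → s ≤ 2 →
      1 ≤ (w₁ - (17 * P.b + s * P.a)) ^ 2 + (w₂ - (17 * P.a - s * P.b)) ^ 2)
    (h2 : ∀ s, 0 ≤ s → s ≤ 17 → 1 ≤ (w₁ - s * P.b) ^ 2 + (w₂ - s * P.a) ^ 2)
    (h3 : ∀ s, 0 ≤ s → s ≤ 1 → 1 ≤ (w₁ - s * P.b') ^ 2 + (w₂ - s * P.a') ^ 2)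
    (h4 : ∀ s, 0 ≤ s → s ≤ 2 →
      1 ≤ (w₁ - (P.b' - s * P.a')) ^ 2 + (w₂ - (P.a' + s * P.b')) ^ 2)
    (h5 : ∀ j ≤ P.N, ∀ z ∈ chainEdge P.V (j + 5), 1 ≤ dist (P.tipPt w₁ w₂) z) :
    P.Clear w₁ w₂ := by
  refine P.isUpperChain.one_le_dist_boundary (by simpa using h) fun i hi z hz => ?_
  match i with
  | 0 =>
    obtain ⟨s, hs, hs1, rfl⟩ := (P.mem_edge0_iff z).1 hz
    rw [one_le_dist_tipPt]
    simp only [tipPt_zero, tipPt_one, add_sub_cancel_left]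
    exact h0 s hs hs1
  | 1 =>
    obtain ⟨s, hs, hs1, rfl⟩ := (P.mem_edge1_iff z).1 hz
    rw [one_le_dist_tipPt]
    simp only [tipPt_zero, tipPt_one, add_sub_cancel_left]
    exact h1 s hs hs1
  | 2 =>
    obtain ⟨s, hs, hs1, rfl⟩ := (P.mem_edge2_iff z).1 hz
    rw [one_le_dist_tipPt]
    simp only [tipPt_zero, tipPt_one, add_sub_cancel_left]
    exact h2 s hs hs1
  | 3 =>
    obtain ⟨s, hs, hs1, rfl⟩ := (P.mem_edge3_iff z).1 hz
    rw [one_le_dist_tipPt]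
    simp only [tipPt_zero, tipPt_one, add_sub_cancel_left]
    exact h3 s hs hs1
  | 4 =>
    obtain ⟨s, hs, hs1, rfl⟩ := (P.mem_edge4_iff z).1 hz
    rw [one_le_dist_tipPt]
    simp only [tipPt_zero, tipPt_one, add_sub_cancel_left]
    exact h4 s hs hs1
  | j + 5 => exact h5 j (by simp only [m] at hi; omega) z hz

/-- Points in the triangle spanned by the three spikes keep distance one from the boundary if they
keep distance one from the spikes. -/
lemma clear_triangle {w₁ w₂ : ℝ} (h0 : 0 ≤ w₁) (h : 0 ≤ 2 * P.b + w₂)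
    (hu : P.b * w₁ + P.a * w₂ ≤ 0) (h1 : 1 ≤ w₁ ^ 2 + w₂ ^ 2)
    (h2 : 1 ≤ (w₁ - 2 * P.a) ^ 2 + (w₂ + 2 * P.b) ^ 2) : P.Clear w₁ w₂ := by
  have ha := P.a_pos
  have hb := P.b_pos
  have ha' := P.a'_pos
  have hb' := P.b'_pos
  have hab := P.sq_add_sq
  have hab' := P.sq_add_sq'
  have hw2 : w₂ ≤ 0 := by
    by_contra! hpos
    nlinarith [mul_nonneg hb.le h0, mul_pos ha hpos]
  have hu' : P.b' * w₁ + P.a' * w₂ ≤ 0 := by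
    have : P.a * (P.b' * w₁ + P.a' * w₂)
        = P.a' * (P.b * w₁ + P.a * w₂) - (P.b * P.a' - P.a * P.b') * w₁ := by ring
    have h3 : P.a * (P.b' * w₁ + P.a' * w₂) ≤ 0 := by
      rw [this]
      nlinarith [mul_nonneg P.sin_diff_pos.le h0]
    by_contra! hpos
    nlinarith [mul_pos ha hpos]
  refine P.clear_of h (fun s hs _ => ?_) (fun s hs hs1 => ?_) (fun s hs _ => ?_)
    (fun s hs _ => ?_) (fun s hs _ => ?_) (fun j hj z hz => ?_)
  · have : (w₁ - (2 * P.a + s * P.b)) ^ 2 + (w₂ - (-2 * P.b + s * P.a)) ^ 2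
        = (w₁ - 2 * P.a) ^ 2 + (w₂ + 2 * P.b) ^ 2 - 2 * s * (P.b * w₁ + P.a * w₂) + s ^ 2 := by
      linear_combination s ^ 2 * hab
    rw [this]
    nlinarith [mul_nonneg hs (neg_nonneg.2 hu), sq_nonneg s]
  · have : (w₁ - (17 * P.b + s * P.a)) ^ 2 + (w₂ - (17 * P.a - s * P.b)) ^ 2
        = (17 - (P.b * w₁ + P.a * w₂)) ^ 2 + (P.a * w₁ - P.b * w₂ - s) ^ 2 := by
      linear_combination (289 + s ^ 2 - w₁ ^ 2 - w₂ ^ 2) * hab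
    rw [this]
    nlinarith [sq_nonneg (P.a * w₁ - P.b * w₂ - s)]
  · have : (w₁ - s * P.b) ^ 2 + (w₂ - s * P.a) ^ 2
        = w₁ ^ 2 + w₂ ^ 2 - 2 * s * (P.b * w₁ + P.a * w₂) + s ^ 2 := by
      linear_combination s ^ 2 * hab
    rw [this]
    nlinarith [mul_nonneg hs (neg_nonneg.2 hu), sq_nonneg s]
  · have : (w₁ - s * P.b') ^ 2 + (w₂ - s * P.a') ^ 2
        = w₁ ^ 2 + w₂ ^ 2 - 2 * s * (P.b' * w₁ + P.a' * w₂) + s ^ 2 := by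
      linear_combination s ^ 2 * hab'
    rw [this]
    nlinarith [mul_nonneg hs (neg_nonneg.2 hu'), sq_nonneg s]
  · have : (w₁ - (P.b' - s * P.a')) ^ 2 + (w₂ - (P.a' + s * P.b')) ^ 2
        = w₁ ^ 2 + w₂ ^ 2 - 2 * (P.b' * w₁ + P.a' * w₂) + 1
          + 2 * s * (P.a' * w₁ - P.b' * w₂) + s ^ 2 := by
      linear_combination (1 + s ^ 2) * hab'
    have h3 : 0 ≤ P.a' * w₁ - P.b' * w₂ := by
      nlinarith [mul_nonneg ha'.le h0, mul_nonneg hb'.le (neg_nonneg.2 hw2)]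
    rw [this]
    nlinarith [mul_nonneg hs h3, sq_nonneg s]
  · rw [one_le_dist_tipPt]
    rcases hj.lt_or_eq with hj | rfl
    · obtain ⟨z1, z2⟩ := P.arcEdge_coord hj hz
      nlinarith [P.four_le_arcEdge hj.le hz, mul_nonneg h0 (sub_nonneg.2 z1),
        mul_nonneg (neg_nonneg.2 hw2) (sub_nonneg.2 z2)]
    · rw [P.lastEdge_coord hz]
      nlinarith [sq_nonneg (w₂ - (z 1 - 2 * P.b))]

/-- The centerline of the corridor keeps distance one from the boundary. -/
lemma clear_corridor {t : ℝ} (ht : 0 ≤ t) (ht1 : t ≤ 16) :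
    P.Clear (P.a + t * P.b) (-P.b + t * P.a) := by
  have ha := P.a_pos
  have hb := P.b_pos
  have ha' := P.a'_pos
  have hb' := P.b'_pos
  have hab := P.sq_add_sq
  have hsd := P.sin_diff_pos
  -- The centerline has distance 1 from the line carrying the wall at the tip, so everything beyond
  -- that line is far enough.
  have key : ∀ z₁ z₂ : ℝ, P.a * z₁ - P.b * z₂ ≤ 0 →
      1 ≤ (P.a + t * P.b - z₁) ^ 2 + (-P.b + t * P.a - z₂) ^ 2 := by
    intro z₁ z₂ hz
    have : (P.a + t * P.b - z₁) ^ 2 + (-P.b + t * P.a - z₂) ^ 2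
        = (1 - (P.a * z₁ - P.b * z₂)) ^ 2 + (t - (P.b * z₁ + P.a * z₂)) ^ 2 := by
      linear_combination (t ^ 2 + 1 - z₁ ^ 2 - z₂ ^ 2) * hab
    rw [this]
    nlinarith [sq_nonneg (t - (P.b * z₁ + P.a * z₂))]
  refine P.clear_of (by nlinarith) (fun s hs _ => ?_) (fun s hs hs1 => ?_) (fun s hs _ => ?_)
    (fun s hs _ => ?_) (fun s hs _ => ?_) (fun j hj z hz => ?_)
  · have : (P.a + t * P.b - (2 * P.a + s * P.b)) ^ 2 + (-P.b + t * P.a - (-2 * P.b + s * P.a)) ^ 2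
        = 1 + (t - s) ^ 2 := by
      linear_combination (1 + (t - s) ^ 2) * hab
    rw [this]
    nlinarith [sq_nonneg (t - s)]
  · have : (P.a + t * P.b - (17 * P.b + s * P.a)) ^ 2 + (-P.b + t * P.a - (17 * P.a - s * P.b)) ^ 2
        = (17 - t) ^ 2 + (1 - s) ^ 2 := by
      linear_combination ((17 - t) ^ 2 + (1 - s) ^ 2) * hab
    rw [this]
    nlinarith [sq_nonneg (1 - s)]
  · exact key _ _ (by nlinarith)
  · exact key _ _ (by nlinarith [mul_nonneg hs hsd.le])
  · refine key _ _ ?_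
    have h1 : 0 < P.a * P.a' + P.b * P.b' := by positivity
    nlinarith [mul_nonneg hs h1.le]
  · rw [one_le_dist_tipPt]
    rcases hj.lt_or_eq with hj | rfl
    · obtain ⟨z1, z2⟩ := P.arcEdge_coord hj hz
      refine key _ _ ?_
      nlinarith [mul_nonneg ha.le (sub_nonneg.2 z1), mul_nonneg hb.le (sub_nonneg.2 z2)]
    · rw [P.lastEdge_coord hz]
      nlinarith [sq_nonneg (-P.b + t * P.a - (z 1 - 2 * P.b)), mul_nonneg ht hb.le]

/-- Points to the left of the tip keep distance one from the boundary if they keep distance one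
from the tip and the polygonal arc. -/
lemma clear_left {w₁ w₂ : ℝ} (h0 : w₁ ≤ 0) (h : 0 ≤ 2 * P.b + w₂)
    (hu' : P.b' * w₁ + P.a' * w₂ ≤ 0) (h1 : 1 ≤ w₁ ^ 2 + w₂ ^ 2)
    (h5 : ∀ j ≤ P.N, ∀ z ∈ chainEdge P.V (j + 5), 1 ≤ dist (P.tipPt w₁ w₂) z) :
    P.Clear w₁ w₂ := by
  have ha := P.a_pos
  have hb := P.b_pos
  have ha' := P.a'_pos
  have hb' := P.b'_pos
  have hab := P.sq_add_sq
  have hab' := P.sq_add_sq'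
  have hu : P.b * w₁ + P.a * w₂ ≤ 0 := by
    have : P.a' * (P.b * w₁ + P.a * w₂)
        = P.a * (P.b' * w₁ + P.a' * w₂) + (P.b * P.a' - P.a * P.b') * w₁ := by ring
    have h3 : P.a' * (P.b * w₁ + P.a * w₂) ≤ 0 := by
      rw [this]
      nlinarith [mul_nonneg P.sin_diff_pos.le (neg_nonneg.2 h0)]
    by_contra! hpos
    nlinarith [mul_pos ha' hpos]
  have far : ∀ z₁ z₂ : ℝ, 1 ≤ z₁ → 1 ≤ (w₁ - z₁) ^ 2 + (w₂ - z₂) ^ 2 := by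
    intro z₁ z₂ hz
    nlinarith [sq_nonneg (w₂ - z₂)]
  refine P.clear_of h (fun s hs _ => ?_) (fun s hs hs1 => ?_) (fun s hs _ => ?_)
    (fun s hs _ => ?_) (fun s hs _ => ?_) h5
  · exact far _ _ (by nlinarith [P.lt_a])
  · exact far _ _ (by nlinarith [P.le_b', P.b'_lt])
  · have : (w₁ - s * P.b) ^ 2 + (w₂ - s * P.a) ^ 2
        = w₁ ^ 2 + w₂ ^ 2 - 2 * s * (P.b * w₁ + P.a * w₂) + s ^ 2 := by
      linear_combination s ^ 2 * hab
    rw [this]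
    nlinarith [mul_nonneg hs (neg_nonneg.2 hu), sq_nonneg s]
  · have : (w₁ - s * P.b') ^ 2 + (w₂ - s * P.a') ^ 2
        = w₁ ^ 2 + w₂ ^ 2 - 2 * s * (P.b' * w₁ + P.a' * w₂) + s ^ 2 := by
      linear_combination s ^ 2 * hab'
    rw [this]
    nlinarith [mul_nonneg hs (neg_nonneg.2 hu'), sq_nonneg s]
  · have : (w₁ - (P.b' - s * P.a')) ^ 2 + (w₂ - (P.a' + s * P.b')) ^ 2
        = (1 - (P.b' * w₁ + P.a' * w₂)) ^ 2 + (P.a' * w₁ - P.b' * w₂ + s) ^ 2 := by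
      linear_combination (1 + s ^ 2 - w₁ ^ 2 - w₂ ^ 2) * hab'
    rw [this]
    nlinarith [sq_nonneg (P.a' * w₁ - P.b' * w₂ + s)]

/-- Below the tip, the arc is nearest in the extreme case where a point of it, at distance r ≥ 2
from the tip, lies straight to the left; then the horizontal gap is at least r + w₁ ≥ 1. The last
edge lies on w₁ = -2. -/
lemma clear_left_low {w₁ w₂ : ℝ} (h0 : w₁ ≤ 0) (h1 : -1 ≤ w₁) (h : 0 ≤ 2 * P.b + w₂)
    (h2 : w₂ ≤ 0) (hn : 1 ≤ w₁ ^ 2 + w₂ ^ 2) : P.Clear w₁ w₂ := by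
  refine P.clear_left h0 h (by nlinarith [P.b'_pos, P.a'_pos]) hn fun j hj z hz => ?_
  rw [one_le_dist_tipPt]
  rcases hj.lt_or_eq with hj | rfl
  · obtain ⟨z1, z2⟩ := P.arcEdge_coord hj hz
    have h4 := P.four_le_arcEdge hj.le hz
    have hq : 0 ≤ z 1 - 2 * P.b := by linarith
    generalize z 0 - P.c = p at *
    generalize z 1 - 2 * P.b = q at *
    have hr : 2 ≤ √(p ^ 2 + q ^ 2) := Real.le_sqrt_of_sq_le (by linarith)
    have hr2 : √(p ^ 2 + q ^ 2) ^ 2 = p ^ 2 + q ^ 2 := Real.sq_sqrt (by positivity)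
    have hp : -√(p ^ 2 + q ^ 2) ≤ p := (abs_le.1 (Real.abs_le_sqrt (by nlinarith))).1
    generalize √(p ^ 2 + q ^ 2) = r at *
    nlinarith [mul_nonneg hq (neg_nonneg.2 h2), sq_nonneg w₂,
      mul_nonneg (neg_nonneg.2 h0) (by linarith : 0 ≤ p + r)]
  · rw [P.lastEdge_coord hz]
    nlinarith [sq_nonneg (w₂ - (z 1 - 2 * P.b))]

/-- The arc has distance at least 2 from the tip, so the triangle inequality leaves 1 for a point of
the unit circle. -/
lemma clear_left_circle {w₁ w₂ : ℝ} (h0 : w₁ ≤ 0) (h2 : 0 ≤ w₂)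
    (hu' : P.b' * w₁ + P.a' * w₂ ≤ 0) (hn : w₁ ^ 2 + w₂ ^ 2 = 1) : P.Clear w₁ w₂ := by
  refine P.clear_left h0 (by linarith [P.b_pos]) hu' hn.ge fun j hj z hz => ?_
  rw [one_le_dist_tipPt]
  have h4 := P.four_le_arcEdge hj hz
  set p := z 0 - P.c
  set q := z 1 - 2 * P.b
  have hCS : (w₁ * p + w₂ * q) ^ 2 ≤ p ^ 2 + q ^ 2 := by
    nlinarith [sq_nonneg (w₁ * q - w₂ * p)]
  by_contra! hlt
  nlinarith [sq_nonneg (p ^ 2 + q ^ 2 - 4)]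

end Params
end
end UnlabeledMRMP

/-! ### Classification of the free positions -/

namespace UnlabeledMRMP
noncomputable section
namespace Params

variable (P : Params)

/-- Linear constraints on the part of the region behind the gates on the right. -/
lemma region_right {i : ℕ} (hi : i < 3) {z : Plane} (hz : z ∈ chainEdge P.V i) {t w₁ w₂ : ℝ}
    (ht : 0 ≤ t) (ht1 : t ≤ 1) (e : P.tipPt w₁ w₂ = t • z) :
    0 ≤ P.a * w₁ - P.b * w₂ ∧ P.a * w₁ - P.b * w₂ ≤ 2 ∧ P.b * w₁ + P.a * w₂ ≤ 17 ∧ -1 ≤ w₁ := by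
  have ha := P.a_pos
  have hb := P.b_pos
  have hb' := P.b'_pos
  have hc := P.c_pos
  have hc1 := P.c_lt_one
  have hab := P.sq_add_sq
  have hca := P.c_mul_a
  have hbb := P.b'_lt
  have hbh := P.b_lt_half
  have e0 : P.c + w₁ = t * z 0 := congrArg (fun x : Plane => x 0) e
  have e1 : 2 * P.b + w₂ = t * z 1 := congrArg (fun x : Plane => x 1) e
  obtain ⟨p, q, hpq, h1, h2, h3, h4⟩ : ∃ p q : ℝ, z = P.tipPt p q ∧ 0 ≤ P.a * p - P.b * q ∧
      P.a * p - P.b * q ≤ 2 ∧ P.b * p + P.a * q ≤ 17 ∧ 0 ≤ p := by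
    match i with
    | 0 =>
      obtain ⟨s, hs, hs1, rfl⟩ := (P.mem_edge0_iff z).1 hz
      refine ⟨_, _, rfl, by nlinarith, by nlinarith, by nlinarith, by positivity⟩
    | 1 =>
      obtain ⟨s, hs, hs1, rfl⟩ := (P.mem_edge1_iff z).1 hz
      refine ⟨_, _, rfl, by nlinarith, by nlinarith, by nlinarith, by positivity⟩
    | 2 =>
      obtain ⟨s, hs, hs1, rfl⟩ := (P.mem_edge2_iff z).1 hz
      refine ⟨_, _, rfl, by nlinarith, by nlinarith, by nlinarith, by positivity⟩
  rw [hpq, tipPt_zero] at e0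
  rw [hpq, tipPt_one] at e1
  -- A point `t • z` is a convex combination of `z` and the origin, which is (-c, -2b) relative to
  -- the tip; linear functions are averaged accordingly.
  have f1 : P.a * w₁ - P.b * w₂ = t * (P.a * p - P.b * q)
      + (1 - t) * (2 * P.b * (P.b - P.b')) := by
    linear_combination P.a * e0 - P.b * e1 - (1 - t) * hca
  have f2 : P.b * w₁ + P.a * w₂ = t * (P.b * p + P.a * q)
      - (1 - t) * (P.b * P.c + 2 * P.a * P.b) := by
    linear_combination P.b * e0 + P.a * e1
  have g2 : 2 * P.b * (P.b - P.b') ≤ 2 := by nlinarith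
  have g3 : 0 ≤ P.b * P.c + 2 * P.a * P.b := by positivity
  have ht' : 0 ≤ 1 - t := by linarith
  refine ⟨?_, ?_, ?_, ?_⟩
  · rw [f1]; positivity
  · rw [f1]; nlinarith [mul_nonneg ht (sub_nonneg.2 h2), mul_nonneg ht' (sub_nonneg.2 g2)]
  · rw [f2]; nlinarith [mul_nonneg ht (sub_nonneg.2 h3), mul_nonneg ht' g3]
  · nlinarith [mul_nonneg ht h4, mul_nonneg ht' hc.le]

/-- An arc vertex has an angle below φ, so its component along (b', a') is `R` times a nonpositive
sine. Only the corner of the cap attains the bound 1. -/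
lemma arcEdge_cap {j : ℕ} (hj : j ≤ P.N) {z : Plane} (hz : z ∈ chainEdge P.V (j + 5)) :
    P.b' * (z 0 - P.c) + P.a' * (z 1 - 2 * P.b) ≤ 1 := by
  have ha' := P.a'_pos
  have hb := P.b_pos
  have hb' := P.b'_pos
  have hab' := P.sq_add_sq'
  have harc : ∀ k < P.N, P.b' * (P.V (k + 6) 0 - P.c) + P.a' * (P.V (k + 6) 1 - 2 * P.b) ≤ 1 := by
    intro k hk
    rw [V, if_pos hk]
    simp only [pt_zero, pt_one]
    have hs : Real.sin (P.ψ k - P.Δ / 2 - P.φ) ≤ 0 := by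
      have h1 := P.ψ_le k
      have h2 := P.ψ_nonneg hk.le
      refine Real.sin_nonpos_of_nonpos_of_neg_pi_le (by linarith [P.Δ_pos]) ?_
      linarith [P.Δ_le, P.φ_lt, P.θ_lt, Real.pi_pos, P.φ_pos]
    rw [Real.sin_sub] at hs
    have hR := P.two_le_R
    simp only [a', b']
    nlinarith [mul_nonneg (by linarith : 0 ≤ P.R) (neg_nonneg.2 hs)]
  have h1 : P.b' * (P.V (j + 5) 0 - P.c) + P.a' * (P.V (j + 5) 1 - 2 * P.b) ≤ 1 := by
    rcases j with _ | j
    · simp only [V, pt_zero, pt_one]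
      nlinarith
    · exact harc j (by omega)
  have h2 : P.b' * (P.V (j + 5 + 1) 0 - P.c) + P.a' * (P.V (j + 5 + 1) 1 - 2 * P.b) ≤ 1 := by
    rcases hj.lt_or_eq with hj | rfl
    · exact harc j hj
    · rw [show P.N + 5 + 1 = P.m by rfl, V_last]
      simp only [pt_zero, pt_one]
      nlinarith [mul_pos ha' hb]
  obtain ⟨s, hs, hs1, e0, e1⟩ := mem_segment_coord hz
  rw [e0, e1]
  nlinarith [mul_nonneg hs (sub_nonneg.2 h2), mul_nonneg (sub_nonneg.2 hs1) (sub_nonneg.2 h1)]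

lemma T_sq_lt : P.T ^ 2 < 5 := by nlinarith [P.R_sq, P.R_lt, P.two_le_R]

/-- A crude bound by 3, used to discard the solutions of |distance| ≥ 1 on the far side of the arc.
-/
lemma arcEdge_norm_lt {j : ℕ} (hj : j ≤ P.N) {z : Plane} (hz : z ∈ chainEdge P.V (j + 5)) :
    (z 0 - P.c) ^ 2 + (z 1 - 2 * P.b) ^ 2 < 9 := by
  obtain ⟨τ, rfl, h1, h2⟩ := P.mem_arcEdge hj hz
  rw [tangent_norm_sq]
  have hT := P.T_pos
  have hT2 := P.T_sq_lt
  have hb := P.b_lt_half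
  have hb0 := P.b_pos
  have h3 : -(1 + P.T) ≤ τ ∧ -max 1 P.T ≤ τ := by
    split_ifs at h1
    · exact ⟨by linarith, by linarith [le_max_left 1 P.T]⟩
    · exact ⟨by linarith, by linarith [le_max_right 1 P.T]⟩
  have h4 : τ ≤ max 1 P.T := by
    split_ifs at h2
    · linarith [le_max_left 1 P.T]
    · exact h2.trans (le_max_right 1 P.T)
  rcases max_cases 1 P.T with ⟨h, -⟩ | ⟨h, -⟩ <;> rw [h] at h3 h4 <;> nlinarith [h3.2]

/-- Linear and quadratic constraints on the part of the region on the left. -/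
lemma region_left {i : ℕ} (hi : 3 ≤ i) (him : i < P.m) {z : Plane} (hz : z ∈ chainEdge P.V i)
    {t w₁ w₂ : ℝ} (ht : 0 ≤ t) (ht1 : t ≤ 1) (e : P.tipPt w₁ w₂ = t • z) :
    0 ≤ -P.a' * w₁ + P.b' * w₂ ∧ P.b' * w₁ + P.a' * w₂ ≤ 1 ∧ w₁ ^ 2 + w₂ ^ 2 < 9 := by
  have ha := P.a_pos
  have ha' := P.a'_pos
  have hb := P.b_pos
  have hb' := P.b'_pos
  have hc := P.c_pos
  have hc1 := P.c_lt_one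
  have hab' := P.sq_add_sq'
  have hca := P.c_mul_a
  have hbb := P.b'_lt
  have hbh := P.b_lt_half
  have haa := P.a_lt
  have e0 : P.c + w₁ = t * z 0 := congrArg (fun x : Plane => x 0) e
  have e1 : 2 * P.b + w₂ = t * z 1 := congrArg (fun x : Plane => x 1) e
  obtain ⟨p, q, hpq, h1, h2, h3⟩ : ∃ p q : ℝ, z = P.tipPt p q ∧ 0 ≤ -P.a' * p + P.b' * q ∧
      P.b' * p + P.a' * q ≤ 1 ∧ p ^ 2 + q ^ 2 < 9 := by
    match i with
    | 3 =>
      obtain ⟨s, hs, hs1, rfl⟩ := (P.mem_edge3_iff z).1 hz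
      refine ⟨_, _, rfl, by nlinarith, by nlinarith, ?_⟩
      have : (s * P.b') ^ 2 + (s * P.a') ^ 2 = s ^ 2 := by linear_combination s ^ 2 * hab'
      nlinarith
    | 4 =>
      obtain ⟨s, hs, hs1, rfl⟩ := (P.mem_edge4_iff z).1 hz
      refine ⟨_, _, rfl, by nlinarith, by nlinarith, ?_⟩
      have : (P.b' - s * P.a') ^ 2 + (P.a' + s * P.b') ^ 2 = 1 + s ^ 2 := by
        linear_combination (1 + s ^ 2) * hab'
      nlinarith
    | j + 5 =>
      have hj : j ≤ P.N := by simp only [m] at him; omega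
      refine ⟨z 0 - P.c, z 1 - 2 * P.b, (P.tipPt_eq z).symm, ?_, P.arcEdge_cap hj hz,
        P.arcEdge_norm_lt hj hz⟩
      rcases hj.lt_or_eq with hj | rfl
      · obtain ⟨z1, z2⟩ := P.arcEdge_coord hj hz
        nlinarith [mul_nonneg ha'.le (sub_nonneg.2 z1), mul_nonneg hb'.le (sub_nonneg.2 z2)]
      · have hz1 := P.isUpperChain.edge_nonneg him hz
        rw [P.lastEdge_coord hz]
        nlinarith [mul_nonneg hb'.le hz1, mul_pos hb hb', P.lt_a]
  rw [hpq, tipPt_zero] at e0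
  rw [hpq, tipPt_one] at e1
  have f0 : w₁ = t * p - (1 - t) * P.c := by linear_combination e0
  have f0' : w₂ = t * q - (1 - t) * (2 * P.b) := by linear_combination e1
  have ht' : 0 ≤ 1 - t := by linarith
  have g1 : 0 ≤ P.a' * P.c - 2 * P.b * P.b' := by nlinarith
  have g2 : 0 ≤ P.b' * P.c + 2 * P.a' * P.b := by positivity
  have g3 : P.c ^ 2 + (2 * P.b) ^ 2 < 9 := by nlinarith
  refine ⟨?_, ?_, ?_⟩
  · have : -P.a' * w₁ + P.b' * w₂ = t * (-P.a' * p + P.b' * q)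
      + (1 - t) * (P.a' * P.c - 2 * P.b * P.b') := by rw [f0, f0']; ring
    rw [this]; positivity
  · have : P.b' * w₁ + P.a' * w₂ = t * (P.b' * p + P.a' * q)
      - (1 - t) * (P.b' * P.c + 2 * P.a' * P.b) := by rw [f0, f0']; ring
    rw [this]; nlinarith [mul_nonneg ht (sub_nonneg.2 h2), mul_nonneg ht' g2]
  · have : w₁ ^ 2 + w₂ ^ 2 = t * (p ^ 2 + q ^ 2) + (1 - t) * (P.c ^ 2 + (2 * P.b) ^ 2)
        - t * (1 - t) * ((p + P.c) ^ 2 + (q + 2 * P.b) ^ 2) := by rw [f0, f0']; ring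
    have h5 : 0 ≤ t * (1 - t) * ((p + P.c) ^ 2 + (q + 2 * P.b) ^ 2) := by positivity
    have h6 := mul_nonneg ht (sub_nonneg.2 h3.le)
    have h7 := mul_nonneg ht' (sub_nonneg.2 g3.le)
    rcases ht.eq_or_lt with rfl | ht0
    · linarith
    · have h8 := mul_pos ht0 (sub_pos.2 h3)
      linarith

/-- Every direction of the left quadrant at the tip that is not above the left edge of the spike
meets the polygonal arc, at distance at most `R` from the tip. -/
lemma exists_arc_point {w₁ w₂ : ℝ} (hα : 0 ≤ -P.a' * w₁ + P.b' * w₂)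
    (hβ : P.b' * w₁ + P.a' * w₂ ≤ 0) (h2 : 0 ≤ w₂) (hw : w₁ ^ 2 + w₂ ^ 2 ≠ 0) :
    ∃ r : ℝ, 0 < r ∧ 4 ≤ r ^ 2 * (w₁ ^ 2 + w₂ ^ 2) ∧ r ^ 2 * (w₁ ^ 2 + w₂ ^ 2) ≤ P.R ^ 2 ∧
      ∃ j ≤ P.N, P.tipPt (r * w₁) (r * w₂) ∈ chainEdge P.V (j + 5) := by
  classical
  have ha' := P.a'_pos
  have hb := P.b_pos
  have hb' := P.b'_pos
  have hT := P.T_pos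
  have hw1 : w₁ ≤ 0 := by
    by_contra! hpos
    nlinarith [mul_pos hb' hpos, mul_nonneg ha'.le h2]
  let U : ℕ → Plane := fun i => pt (P.V i 0 - P.c) (P.V i 1 - 2 * P.b)
  let w : Plane := pt w₁ w₂
  have hP0 : 0 ≤ cross (U (0 + 5)) w := by
    simp only [U, w, cross, V, pt_zero, pt_one]
    nlinarith
  -- The same search for the cone containing a direction as in `exists_smul_mem_edge`, now about the
  -- tip instead of the origin.
  let j := Nat.findGreatest (fun j => 0 ≤ cross (U (j + 5)) w) P.N
  have hj : 0 ≤ cross (U (j + 5)) w :=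
    Nat.findGreatest_spec (P := fun j => 0 ≤ cross (U (j + 5)) w) (Nat.zero_le P.N) hP0
  have hjN : j ≤ P.N := Nat.findGreatest_le _
  have hj' : 0 ≤ cross w (U (j + 5 + 1)) := by
    rcases hjN.eq_or_lt with he | hlt
    · have : j + 5 + 1 = P.m := by simp only [m]; omega
      rw [this]
      simp only [U, w, V_last, cross, pt_zero, pt_one]
      nlinarith [mul_nonneg hb.le (neg_nonneg.2 hw1)]
    · have := Nat.findGreatest_is_greatest (P := fun j => 0 ≤ cross (U (j + 5)) w) (n := P.N)
        (k := j + 1) (Nat.lt_succ_self _) hlt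
      rw [show j + 1 + 5 = j + 5 + 1 by ring] at this
      simp only [cross] at this ⊢
      linarith
  have hturn : 0 < cross (U (j + 5)) (U (j + 5 + 1)) := by
    have : ∀ σ τ : ℝ, cross (pt (P.tangent j σ 0 - P.c) (P.tangent j σ 1 - 2 * P.b))
        (pt (P.tangent j τ 0 - P.c) (P.tangent j τ 1 - 2 * P.b)) = 2 * (τ - σ) := by
      intro σ τ
      simp only [cross, tangent, pt_zero, pt_one]
      linear_combination 2 * (τ - σ) * Real.cos_sq_add_sin_sq (P.ψ j)
    simp only [U]
    rw [P.V_arc_left hjN, P.V_arc_right hjN, this]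
    split_ifs <;> linarith
  have hw0 : w ≠ 0 := by
    intro he
    have e0 : w₁ = 0 := congrArg (fun x : Plane => x 0) he
    have e1 : w₂ = 0 := congrArg (fun x : Plane => x 1) he
    exact hw (by rw [e0, e1]; ring)
  obtain ⟨r, hr, hmem⟩ := exists_pos_smul_mem_segment hturn hj hj' hw0
  have hz : P.tipPt (r * w₁) (r * w₂) ∈ chainEdge P.V (j + 5) := by
    obtain ⟨s, hs, hs1, e0, e1⟩ := mem_segment_coord hmem
    simp only [U, w, PiLp.smul_apply, pt_zero, pt_one, smul_eq_mul] at e0 e1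
    refine mem_segment_of_coord hs hs1 ?_ ?_
    · rw [tipPt_zero]; linarith
    · rw [tipPt_one]; linarith
  obtain ⟨τ, he, hτ1, hτ2⟩ := P.mem_arcEdge hjN hz
  have hn := P.tangent_norm_sq j τ
  rw [← he] at hn
  simp only [tipPt_zero, tipPt_one, add_sub_cancel_left] at hn
  refine ⟨r, hr, by nlinarith, ?_, j, hjN, hz⟩
  have e0 : P.c + r * w₁ = P.tangent j τ 0 := congrArg (fun x : Plane => x 0) he
  have e1 : 2 * P.b + r * w₂ = P.tangent j τ 1 := congrArg (fun x : Plane => x 1) he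
  simp only [tangent, pt_zero, pt_one] at e0 e1
  -- The first and last edges may extend beyond offset `T`; the conditions `hβ` and `h2` exclude
  -- these parts.
  have hτ : τ ^ 2 ≤ P.T ^ 2 := by
    have hl : -P.T ≤ τ := by
      split_ifs at hτ1 with h0
      · rw [h0, ψ_zero] at e0 e1
        have : τ = -(r * (P.b' * w₁ + P.a' * w₂)) := by
          simp only [a', b']
          linear_combination Real.sin P.φ * e0 + Real.cos P.φ * e1
            - τ * Real.cos_sq_add_sin_sq P.φ
        nlinarith
      · exact hτ1
    have hu : τ ≤ P.T := by
      split_ifs at hτ2 with h0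
      · rw [h0, ψ_N, Real.sin_zero, Real.cos_zero] at e1
        nlinarith
      · exact hτ2
    exact sq_le_sq' hl hu
  rw [P.R_sq]
  nlinarith

lemma one_le_of_free {w₁ w₂ : ℝ} (hx : P.tipPt w₁ w₂ ∈ P.free) {i : ℕ} (hi : i < P.m) {z₁ z₂ : ℝ}
    (hz : P.tipPt z₁ z₂ ∈ chainEdge P.V i) : 1 ≤ (w₁ - z₁) ^ 2 + (w₂ - z₂) ^ 2 := by
  have := (P.one_le_dist_tipPt _ _ _).1 (P.isUpperChain.one_le_dist_edge hx hi hz)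
  simpa only [tipPt_zero, tipPt_one, add_sub_cancel_left] using this

lemma m_eq : P.m = P.N + 6 := rfl

lemma one_le_norm_of_free {w₁ w₂ : ℝ} (hx : P.tipPt w₁ w₂ ∈ P.free) : 1 ≤ w₁ ^ 2 + w₂ ^ 2 := by
  have := P.one_le_of_free hx (i := 2) (by rw [m_eq]; omega) ((P.mem_edge2_iff (P.tipPt 0 0)).2
    ⟨0, by norm_num, by norm_num, by simp⟩)
  simpa using this

/-- A free position in the corridor lies on its centerline. -/
lemma free_corridor {w₁ w₂ : ℝ} (hx : P.tipPt w₁ w₂ ∈ P.free) (h1 : 0 ≤ P.a * w₁ - P.b * w₂)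
    (h2 : P.a * w₁ - P.b * w₂ ≤ 2) (hu : 0 ≤ P.b * w₁ + P.a * w₂)
    (h3 : P.b * w₁ + P.a * w₂ ≤ 17) :
    ∃ t, 0 ≤ t ∧ t ≤ 16 ∧ w₁ = P.a + t * P.b ∧ w₂ = -P.b + t * P.a := by
  have hab := P.sq_add_sq
  have hm := P.m_eq
  have f2 := P.one_le_of_free hx (by omega) ((P.mem_edge2_iff _).2 ⟨_, hu, h3, rfl⟩)
  have f0 := P.one_le_of_free hx (by omega) ((P.mem_edge0_iff _).2 ⟨_, hu, h3, rfl⟩)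
  have f1 := P.one_le_of_free hx (by omega) ((P.mem_edge1_iff _).2 ⟨_, h1, h2, rfl⟩)
  have ew1 : w₁ = P.a * (P.a * w₁ - P.b * w₂) + P.b * (P.b * w₁ + P.a * w₂) := by
    linear_combination -w₁ * hab
  have ew2 : w₂ = -P.b * (P.a * w₁ - P.b * w₂) + P.a * (P.b * w₁ + P.a * w₂) := by
    linear_combination -w₂ * hab
  generalize P.a * w₁ - P.b * w₂ = κ at *
  generalize P.b * w₁ + P.a * w₂ = σ at *
  subst ew1 ew2
  -- With κ across and σ along the corridor, the distances to the feet of the perpendiculars on both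
  -- walls force κ = 1, and the end wall gives σ ≤ 16.
  have k2 : 1 ≤ κ ^ 2 := f2.trans_eq (by linear_combination κ ^ 2 * hab)
  have k0 : 1 ≤ (2 - κ) ^ 2 := f0.trans_eq (by linear_combination (2 - κ) ^ 2 * hab)
  have k1 : 1 ≤ (17 - σ) ^ 2 := f1.trans_eq (by linear_combination (17 - σ) ^ 2 * hab)
  have hκ1 : 1 ≤ κ := by
    by_contra! hlt
    nlinarith
  have hκ2 : κ ≤ 1 := by
    by_contra! hlt
    nlinarith
  obtain rfl : κ = 1 := le_antisymm hκ2 hκ1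
  refine ⟨σ, hu, ?_, by ring, by ring⟩
  by_contra! hlt
  nlinarith

/-- No free position on the left lies properly above the foot of the left edge of the spike. -/
lemma free_cap {w₁ w₂ : ℝ} (hx : P.tipPt w₁ w₂ ∈ P.free) (hα : 0 ≤ -P.a' * w₁ + P.b' * w₂)
    (hβ : P.b' * w₁ + P.a' * w₂ ≤ 1) (h9 : w₁ ^ 2 + w₂ ^ 2 < 9) :
    P.b' * w₁ + P.a' * w₂ ≤ 0 := by
  by_contra! hβ0
  have hab' := P.sq_add_sq'
  have hm := P.m_eq
  have hT := P.T_pos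
  have hb := P.b_pos
  have f3 := P.one_le_of_free hx (by omega) ((P.mem_edge3_iff _).2 ⟨_, hβ0.le, hβ, rfl⟩)
  have f5 := P.tangent_mem_arcEdge (j := 0) (Nat.zero_le _)
    (τ := -(P.b' * w₁ + P.a' * w₂)) (by simpa using hβ) (by split_ifs <;> linarith)
  have et : P.tangent 0 (-(P.b' * w₁ + P.a' * w₂)) = P.tipPt
      (-2 * P.a' + (P.b' * w₁ + P.a' * w₂) * P.b') (2 * P.b' + (P.b' * w₁ + P.a' * w₂) * P.a') := by
    rw [tangent, ψ_zero]
    refine plane_ext ?_ ?_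
    · simp only [pt_zero, tipPt_zero, a', b']; ring
    · simp only [pt_one, tipPt_one, a', b']; ring
  rw [et] at f5
  replace f5 := P.one_le_of_free hx (by omega) f5
  have f4 : -P.a' * w₁ + P.b' * w₂ ≤ 2 → _ := fun h2 =>
    P.one_le_of_free hx (by omega) ((P.mem_edge4_iff _).2 ⟨_, hα, h2, rfl⟩)
  have ew1 : w₁ = -P.a' * (-P.a' * w₁ + P.b' * w₂) + P.b' * (P.b' * w₁ + P.a' * w₂) := by
    linear_combination -w₁ * hab'
  have ew2 : w₂ = P.b' * (-P.a' * w₁ + P.b' * w₂) + P.a' * (P.b' * w₁ + P.a' * w₂) := by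
    linear_combination -w₂ * hab'
  generalize -P.a' * w₁ + P.b' * w₂ = α at *
  generalize P.b' * w₁ + P.a' * w₂ = β at *
  subst ew1 ew2
  -- The arc's first edge forces α ≤ 1, since α ≥ 3 is too far from the tip. Then the perpendicular
  -- on the cap edge has its foot on that edge, which forces β ≤ 0.
  have k5 : 1 ≤ (2 - α) ^ 2 := f5.trans_eq (by linear_combination (2 - α) ^ 2 * hab')
  have k9 : α ^ 2 + β ^ 2 < 9 :=
    lt_of_eq_of_lt (by linear_combination -(α ^ 2 + β ^ 2) * hab') h9
  have hα3 : α < 3 := by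
    by_contra! hlt
    nlinarith [sq_nonneg β]
  have hα1 : α ≤ 1 := by
    by_contra! hlt
    nlinarith
  have k4 : 1 ≤ (1 - β) ^ 2 :=
    (f4 (by linarith)).trans_eq (by linear_combination (1 - β) ^ 2 * hab')
  nlinarith

/-- A free position next to the polygonal arc has distance at most `R - 1` from the tip. -/
lemma free_arc {w₁ w₂ : ℝ} (hx : P.tipPt w₁ w₂ ∈ P.free) (hα : 0 ≤ -P.a' * w₁ + P.b' * w₂)
    (hβ : P.b' * w₁ + P.a' * w₂ ≤ 0) (h2 : 0 ≤ w₂) (h9 : w₁ ^ 2 + w₂ ^ 2 < 9) :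
    w₁ ^ 2 + w₂ ^ 2 ≤ (P.R - 1) ^ 2 := by
  have hm := P.m_eq
  have htip := P.one_le_norm_of_free hx
  -- The ray from the tip through the position hits the arc at a distance between 2 and `R`. The
  -- position is at least 1 before that point: being 1 beyond it would mean distance at least 3.
  obtain ⟨r, hr, h4, hR, j, hj, hmem⟩ := P.exists_arc_point hα hβ h2 (by linarith)
  have f := P.one_le_of_free hx (by omega) hmem
  have hn : √(w₁ ^ 2 + w₂ ^ 2) ^ 2 = w₁ ^ 2 + w₂ ^ 2 := Real.sq_sqrt (by positivity)
  have hn0 : 0 ≤ √(w₁ ^ 2 + w₂ ^ 2) := Real.sqrt_nonneg _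
  have f' : 1 ≤ (r - 1) ^ 2 * (w₁ ^ 2 + w₂ ^ 2) := f.trans_eq (by ring)
  rw [← hn] at f' h4 hR h9 ⊢
  generalize √(w₁ ^ 2 + w₂ ^ 2) = n at *
  have hR2 := P.two_le_R
  have h4' : 2 ≤ r * n := by
    have : (2 : ℝ) ^ 2 ≤ (r * n) ^ 2 := by rw [mul_pow]; linarith
    exact (sq_le_sq₀ (by norm_num) (by positivity)).1 this
  have hR' : r * n ≤ P.R := by
    have : (r * n) ^ 2 ≤ P.R ^ 2 := by rw [mul_pow]; linarith
    exact (sq_le_sq₀ (by positivity) (by linarith)).1 this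
  have h9' : n < 3 := by
    by_contra! hlt
    nlinarith
  have h1 : n ≤ r * n - 1 := by
    by_contra! hlt
    nlinarith
  exact (sq_le_sq₀ hn0 (by linarith)).2 (by linarith)

lemma free_wall {w₁ w₂ : ℝ} (hx : P.tipPt w₁ w₂ ∈ P.free) (h : 0 ≤ 2 * P.b + w₂) (h2 : w₂ ≤ 0)
    (h9 : w₁ ^ 2 + w₂ ^ 2 < 9) : -1 ≤ w₁ := by
  have hm := P.m_eq
  have hT := P.T_pos
  have f := P.tangent_mem_arcEdge (j := P.N) le_rfl (τ := -w₂)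
    (by split_ifs <;> linarith) (by rw [if_pos rfl]; linarith)
  have et : P.tangent P.N (-w₂) = P.tipPt (-2) w₂ := by
    rw [tangent, ψ_N, Real.sin_zero, Real.cos_zero]
    refine plane_ext ?_ ?_
    · simp only [pt_zero, tipPt_zero]; ring
    · simp only [pt_one, tipPt_one]; ring
  rw [et] at f
  have f' := P.one_le_of_free hx (by omega) f
  by_contra! hlt
  nlinarith

/-- The four kinds of free positions in the upper half-plane: next to the polygonal arc, to the left
of the tips, in the corridor, and between the three spikes. -/
theorem free_cases {w₁ w₂ : ℝ} (h : 0 ≤ 2 * P.b + w₂) (hx : P.tipPt w₁ w₂ ∈ P.free) :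
    (w₁ < 0 ∧ P.b' * w₁ + P.a' * w₂ ≤ 0 ∧ 0 ≤ w₂ ∧ 1 ≤ w₁ ^ 2 + w₂ ^ 2 ∧
        w₁ ^ 2 + w₂ ^ 2 ≤ (P.R - 1) ^ 2) ∨
      (-1 ≤ w₁ ∧ w₁ < 0 ∧ w₂ ≤ 0 ∧ 1 ≤ w₁ ^ 2 + w₂ ^ 2) ∨
      (∃ t, 0 ≤ t ∧ t ≤ 16 ∧ w₁ = P.a + t * P.b ∧ w₂ = -P.b + t * P.a) ∨
      (0 < w₁ ∧ P.b * w₁ + P.a * w₂ ≤ 0 ∧ P.a * w₁ - P.b * w₂ ≤ 2 ∧ 1 ≤ w₁ ^ 2 + w₂ ^ 2 ∧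
        1 ≤ (w₁ - 2 * P.a) ^ 2 + (w₂ + 2 * P.b) ^ 2) := by
  have hch := P.isUpperChain
  have ha := P.a_pos
  have ha' := P.a'_pos
  have hb := P.b_pos
  have hb' := P.b'_pos
  have hbh := P.b_lt_half
  have hm := P.m_eq
  have htip := P.one_le_norm_of_free hx
  -- The gap between the tips is closed: at w₁ = 0 and -2b ≤ w₂ ≤ 0 the distance to the tip is at
  -- most 2b < 1.
  have hw10 : w₁ = 0 → 0 < w₂ := by
    rintro rfl
    by_contra! hle
    nlinarith
  obtain ⟨i, hi, t, ⟨ht, ht1⟩, z, hz, e⟩ := hch.exists_smul_of_mem_region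
    (x := P.tipPt w₁ w₂) (by simpa using h) ((hch.mem_freeSpace_iff _).1 hx).1
  rcases lt_or_ge i 3 with hi3 | hi3
  · obtain ⟨h1, h2, h3, h4⟩ := P.region_right hi3 hz ht ht1 e
    rcases lt_trichotomy w₁ 0 with hw | hw | hw
    · refine Or.inr (Or.inl ⟨h4, hw, ?_, htip⟩)
      by_contra! hpos
      nlinarith [mul_pos hb hpos, mul_pos ha (neg_pos.2 hw)]
    · have := hw10 hw
      rw [hw] at h1
      nlinarith
    · rcases le_total (P.b * w₁ + P.a * w₂) 0 with hu | hu
      · refine Or.inr (Or.inr (Or.inr ⟨hw, hu, h2, htip, ?_⟩))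
        have := P.one_le_of_free hx (by omega) ((P.mem_edge0_iff (P.tipPt (2 * P.a) (-2 * P.b))).2
          ⟨0, by norm_num, by norm_num, by simp⟩)
        exact this.trans_eq (by ring)
      · exact Or.inr (Or.inr (Or.inl (P.free_corridor hx h1 h2 hu h3)))
  · obtain ⟨hα, hβ, h9⟩ := P.region_left hi3 hi hz ht ht1 e
    have hβ0 := P.free_cap hx hα hβ h9
    have hw : w₁ < 0 := by
      rcases lt_trichotomy w₁ 0 with hw | hw | hw
      · exact hw
      · have := hw10 hw
        rw [hw] at hβ0
        nlinarith
      · exfalso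
        have : w₂ < 0 := by
          by_contra! hpos
          nlinarith [mul_pos hb' hw, mul_nonneg ha'.le hpos]
        nlinarith [mul_pos ha' hw, mul_neg_of_pos_of_neg hb' this]
    rcases le_total 0 w₂ with hw2 | hw2
    · exact Or.inl ⟨hw, hβ0, hw2, htip, P.free_arc hx hα hβ0 hw2 h9⟩
    · exact Or.inr (Or.inl ⟨P.free_wall hx h hw2 h9, hw, hw2, htip⟩)

end Params
end
end UnlabeledMRMP

namespace UnlabeledMRMP
noncomputable section
namespace Params

variable (P : Params)

/-! ### The free-space components -/

/-- The two points are joined by a connected set within `H` that keeps distance one from the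
boundary. -/
def Link (H : Set Plane) (x y : Plane) : Prop :=
  ∃ s : Set Plane, IsPreconnected s ∧ x ∈ s ∧ y ∈ s ∧ s ⊆ H ∧
    ∀ z ∈ s, ∀ b ∈ P.polygon.boundary ℝ, 1 ≤ dist z b

variable {P}

lemma Link.symm {H : Set Plane} {x y : Plane} (h : P.Link H x y) : P.Link H y x := by
  obtain ⟨s, h1, h2, h3, h4⟩ := h
  exact ⟨s, h1, h3, h2, h4⟩

lemma Link.trans {H : Set Plane} {x y z : Plane} (h : P.Link H x y) (h' : P.Link H y z) :
    P.Link H x z := by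
  obtain ⟨s, h1, h2, h3, h4, h5⟩ := h
  obtain ⟨t, k1, k2, k3, k4, k5⟩ := h'
  refine ⟨s ∪ t, h1.union y h3 k2 k1, Or.inl h2, Or.inr k3, union_subset h4 k4, ?_⟩
  rintro z (hz | hz)
  · exact h5 z hz
  · exact k5 z hz

lemma Link.mirror {H : Set Plane} (hH : ∀ x ∈ H, mirror x ∈ H) {x y : Plane} (h : P.Link H x y) :
    P.Link H (UnlabeledMRMP.mirror x) (UnlabeledMRMP.mirror y) := by
  obtain ⟨s, h1, h2, h3, h4, h5⟩ := h
  refine ⟨UnlabeledMRMP.mirror '' s, h1.image _ continuous_mirror.continuousOn,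
    mem_image_of_mem _ h2, mem_image_of_mem _ h3, ?_, ?_⟩
  · rintro _ ⟨z, hz, rfl⟩
    exact hH z (h4 hz)
  · rintro _ ⟨z, hz, rfl⟩ b hb
    rw [← dist_mirror, mirror_mirror]
    exact h5 z hz _ (P.isUpperChain.mirror_mem_boundary hb)

lemma Link.free {H : Set Plane} {x y : Plane} (h : P.Link H x y) (hx : x ∈ P.free) :
    ∃ s : Set Plane, IsPreconnected s ∧ x ∈ s ∧ y ∈ s ∧ s ⊆ H ∩ P.free := by
  obtain ⟨s, h1, h2, h3, h4, h5⟩ := h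
  exact ⟨s, h1, h2, h3, subset_inter h4 (P.isUpperChain.subset_freeSpace h1 h5 h2
    ((P.isUpperChain.mem_freeSpace_iff x).1 hx).1)⟩

lemma Link.mem_free {H : Set Plane} {x y : Plane} (h : P.Link H x y) (hx : x ∈ P.free) :
    y ∈ P.free := by
  obtain ⟨s, -, -, h3, h4⟩ := h.free hx
  exact (h4 h3).2

variable (P)

lemma continuous_tipPt {α : Type*} [TopologicalSpace α] {f g : α → ℝ} {s : Set α}
    (hf : ContinuousOn f s) (hg : ContinuousOn g s) :
    ContinuousOn (fun x => P.tipPt (f x) (g x)) s := by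
  rw [(PiLp.homeomorph 2 (fun _ : Fin 2 => ℝ)).isInducing.continuousOn_iff, continuousOn_pi]
  intro i
  fin_cases i
  · exact continuousOn_const.add hf
  · exact continuousOn_const.add hg

lemma link_segment {H : Set Plane} {p q p' q' : ℝ}
    (h : ∀ t : ℝ, 0 ≤ t → t ≤ 1 → P.Clear (p + t * (p' - p)) (q + t * (q' - q)) ∧
      P.tipPt (p + t * (p' - p)) (q + t * (q' - q)) ∈ H) :
    P.Link H (P.tipPt p q) (P.tipPt p' q') := by
  refine ⟨(fun t : ℝ => P.tipPt (p + t * (p' - p)) (q + t * (q' - q))) '' Icc 0 1,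
    isPreconnected_Icc.image _ (P.continuous_tipPt (by fun_prop) (by fun_prop)),
    ⟨0, by simp, by simp⟩, ⟨1, by simp, by simp⟩, ?_, ?_⟩
  · rintro _ ⟨t, ht, rfl⟩
    exact (h t ht.1 ht.2).2
  · rintro _ ⟨t, ht, rfl⟩
    exact (h t ht.1 ht.2).1

/-- The closed half-plane to the left of the tips. -/
def leftHalf : Set Plane := {x | x 0 ≤ P.c}

/-- The closed half-plane to the right of the tips. -/
def rightHalf : Set Plane := {x | P.c ≤ x 0}

/-- The base point of the left component. -/
def leftBase : Plane := P.tipPt (-1) (-2 * P.b)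

/-- The base point of the right component. -/
def rightBase : Plane := P.tipPt (2 * P.a - 1) (-2 * P.b)

lemma tipPt_mem_left {w₁ w₂ : ℝ} (h : w₁ ≤ 0) : P.tipPt w₁ w₂ ∈ P.leftHalf := by
  show P.c + w₁ ≤ P.c
  linarith

lemma tipPt_mem_right {w₁ w₂ : ℝ} (h : 0 ≤ w₁) : P.tipPt w₁ w₂ ∈ P.rightHalf := by
  show P.c ≤ P.c + w₁
  linarith

/-- A slide to the left onto w₁ = -1 only increases the distance to the tip; a vertical slide then
reaches the axis. -/
lemma link_left_low {w₁ w₂ : ℝ} (h : 0 ≤ 2 * P.b + w₂) (h1 : -1 ≤ w₁) (h0 : w₁ ≤ 0) (h2 : w₂ ≤ 0)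
    (hn : 1 ≤ w₁ ^ 2 + w₂ ^ 2) : P.Link P.leftHalf (P.tipPt w₁ w₂) P.leftBase := by
  refine Link.trans (y := P.tipPt (-1) w₂) (P.link_segment fun t ht ht1 => ?_)
    (P.link_segment fun t ht ht1 => ?_)
  · have e1 : w₁ + t * (-1 - w₁) ≤ w₁ := by nlinarith
    have e2 : -1 ≤ w₁ + t * (-1 - w₁) := by nlinarith
    refine ⟨P.clear_left_low (by linarith) e2 (by simpa using h) (by simpa using h2) ?_,
      P.tipPt_mem_left (by linarith)⟩
    rw [sub_self, mul_zero, add_zero]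
    nlinarith
  · have e1 : w₂ + t * (-2 * P.b - w₂) ≤ 0 := by nlinarith
    have e2 : 0 ≤ 2 * P.b + (w₂ + t * (-2 * P.b - w₂)) := by nlinarith
    refine ⟨P.clear_left_low (by linarith) (by linarith) e2 e1 ?_, P.tipPt_mem_left (by linarith)⟩
    nlinarith [sq_nonneg (w₂ + t * (-2 * P.b - w₂))]

/-- The segment from `w` to (-1, 0), projected radially from the tip, runs along the unit circle. -/
lemma link_left_circle {w₁ w₂ : ℝ} (h0 : w₁ < 0) (h2 : 0 ≤ w₂)
    (hu' : P.b' * w₁ + P.a' * w₂ ≤ 0) :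
    P.Link P.leftHalf (P.tipPt (w₁ / √(w₁ ^ 2 + w₂ ^ 2)) (w₂ / √(w₁ ^ 2 + w₂ ^ 2)))
      P.leftBase := by
  have hb := P.b_pos
  have hb' := P.b'_pos
  refine Link.trans (y := P.tipPt (-1) 0) ?_ (P.link_left_low (by linarith) le_rfl (by norm_num)
    le_rfl (by norm_num))
  have hpos : ∀ t : ℝ, 0 ≤ t → t ≤ 1 → w₁ + t * (-1 - w₁) < 0 := by
    intro t ht ht1
    rcases ht1.lt_or_eq with h | rfl
    · nlinarith [mul_pos (sub_pos.2 h) (neg_pos.2 h0)]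
    · linarith
  have hn : ∀ t : ℝ, 0 ≤ t → t ≤ 1 →
      0 < (w₁ + t * (-1 - w₁)) ^ 2 + (w₂ + t * (0 - w₂)) ^ 2 := by
    intro t ht ht1
    have := hpos t ht ht1
    exact add_pos_of_pos_of_nonneg (by rw [pow_two]; exact mul_pos_of_neg_of_neg this this)
      (sq_nonneg _)
  let n : ℝ → ℝ := fun t => √((w₁ + t * (-1 - w₁)) ^ 2 + (w₂ + t * (0 - w₂)) ^ 2)
  have hncont : ContinuousOn n (Icc 0 1) := by fun_prop
  have hn0 : ∀ t ∈ Icc (0 : ℝ) 1, n t ≠ 0 := fun t ht =>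
    (Real.sqrt_pos.2 (hn t ht.1 ht.2)).ne'
  refine ⟨(fun t : ℝ => P.tipPt ((w₁ + t * (-1 - w₁)) / n t) ((w₂ + t * (0 - w₂)) / n t)) ''
    Icc 0 1, isPreconnected_Icc.image _ (P.continuous_tipPt
      (ContinuousOn.div (by fun_prop) hncont hn0) (ContinuousOn.div (by fun_prop) hncont hn0)),
    ⟨0, by simp, by simp [n]⟩, ⟨1, by simp, by simp [n]⟩, ?_, ?_⟩
  · rintro _ ⟨t, ht, rfl⟩
    exact P.tipPt_mem_left (div_nonpos_of_nonpos_of_nonneg (hpos t ht.1 ht.2).le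
      (Real.sqrt_nonneg _))
  · rintro _ ⟨t, ht, rfl⟩
    have hsq : n t ^ 2 = (w₁ + t * (-1 - w₁)) ^ 2 + (w₂ + t * (0 - w₂)) ^ 2 :=
      Real.sq_sqrt (hn t ht.1 ht.2).le
    have hnt : 0 < n t := Real.sqrt_pos.2 (hn t ht.1 ht.2)
    refine P.clear_left_circle (div_nonpos_of_nonpos_of_nonneg (hpos t ht.1 ht.2).le hnt.le)
      (div_nonneg ?_ hnt.le) ?_ ?_
    · nlinarith [ht.1, ht.2]
    · have : P.b' * ((w₁ + t * (-1 - w₁)) / n t) + P.a' * ((w₂ + t * (0 - w₂)) / n t)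
          = ((1 - t) * (P.b' * w₁ + P.a' * w₂) - t * P.b') / n t := by
        field_simp; ring
      rw [this]
      refine div_nonpos_of_nonpos_of_nonneg ?_ hnt.le
      nlinarith [ht.1, ht.2, mul_nonneg ht.1 hb'.le, mul_nonneg (sub_nonneg.2 ht.2)
        (neg_nonneg.2 hu')]
    · rw [div_pow, div_pow, ← add_div, ← hsq, div_self (by positivity)]

/-- Shrinking a position `w` towards the tip keeps distance 1 from a boundary point `z`, with d =
|z|², M = |w|² and k their inner product. The quadratic in r is decreasing on [0, 1] if k ≥ M, at
least d if k ≤ 0, and otherwise has minimum d - k²/M ≥ 4 - M ≥ 1. -/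
lemma one_le_interpolation {r k d M : ℝ} (hr : 0 ≤ r) (hr1 : r ≤ 1) (hM : 1 ≤ M) (hM3 : M ≤ 3)
    (hd : 4 ≤ d) (h : 1 ≤ d - 2 * k + M) : 1 ≤ d - 2 * r * k + r ^ 2 * M := by
  rcases le_total M k with hk | hk
  · have h1 := mul_nonneg (sub_nonneg.2 hr1) (sub_nonneg.2 hk)
    have h2 := mul_nonneg (mul_nonneg (sub_nonneg.2 hr1) (sub_nonneg.2 hr1))
      (zero_le_one.trans hM)
    linarith
  · rcases le_total k 0 with hk0 | hk0
    · have h1 := mul_nonneg hr (neg_nonneg.2 hk0)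
      have h2 := mul_nonneg (sq_nonneg r) (zero_le_one.trans hM)
      linarith
    · have h1 : k ^ 2 ≤ M ^ 2 := pow_le_pow_left₀ hk0 hk 2
      have h2 : M * (d - 2 * r * k + r ^ 2 * M) = M * d - k ^ 2 + (r * M - k) ^ 2 := by ring
      have h3 := mul_nonneg (zero_le_one.trans hM) (sub_nonneg.2 hd)
      have h4 := mul_nonneg (zero_le_one.trans hM) (sub_nonneg.2 hM3)
      have h5 : M * 1 ≤ M * (d - 2 * r * k + r ^ 2 * M) := by
        rw [h2]
        linarith [sq_nonneg (r * M - k)]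
      exact le_of_mul_le_mul_left h5 (by linarith)

lemma link_left_arc {w₁ w₂ : ℝ} (hx : P.tipPt w₁ w₂ ∈ P.free) (h0 : w₁ < 0) (h2 : 0 ≤ w₂)
    (hu' : P.b' * w₁ + P.a' * w₂ ≤ 0) (h1 : 1 ≤ w₁ ^ 2 + w₂ ^ 2)
    (hR : w₁ ^ 2 + w₂ ^ 2 ≤ (P.R - 1) ^ 2) : P.Link P.leftHalf (P.tipPt w₁ w₂) P.leftBase := by
  refine Link.trans (P.link_segment fun t ht ht1 => ?_) (P.link_left_circle h0 h2 hu')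
  have hsq : √(w₁ ^ 2 + w₂ ^ 2) ^ 2 = w₁ ^ 2 + w₂ ^ 2 := Real.sq_sqrt (by positivity)
  have hn1 : 1 ≤ √(w₁ ^ 2 + w₂ ^ 2) := Real.one_le_sqrt.2 h1
  generalize √(w₁ ^ 2 + w₂ ^ 2) = n at *
  obtain ⟨r, hr0, hr1, hrn, e1, e2⟩ : ∃ r : ℝ, 0 < r ∧ r ≤ 1 ∧ 1 ≤ r * n ∧
      w₁ + t * (w₁ / n - w₁) = r * w₁ ∧ w₂ + t * (w₂ / n - w₂) = r * w₂ := by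
    have hn0 : 0 < n := by linarith
    have hi : 1 / n ≤ 1 := (div_le_one hn0).2 hn1
    have hi0 : 0 < 1 / n := by positivity
    have e : (1 + t * (1 / n - 1)) * n = n + t * (1 - n) := by field_simp
    refine ⟨1 + t * (1 / n - 1), by nlinarith, by nlinarith, by rw [e]; nlinarith, by ring, by ring⟩
  rw [e1, e2]
  have hrw : r ^ 2 * (w₁ ^ 2 + w₂ ^ 2) = (r * n) ^ 2 := by rw [← hsq]; ring
  refine ⟨P.clear_left (by nlinarith) (by nlinarith [P.b_pos]) ?_ ?_ fun j hj z hz => ?_,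
    P.tipPt_mem_left (by nlinarith)⟩
  · have : P.b' * (r * w₁) + P.a' * (r * w₂) = r * (P.b' * w₁ + P.a' * w₂) := by ring
    rw [this]
    nlinarith
  · have : (r * w₁) ^ 2 + (r * w₂) ^ 2 = (r * n) ^ 2 := by rw [← hrw]; ring
    rw [this]
    nlinarith
  · rw [one_le_dist_tipPt]
    have h4 := P.four_le_arcEdge hj hz
    have hd := P.one_le_of_free hx (i := j + 5) (by rw [m_eq]; omega)
      (by rw [P.tipPt_eq]; exact hz)
    have h3 := P.R_sub_one_sq
    generalize z 0 - P.c = p at *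
    generalize z 1 - 2 * P.b = q at *
    have e : (r * w₁ - p) ^ 2 + (r * w₂ - q) ^ 2
        = (p ^ 2 + q ^ 2) - 2 * r * (p * w₁ + q * w₂) + r ^ 2 * n ^ 2 := by rw [hsq]; ring
    have e' : (w₁ - p) ^ 2 + (w₂ - q) ^ 2
        = (p ^ 2 + q ^ 2) - 2 * (p * w₁ + q * w₂) + n ^ 2 := by rw [hsq]; ring
    rw [e' ] at hd
    rw [e]
    rw [← hsq] at hR
    generalize p * w₁ + q * w₂ = k at *
    generalize p ^ 2 + q ^ 2 = d at *
    exact one_le_interpolation hr0.le hr1 (by nlinarith) (by linarith) h4 hd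

/-- In the triangle between the spikes, the positions at distance one from the tip are not close
to the left end of the triangle. -/
lemma le_of_triangle {w₁ w₂ : ℝ} (h0 : 0 ≤ w₁) (hu : P.b * w₁ + P.a * w₂ ≤ 0)
    (h1 : 1 ≤ w₁ ^ 2 + w₂ ^ 2) : P.b ≤ P.a * w₁ - P.b * w₂ := by
  have ha := P.a_pos
  have hb := P.b_pos
  have hw2 : w₂ ≤ 0 := by
    by_contra! hpos
    linarith [mul_nonneg hb.le h0, mul_pos ha hpos]
  have hκ0 : 0 ≤ P.a * w₁ - P.b * w₂ := by
    linarith [mul_nonneg ha.le h0, mul_nonneg hb.le (neg_nonneg.2 hw2)]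
  have key : P.b ^ 2 ≤ (P.a * w₁ - P.b * w₂) ^ 2 := by
    have h2 : 0 ≤ w₁ * (P.a * (P.a * w₁ - P.b * w₂) - P.b * (P.b * w₁ + P.a * w₂)) :=
      mul_nonneg h0 (by linarith [mul_nonneg ha.le hκ0, mul_nonneg hb.le (neg_nonneg.2 hu)])
    have h3 := mul_le_mul_of_nonneg_left h1 (sq_nonneg P.b)
    linarith
  exact (sq_le_sq₀ hb.le hκ0).1 key

/-- Moving down parallel to the corridor inside the triangle between the spikes. -/
lemma triangle_descend {w₁ w₂ s : ℝ} (h0 : 0 ≤ w₁)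
    (hu : P.b * w₁ + P.a * w₂ ≤ 0) (h1 : 1 ≤ w₁ ^ 2 + w₂ ^ 2)
    (h2 : 1 ≤ (w₁ - 2 * P.a) ^ 2 + (w₂ + 2 * P.b) ^ 2) (hs : 0 ≤ s)
    (hsa : s * P.a ≤ w₂ + 2 * P.b) :
    0 ≤ w₁ - s * P.b ∧ 0 ≤ 2 * P.b + (w₂ - s * P.a) ∧
      P.b * (w₁ - s * P.b) + P.a * (w₂ - s * P.a) ≤ 0 ∧
      1 ≤ (w₁ - s * P.b) ^ 2 + (w₂ - s * P.a) ^ 2 ∧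
      1 ≤ (w₁ - s * P.b - 2 * P.a) ^ 2 + (w₂ - s * P.a + 2 * P.b) ^ 2 := by
  have ha := P.a_pos
  have hb := P.b_pos
  have hab := P.sq_add_sq
  have hκ := P.le_of_triangle h0 hu h1
  have hsu := mul_nonneg hs (neg_nonneg.2 hu)
  refine ⟨?_, by linarith, ?_, ?_, ?_⟩
  · have e : P.a * (w₁ - s * P.b) = (P.a * w₁ - P.b * w₂) - 2 * P.b ^ 2
        + P.b * (w₂ + 2 * P.b - s * P.a) := by ring
    have h3 : 2 * P.b ^ 2 ≤ P.b := by nlinarith [P.b_lt_half]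
    have h4 : 0 ≤ P.a * (w₁ - s * P.b) := by
      rw [e]
      linarith [mul_nonneg hb.le (sub_nonneg.2 hsa)]
    exact nonneg_of_mul_nonneg_right h4 ha
  · have e : P.b * (w₁ - s * P.b) + P.a * (w₂ - s * P.a) = P.b * w₁ + P.a * w₂ - s := by
      linear_combination -s * hab
    rw [e]; linarith
  · have e : (w₁ - s * P.b) ^ 2 + (w₂ - s * P.a) ^ 2
        = w₁ ^ 2 + w₂ ^ 2 - 2 * s * (P.b * w₁ + P.a * w₂) + s ^ 2 := by
      linear_combination s ^ 2 * hab
    rw [e]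
    linarith [sq_nonneg s]
  · have e : (w₁ - s * P.b - 2 * P.a) ^ 2 + (w₂ - s * P.a + 2 * P.b) ^ 2
        = (w₁ - 2 * P.a) ^ 2 + (w₂ + 2 * P.b) ^ 2 - 2 * s * (P.b * w₁ + P.a * w₂) + s ^ 2 := by
      linear_combination s ^ 2 * hab
    rw [e]
    linarith [sq_nonneg s]

/-- Descending parallel to the corridor moves away from the upper tip and the right spike. The
factor μ is chosen to reach the axis, along which the base point is then approached. -/
lemma link_triangle {w₁ w₂ : ℝ} (h : 0 ≤ 2 * P.b + w₂) (h0 : 0 ≤ w₁)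
    (hu : P.b * w₁ + P.a * w₂ ≤ 0) (h1 : 1 ≤ w₁ ^ 2 + w₂ ^ 2)
    (h2 : 1 ≤ (w₁ - 2 * P.a) ^ 2 + (w₂ + 2 * P.b) ^ 2) :
    P.Link P.rightHalf (P.tipPt w₁ w₂) P.rightBase := by
  have ha := P.a_pos
  have hb := P.b_pos
  set μ := (w₂ + 2 * P.b) / P.a
  have hμ0 : 0 ≤ μ := div_nonneg (by linarith) ha.le
  have hμa : μ * P.a = w₂ + 2 * P.b := div_mul_cancel₀ _ ha.ne'
  obtain ⟨g0, g1, g2, g3, g4⟩ := P.triangle_descend h0 hu h1 h2 hμ0 hμa.le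
  have ge : w₂ - μ * P.a = -2 * P.b := by linarith
  refine Link.trans (y := P.tipPt (w₁ - μ * P.b) (w₂ - μ * P.a))
    (P.link_segment fun t ht ht1 => ?_) ?_
  · obtain ⟨k0, k1, k2, k3, k4⟩ := P.triangle_descend (s := t * μ) h0 hu h1 h2
      (mul_nonneg ht hμ0) (by rw [mul_assoc, hμa]; exact mul_le_of_le_one_left (by linarith) ht1)
    rw [show w₁ + t * (w₁ - μ * P.b - w₁) = w₁ - t * μ * P.b by ring,
      show w₂ + t * (w₂ - μ * P.a - w₂) = w₂ - t * μ * P.a by ring]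
    exact ⟨P.clear_triangle k0 k1 k2 k3 k4, P.tipPt_mem_right k0⟩
  · rw [ge] at g1 g2 g3 g4 ⊢
    generalize w₁ - μ * P.b = v at *
    -- Otherwise `v`, which is at most 2a by `g2`, would be within distance 1 of the right spike.
    have hv : v ≤ 2 * P.a - 1 := by
      by_contra! hlt
      nlinarith
    refine P.link_segment fun t ht ht1 => ?_
    have e1 : v ≤ v + t * (2 * P.a - 1 - v) := by linarith [mul_nonneg ht (sub_nonneg.2 hv)]
    have e2 : v + t * (2 * P.a - 1 - v) ≤ 2 * P.a - 1 := by
      linarith [mul_nonneg (sub_nonneg.2 ht1) (sub_nonneg.2 hv)]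
    rw [sub_self, mul_zero, add_zero]
    generalize v + t * (2 * P.a - 1 - v) = y at *
    have e3 := mul_le_mul_of_nonneg_left e2 hb.le
    refine ⟨P.clear_triangle (by linarith) (by linarith) (by linarith) ?_ ?_,
      P.tipPt_mem_right (by linarith)⟩
    · linarith [pow_le_pow_left₀ g0 e1 2]
    · have : 1 ≤ (2 * P.a - y) ^ 2 := one_le_pow₀ (by linarith)
      exact this.trans_eq (by ring)

lemma link_corridor {t : ℝ} (ht : 0 ≤ t) (ht1 : t ≤ 16) :
    P.Link P.rightHalf (P.tipPt (P.a + t * P.b) (-P.b + t * P.a)) P.rightBase := by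
  have ha := P.a_pos
  have hb := P.b_pos
  have hab := P.sq_add_sq
  refine Link.trans (y := P.tipPt P.a (-P.b)) (P.link_segment fun s hs hs1 => ?_)
    (P.link_triangle (by linarith) ha.le (by nlinarith) (by nlinarith) (by nlinarith))
  have h1 : 0 ≤ (1 - s) * t := mul_nonneg (by linarith) ht
  have h2 : (1 - s) * t ≤ 16 := by nlinarith
  rw [show P.a + t * P.b + s * (P.a - (P.a + t * P.b)) = P.a + (1 - s) * t * P.b by ring,
    show -P.b + t * P.a + s * (-P.b - (-P.b + t * P.a)) = -P.b + (1 - s) * t * P.a by ring]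
  exact ⟨P.clear_corridor h1 h2, P.tipPt_mem_right (by positivity)⟩

/-- The boundary meets the axis only in the two ends of the chain, and the open interval between
them contains the origin. -/
lemma axis_mem_region {s : ℝ} (h1 : P.c - 2 < s) (h2 : s < P.c + 2 * P.a) :
    pt s 0 ∈ region P.polygon := by
  have hch := P.isUpperChain
  have hc := P.c_pos
  have hc1 := P.c_lt_one
  have ha := P.a_pos
  have hp : IsPreconnected ((fun r : ℝ => r • pt 1 0) '' Ioo (P.c - 2) (P.c + 2 * P.a)) :=
    isPreconnected_Ioo.image _ (by fun_prop)
  refine hch.subset_region_of_preconnected hp ?_ (y := 0) ⟨0, ⟨by linarith, by linarith⟩, by simp⟩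
    ?_ ⟨s, ⟨h1, h2⟩, plane_ext (by simp) (by simp)⟩
  · rintro _ ⟨r, hr, rfl⟩ hmem
    obtain ⟨i, hi, hz⟩ := (hch.mem_boundary_iff _).1 hmem
    have hz : r • pt 1 0 ∈ chainEdge P.V i := by
      rcases hz with hz | hz
      · exact hz
      · rwa [mirror_eq_self (by simp)] at hz
    rcases hch.edge_eq_zero hi hz (by simp) with ⟨-, he⟩ | ⟨-, he⟩
    · have := congrArg (fun x : Plane => x 0) he
      simp [V] at this
      linarith [hr.2]
    · rw [V_last] at he
      have := congrArg (fun x : Plane => x 0) he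
      simp at this
      linarith [hr.1]
  · rw [hch.mem_region_iff]
    refine ⟨0, by simp, P.V 0, (hch.mem_boundary_iff _).2 ⟨0, by rw [m_eq]; omega,
      Or.inl (IsUpperChain.left_mem _ _)⟩, by simp⟩

lemma Link.left_mem_clear {H : Set Plane} {x y : Plane} (h : P.Link H x y) :
    ∀ b ∈ P.polygon.boundary ℝ, 1 ≤ dist x b := by
  obtain ⟨s, -, h2, -, -, h5⟩ := h
  exact h5 x h2

lemma leftBase_mem : P.leftBase ∈ P.free := by
  refine (P.isUpperChain.mem_freeSpace_iff _).2 ⟨?_, (P.link_left_low (w₁ := -1)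
    (w₂ := -2 * P.b) (by linarith) le_rfl (by norm_num) (by linarith [P.b_pos])
    (by nlinarith [sq_nonneg P.b])).left_mem_clear⟩
  have e : P.leftBase = pt (P.c - 1) 0 :=
    plane_ext (by simp [leftBase, sub_eq_add_neg]) (by simp [leftBase])
  rw [e]
  exact P.axis_mem_region (by linarith) (by linarith [P.a_pos])

lemma link_gate : P.Link P.rightHalf (P.tipPt P.a (-P.b)) P.rightBase := by
  have := P.link_corridor (t := 0) le_rfl (by norm_num)
  simpa using this

lemma rightBase_mem : P.rightBase ∈ P.free := by
  refine (P.isUpperChain.mem_freeSpace_iff _).2 ⟨?_, P.link_gate.symm.left_mem_clear⟩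
  have e : P.rightBase = pt (P.c + (2 * P.a - 1)) 0 :=
    plane_ext (by simp [rightBase]) (by simp [rightBase])
  rw [e]
  exact P.axis_mem_region (by linarith [P.a_pos]) (by linarith)

/-- The left free-space component. -/
def leftComp : Set Plane := {x | x ∈ P.free ∧ x 0 < P.c}

/-- The right free-space component. -/
def rightComp : Set Plane := {x | x ∈ P.free ∧ P.c < x 0}

lemma mirror_mem_free {x : Plane} (hx : x ∈ P.free) : mirror x ∈ P.free :=
  P.isUpperChain.mirror_mem_freeSpace hx

lemma mirror_mem_leftComp {x : Plane} (hx : x ∈ P.leftComp) : mirror x ∈ P.leftComp :=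
  ⟨P.mirror_mem_free hx.1, hx.2⟩

lemma mirror_mem_rightComp {x : Plane} (hx : x ∈ P.rightComp) : mirror x ∈ P.rightComp :=
  ⟨P.mirror_mem_free hx.1, hx.2⟩

lemma free_upper_ne {x : Plane} (hx : x ∈ P.free) (h : 0 ≤ x 1) : x 0 ≠ P.c := by
  intro he
  rw [← P.tipPt_eq x] at hx
  have ha := P.a_pos
  have hb := P.b_pos
  rcases P.free_cases (by linarith) hx with h | h | ⟨t, ht, -, h, -⟩ | h
  · linarith [h.1]
  · linarith [h.2.1]
  · linarith [mul_nonneg ht hb.le]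
  · linarith [h.1]

lemma free_ne {x : Plane} (hx : x ∈ P.free) : x 0 ≠ P.c := by
  rcases le_total 0 (x 1) with h | h
  · exact P.free_upper_ne hx h
  · exact P.free_upper_ne (x := mirror x) (P.mirror_mem_free hx) (by simpa using h)

lemma link_left {x : Plane} (hx : x ∈ P.leftComp) : P.Link P.leftHalf x P.leftBase := by
  have upper : ∀ x ∈ P.leftComp, 0 ≤ x 1 → P.Link P.leftHalf x P.leftBase := by
    intro x hx h
    obtain ⟨hx, hc⟩ := hx
    rw [← P.tipPt_eq x] at hx ⊢
    rcases P.free_cases (by linarith) hx with h | h | ⟨t, ht, -, h, -⟩ | h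
    · exact P.link_left_arc hx h.1 h.2.2.1 h.2.1 h.2.2.2.1 h.2.2.2.2
    · exact P.link_left_low (by linarith) h.1 h.2.1.le h.2.2.1 h.2.2.2
    · linarith [P.a_pos, mul_nonneg ht P.b_pos.le]
    · linarith [h.1]
  rcases le_total 0 (x 1) with h | h
  · exact upper x hx h
  · have := (upper _ (P.mirror_mem_leftComp hx) (by simpa using h)).mirror fun x hx => hx
    rwa [mirror_mirror, mirror_eq_self (by simp [leftBase])] at this

lemma link_right {x : Plane} (hx : x ∈ P.rightComp) : P.Link P.rightHalf x P.rightBase := by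
  have upper : ∀ x ∈ P.rightComp, 0 ≤ x 1 → P.Link P.rightHalf x P.rightBase := by
    intro x hx h
    obtain ⟨hx, hc⟩ := hx
    rw [← P.tipPt_eq x] at hx ⊢
    rcases P.free_cases (by linarith) hx with h | h | ⟨t, ht, ht1, h, h'⟩ | h
    · linarith [h.1]
    · linarith [h.2.1]
    · rw [h, h']
      exact P.link_corridor ht ht1
    · exact P.link_triangle (by linarith) h.1.le h.2.1 h.2.2.2.1 h.2.2.2.2
  rcases le_total 0 (x 1) with h | h
  · exact upper x hx h
  · have := (upper _ (P.mirror_mem_rightComp hx) (by simpa using h)).mirror fun x hx => hx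
    rwa [mirror_mirror, mirror_eq_self (by simp [rightBase])] at this

lemma leftBase_mem_leftComp : P.leftBase ∈ P.leftComp :=
  ⟨P.leftBase_mem, by simp [leftBase]⟩

lemma rightBase_mem_rightComp : P.rightBase ∈ P.rightComp :=
  ⟨P.rightBase_mem, by simp only [rightBase, tipPt_zero]; linarith [P.lt_a]⟩

lemma isPreconnected_leftComp : IsPreconnected P.leftComp := by
  refine isPreconnected_of_forall P.leftBase fun x hx => ?_
  obtain ⟨s, h1, h2, h3, h4⟩ := (P.link_left hx).free hx.1
  exact ⟨s, fun z hz => ⟨(h4 hz).2, lt_of_le_of_ne (h4 hz).1 (P.free_ne (h4 hz).2)⟩, h3, h2, h1⟩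

lemma isPreconnected_rightComp : IsPreconnected P.rightComp := by
  refine isPreconnected_of_forall P.rightBase fun x hx => ?_
  obtain ⟨s, h1, h2, h3, h4⟩ := (P.link_right hx).free hx.1
  exact ⟨s, fun z hz => ⟨(h4 hz).2, lt_of_le_of_ne (h4 hz).1 (P.free_ne (h4 hz).2).symm⟩,
    h3, h2, h1⟩

lemma continuous_coord (i : Fin 2) : Continuous fun x : Plane => x i := by fun_prop

/-- A connected subset of the free space does not pass between the tips. -/
lemma preconnected_side {s : Set Plane} (hs : IsPreconnected s) (hsf : s ⊆ P.free) {x y : Plane}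
    (hx : x ∈ s) (hy : y ∈ s) (hxc : x 0 < P.c) : y 0 < P.c := by
  by_contra! hle
  obtain ⟨z, hz, he⟩ := hs.intermediate_value hx hy (continuous_coord 0).continuousOn ⟨hxc.le, hle⟩
  exact P.free_ne (hsf hz) he

lemma component_left {x : Plane} (hx : x ∈ P.leftComp) :
    connectedComponentIn P.free x = P.leftComp := by
  refine Subset.antisymm (fun y hy => ?_)
    (P.isPreconnected_leftComp.subset_connectedComponentIn hx fun _ h => h.1)
  have hsub := connectedComponentIn_subset P.free x
  exact ⟨hsub hy, P.preconnected_side isPreconnected_connectedComponentIn hsub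
    (mem_connectedComponentIn hx.1) hy hx.2⟩

lemma component_right {x : Plane} (hx : x ∈ P.rightComp) :
    connectedComponentIn P.free x = P.rightComp := by
  refine Subset.antisymm (fun y hy => ?_)
    (P.isPreconnected_rightComp.subset_connectedComponentIn hx fun _ h => h.1)
  have hsub := connectedComponentIn_subset P.free x
  refine ⟨hsub hy, lt_of_le_of_ne ?_ (P.free_ne (hsub hy)).symm⟩
  by_contra! hlt
  exact lt_asymm hx.2 (P.preconnected_side isPreconnected_connectedComponentIn hsub hy
    (mem_connectedComponentIn hx.1) hlt)

theorem freeComponents_eq : freeComponents (region P.polygon) = {P.leftComp, P.rightComp} := by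
  ext K
  constructor
  · rintro ⟨x, hx, rfl⟩
    rcases lt_or_gt_of_ne (P.free_ne hx) with h | h
    · exact Or.inl (P.component_left ⟨hx, h⟩)
    · exact Or.inr (P.component_right ⟨hx, h⟩)
  · rintro (rfl | rfl)
    · exact ⟨_, P.leftBase_mem, (P.component_left P.leftBase_mem_leftComp).symm⟩
    · exact ⟨_, P.rightBase_mem, (P.component_right P.rightBase_mem_rightComp).symm⟩

end Params
end
end UnlabeledMRMP

namespace UnlabeledMRMP
noncomputable section
namespace Params

variable (P : Params)

/-! ### Blocking -/

/-- The only free position in the gate between the upper tip and the right spike. -/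
def gate : Plane := P.tipPt P.a (-P.b)

/-- A robot in the upper half of the left component blocks the upper gate. -/
lemma dist_gate_lt {x : Plane} (hx : x ∈ P.leftComp) (h : 0 ≤ x 1) : dist x P.gate < 2 := by
  obtain ⟨hx, hc⟩ := hx
  have ha := P.a_pos
  have hb := P.b_pos
  have ha' := P.a'_pos
  have hb' := P.b'_pos
  have hab := P.sq_add_sq
  have hab' := P.sq_add_sq'
  have ha1 := P.a_lt_one
  rw [dist_lt_iff zero_le_two]
  rw [← P.tipPt_eq x] at hx
  have hc' : x 0 - P.c < 0 := by linarith
  have h' : 0 ≤ 2 * P.b + (x 1 - 2 * P.b) := by linarith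
  have e : (x 0 - P.gate 0) ^ 2 + (x 1 - P.gate 1) ^ 2
      = (x 0 - P.c - P.a) ^ 2 + (x 1 - 2 * P.b + P.b) ^ 2 := by
    simp only [gate, tipPt_zero, tipPt_one]; ring
  rw [e]
  generalize x 0 - P.c = w₁ at *
  generalize x 1 - 2 * P.b = w₂ at *
  rcases P.free_cases h' hx with ⟨-, h1, h2, h3, h4⟩ | ⟨h1, h2, h3, h4⟩ | ⟨t, ht, -, h1, -⟩ | h1
  · have hcos : Real.cos (P.θ - P.φ) = P.a * P.a' + P.b * P.b' := Real.cos_sub _ _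
    have hsin := P.sin_diff_pos
    have hbd := P.bound
    rw [hcos] at hbd
    have hR := P.two_le_R
    have hα : (-P.a' * w₁ + P.b' * w₂) ≤ P.R - 1 := by
      have : (-P.a' * w₁ + P.b' * w₂) ^ 2 ≤ (P.R - 1) ^ 2 := by
        have e2 : (-P.a' * w₁ + P.b' * w₂) ^ 2 + (P.b' * w₁ + P.a' * w₂) ^ 2
            = w₁ ^ 2 + w₂ ^ 2 := by linear_combination (w₁ ^ 2 + w₂ ^ 2) * hab'
        linarith [sq_nonneg (P.b' * w₁ + P.a' * w₂)]
      exact (abs_le_of_sq_le_sq' this (by linarith)).2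
    -- The component opposite to the gate, in the frame turned by θ - φ. The second summand is
    -- nonpositive below the cap and the first is at most (R - 1) cos(θ - φ), so `bound` applies.
    have key : -P.a * w₁ + P.b * w₂ = (P.a * P.a' + P.b * P.b') * (-P.a' * w₁ + P.b' * w₂)
        + (P.b * P.a' - P.a * P.b') * (P.b' * w₁ + P.a' * w₂) := by
      linear_combination (P.a * w₁ - P.b * w₂) * hab'
    have k1 : 0 ≤ P.a * P.a' + P.b * P.b' := by positivity
    have k2 := mul_nonneg k1 (sub_nonneg.2 hα)
    have k3 := mul_nonneg hsin.le (neg_nonneg.2 h1)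
    have e3 : (w₁ - P.a) ^ 2 + (w₂ + P.b) ^ 2
        = w₁ ^ 2 + w₂ ^ 2 + 1 + 2 * (-P.a * w₁ + P.b * w₂) := by linear_combination hab
    rw [e3, key]
    linarith
  -- Here the position is in a rectangle whose corners have squared distance at most (1 + a)² + b² =
  -- 2 + 2a < 4 from the gate.
  · have k1 : (w₁ - P.a) ^ 2 ≤ (1 + P.a) ^ 2 := by nlinarith
    have k2 : (w₂ + P.b) ^ 2 ≤ P.b ^ 2 := by nlinarith
    nlinarith
  · linarith [mul_nonneg ht hb.le]
  · linarith [h1.1]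

lemma rightComp_gate_aux {x : Plane} (hx : x ∈ P.rightComp) (h : 0 ≤ x 1) (hb1 : x 1 ≤ P.b) :
    x 0 ≤ P.c + P.a ∧ (x 1 = P.b → x = P.gate) := by
  obtain ⟨hx, hc⟩ := hx
  have ha := P.a_pos
  have hb := P.b_pos
  have hab := P.sq_add_sq
  have ew := P.tipPt_eq x
  have hc' : 0 < x 0 - P.c := by linarith
  have h' : 0 ≤ 2 * P.b + (x 1 - 2 * P.b) := by linarith
  have h'' : x 1 - 2 * P.b ≤ -P.b := by linarith
  rw [← ew] at hx
  suffices key : x 0 - P.c ≤ P.a ∧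
      (x 1 - 2 * P.b = -P.b → P.tipPt (x 0 - P.c) (x 1 - 2 * P.b) = P.gate) from
    ⟨by linarith [key.1], fun he => ew.symm.trans (key.2 (by linarith))⟩
  clear ew
  generalize x 0 - P.c = w₁ at *
  generalize x 1 - 2 * P.b = w₂ at *
  rcases P.free_cases h' hx with h1 | h1 | ⟨t, ht, -, h1, h2⟩ | ⟨-, h2, -, h4, h5⟩
  · linarith [h1.1]
  · linarith [h1.2.1]
  · have ht0 : t = 0 := by
      refine le_antisymm ?_ ht
      by_contra! hpos
      linarith [mul_pos hpos ha]
    subst ht0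
    rw [h1, h2]
    exact ⟨by linarith, fun _ => plane_ext (by simp [gate]) (by simp [gate])⟩
  -- The chamber's upper side bounds the height above the right spike by (b/a)(2a - w₁). Distance 1
  -- from that spike then needs 2a - w₁ ≥ a.
  · have hle : w₁ ≤ P.a := by
      by_contra! hlt
      have k1 : 0 ≤ 2 * P.a - w₁ := by
        by_contra! hneg
        linarith [mul_lt_mul_of_pos_left (sub_neg.1 hneg) hb, mul_nonneg ha.le h']
      have k2 : P.a * (w₂ + 2 * P.b) ≤ P.b * (2 * P.a - w₁) := by linarith
      have k3 : (P.a * (w₂ + 2 * P.b)) ^ 2 ≤ (P.b * (2 * P.a - w₁)) ^ 2 :=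
        pow_le_pow_left₀ (mul_nonneg ha.le (by linarith)) k2 2
      have k4 : P.a ^ 2 ≤ (2 * P.a - w₁) ^ 2 := by
        have e : P.a ^ 2 * ((w₁ - 2 * P.a) ^ 2 + (w₂ + 2 * P.b) ^ 2)
            = (P.a ^ 2 + P.b ^ 2) * (2 * P.a - w₁) ^ 2 + (P.a * (w₂ + 2 * P.b)) ^ 2
              - (P.b * (2 * P.a - w₁)) ^ 2 := by ring
        have := mul_le_mul_of_nonneg_left h5 (sq_nonneg P.a)
        rw [e, hab] at this
        linarith
      have := (sq_le_sq₀ ha.le k1).1 k4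
      linarith
    refine ⟨hle, fun he => ?_⟩
    have : w₁ = P.a := by
      refine le_antisymm hle ?_
      rw [he] at h4
      have : P.a ^ 2 ≤ w₁ ^ 2 := by linarith
      exact (sq_le_sq₀ ha.le hc'.le).1 this
    rw [this, he]
    rfl

lemma eq_gate {x : Plane} (hx : x ∈ P.rightComp) (h : x 1 = P.b) : x = P.gate :=
  (P.rightComp_gate_aux hx (by linarith [P.b_pos]) h.le).2 h

lemma le_of_between_gates {x : Plane} (hx : x ∈ P.rightComp) (h : -P.b ≤ x 1) (h' : x 1 ≤ P.b) :
    x 0 ≤ P.c + P.a := by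
  rcases le_total 0 (x 1) with h0 | h0
  · exact (P.rightComp_gate_aux hx h0 h').1
  · exact (P.rightComp_gate_aux (x := mirror x) (P.mirror_mem_rightComp hx) (by simpa using h0)
      (by simp only [mirror_apply_one]; linarith)).1

/-- A robot on the axis of symmetry in the left component blocks all positions between the two
gates. -/
lemma dist_axis_lt {x y : Plane} (hx : x ∈ P.leftComp) (h : x 1 = 0) (hy : y ∈ P.rightComp)
    (hy1 : -P.b ≤ y 1) (hy2 : y 1 ≤ P.b) : dist x y < 2 := by
  have hya := P.le_of_between_gates hy hy1 hy2
  have hyc := hy.2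
  have hb := P.b_pos
  have hab := P.sq_add_sq
  have ha1 := P.a_lt_one
  obtain ⟨hx, hc⟩ := hx
  rw [← P.tipPt_eq x] at hx
  have hx1 : P.c - 1 ≤ x 0 := by
    rcases P.free_cases (by linarith) hx with h1 | h1 | ⟨t, ht, -, h1, -⟩ | h1
    · linarith [h1.2.2.1]
    · linarith [h1.1]
    · linarith [mul_nonneg ht hb.le, P.a_pos]
    · linarith [h1.1]
  rw [dist_lt_iff zero_le_two, h]
  have k1 : (x 0 - y 0) ^ 2 ≤ (1 + P.a) ^ 2 := sq_le_sq' (by linarith) (by linarith [P.a_pos])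
  have k2 : (0 - y 1) ^ 2 ≤ P.b ^ 2 := sq_le_sq' (by linarith) (by linarith)
  linarith

/-- If a real function descends from above `b` to below `-b` and a second one does not vanish while
the first is between these bounds, then the second has the same sign at a passage through `b` and
through `-b`. -/
lemma exists_crossing {f g : unitInterval → ℝ} (hf : Continuous f) (hg : Continuous g) {b : ℝ}
    (hb : 0 < b) (h0 : b ≤ f 0) (h1 : f 1 ≤ -b) :
    ∃ τ, (f τ = b ∧ 0 ≤ g τ) ∨ (f τ = -b ∧ g τ ≤ 0) ∨ (g τ = 0 ∧ -b ≤ f τ ∧ f τ ≤ b) := by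
  by_contra! hne
  -- With τ₂ the first time at or below -b and τ₁ the last time before it at or above b, `f` stays
  -- in [-b, b] in between, while `g` goes from negative to positive.
  obtain ⟨τ₂, hτ₂, hmin⟩ := (isClosed_le hf continuous_const).isCompact.exists_isLeast
    (s := {τ | f τ ≤ -b}) ⟨1, h1⟩
  have hcl : IsClosed {τ | b ≤ f τ ∧ τ ≤ τ₂} :=
    (isClosed_le continuous_const hf).inter isClosed_Iic
  obtain ⟨τ₁, ⟨hτ₁, hle⟩, hmax⟩ := hcl.isCompact.exists_isGreatest ⟨0, h0, unitInterval.nonneg'⟩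
  have hτ₂ : f τ₂ ≤ -b := hτ₂
  obtain ⟨τ₃, hτ₃, e₃⟩ := intermediate_value_Icc' hle hf.continuousOn
    (show b ∈ Icc (f τ₂) (f τ₁) from ⟨by linarith, hτ₁⟩)
  obtain ⟨τ₄, hτ₄, e₄⟩ := intermediate_value_Icc' hle hf.continuousOn
    (show -b ∈ Icc (f τ₂) (f τ₁) from ⟨hτ₂, by linarith⟩)
  have h3 : τ₃ = τ₁ := le_antisymm (hmax ⟨e₃.ge, hτ₃.2⟩) hτ₃.1
  have h4 : τ₄ = τ₂ := le_antisymm hτ₄.2 (hmin (show f τ₄ ≤ -b from e₄.le))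
  rw [h3] at e₃
  rw [h4] at e₄
  have g1 : g τ₁ < 0 := (hne τ₁).1 e₃
  have g2 : 0 < g τ₂ := (hne τ₂).2.1 e₄
  obtain ⟨τ, hτ, e⟩ := intermediate_value_Icc hle hg.continuousOn
    (show (0 : ℝ) ∈ Icc (g τ₁) (g τ₂) from ⟨g1.le, g2.le⟩)
  have hlo : -b ≤ f τ := by
    by_contra! hlt
    have := hmin (show f τ ≤ -b from hlt.le)
    rw [le_antisymm hτ.2 this] at hlt
    linarith
  have hhi : f τ ≤ b := by
    by_contra! hlt
    have := hmax ⟨hlt.le, hτ.2⟩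
    rw [le_antisymm this hτ.1] at hlt
    linarith
  exact absurd hhi (not_le.2 ((hne τ).2.2 e hlo))

/-- The start position in the right component. -/
def rightStart : Plane := P.tipPt (P.a + 16 * P.b) (-P.b + 16 * P.a)

lemma rightStart_mem : P.rightStart ∈ P.rightComp :=
  ⟨(P.link_corridor (t := 16) (by norm_num) le_rfl).symm.mem_free P.rightBase_mem, by
    simp only [rightStart, tipPt_zero]; linarith [P.a_pos, P.b_pos]⟩

theorem alwaysBlocks : AlwaysBlocks P.leftComp P.rightComp P.rightStart (mirror P.rightStart) := by
  intro γ γ' hγ hγ' hs ht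
  have ha := P.a_pos
  have hb := P.b_pos
  obtain ⟨τ, h⟩ := exists_crossing (f := fun τ => γ' τ 1) (g := fun τ => γ τ 1)
    ((continuous_coord 1).comp γ'.continuous) ((continuous_coord 1).comp γ.continuous) hb
    (by simp only [hs, rightStart, tipPt_one]; linarith)
    (by simp only [ht, rightStart, mirror_apply_one, tipPt_one]; linarith)
  refine ⟨τ, ?_⟩
  rw [mem_ball, dist_comm]
  rcases h with ⟨h1, h2⟩ | ⟨h1, h2⟩ | ⟨h1, h2, h3⟩
  · rw [P.eq_gate (hγ' τ) h1]
    exact P.dist_gate_lt (hγ τ) h2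
  · have e := P.eq_gate (P.mirror_mem_rightComp (hγ' τ)) (by simp [h1])
    rw [← dist_mirror, e]
    exact P.dist_gate_lt (P.mirror_mem_leftComp (hγ τ)) (by simpa using h2)
  · exact P.dist_axis_lt (hγ τ) h1 (hγ' τ) h2 h3

/-! ### The instance -/

/-- The start position in the left component. -/
def leftStart : Plane := P.tipPt (-P.a') P.b'

lemma leftStart_mem : P.leftStart ∈ P.leftComp := by
  have h1 := P.sq_add_sq'
  have hl := P.link_left_circle (w₁ := -P.a') (w₂ := P.b') (neg_neg_of_pos P.a'_pos)
    P.b'_pos.le (by linarith)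
  have hn : (-P.a') ^ 2 + P.b' ^ 2 = 1 := by rw [neg_sq]; exact h1
  rw [hn, Real.sqrt_one, div_one, div_one] at hl
  exact ⟨hl.symm.mem_free P.leftBase_mem, by
    simp only [leftStart, tipPt_zero]; linarith [P.a'_pos]⟩

/-- Intermediate values of the distance from `leftStart` on the connected left component, up to its
mirror image at distance 2(2b + b'). -/
lemma exists_target {δ : ℝ} (h0 : 0 ≤ δ) (h : δ ≤ 2 * (2 * P.b + P.b')) :
    ∃ t ∈ P.leftComp, dist P.leftStart t = δ := by
  have hd : δ ≤ dist P.leftStart (mirror P.leftStart) := by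
    rw [le_dist_iff h0]
    simp only [leftStart, mirror_apply_zero, mirror_apply_one, tipPt_zero, tipPt_one]
    have := pow_le_pow_left₀ h0 h 2
    linarith
  obtain ⟨t, ht, he⟩ := P.isPreconnected_leftComp.intermediate_value P.leftStart_mem
    (P.mirror_mem_leftComp P.leftStart_mem)
    (f := fun t => dist P.leftStart t) (by fun_prop) ⟨by simpa using h0, hd⟩
  exact ⟨t, ht, he⟩

lemma four_le_dist_right {x : Plane} (hx : x ∈ P.leftComp) : 4 ≤ dist x P.rightStart := by
  rw [le_dist_iff (by norm_num)]
  have h1 := hx.2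
  have h2 : x 0 - P.rightStart 0 ≤ -4 := by
    simp only [rightStart, tipPt_zero]
    linarith [P.a_pos, P.le_b', P.b'_lt]
  nlinarith [sq_nonneg (x 1 - P.rightStart 1)]

lemma four_le_dist_right_mirror {x : Plane} (hx : x ∈ P.leftComp) :
    4 ≤ dist x (mirror P.rightStart) := by
  rw [← dist_mirror, mirror_mirror]
  exact P.four_le_dist_right (P.mirror_mem_leftComp hx)

lemma three_le_dist_right : 3 ≤ dist P.rightStart (mirror P.rightStart) := by
  rw [le_dist_iff (by norm_num)]
  simp only [rightStart, mirror_apply_zero, mirror_apply_one, tipPt_zero, tipPt_one]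
  nlinarith [P.lt_a, P.b_pos]

lemma left_right_disjoint {x : Plane} (h : x ∈ P.leftComp) (h' : x ∈ P.rightComp) : False :=
  lt_asymm h.2 h'.2

lemma pair_inter_left {x y : Plane} (hx : x ∈ P.leftComp) (hy : y ∈ P.rightComp) :
    ({x, y} : Set Plane) ∩ P.leftComp = {x} := by
  ext z
  constructor
  · rintro ⟨rfl | rfl, hz⟩
    · rfl
    · exact (P.left_right_disjoint hz hy).elim
  · rintro rfl
    exact ⟨Or.inl rfl, hx⟩

lemma pair_inter_right {x y : Plane} (hx : x ∈ P.leftComp) (hy : y ∈ P.rightComp) :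
    ({x, y} : Set Plane) ∩ P.rightComp = {y} := by
  ext z
  constructor
  · rintro ⟨rfl | rfl, hz⟩
    · exact (P.left_right_disjoint hx hz).elim
    · rfl
  · rintro rfl
    exact ⟨Or.inr rfl, hy⟩

lemma ne_of_left_right {x y : Plane} (hx : x ∈ P.leftComp) (hy : y ∈ P.rightComp) : x ≠ y := by
  rintro rfl
  exact P.left_right_disjoint hx hy

open Classical in
/-- The instance with the given target position in the left component. -/
def inst {t : Plane} (ht : t ∈ P.leftComp) : Instance where
  n := 2 * P.m
  polygon := P.polygon
  simple := P.isUpperChain.isSimple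
  starts := {P.leftStart, P.rightStart}
  targets := {t, mirror P.rightStart}
  card_eq := by
    rw [Finset.card_pair (P.ne_of_left_right P.leftStart_mem P.rightStart_mem),
      Finset.card_pair (P.ne_of_left_right ht (P.mirror_mem_rightComp P.rightStart_mem))]
  starts_free := by
    rw [Finset.coe_pair]
    rintro x (rfl | rfl)
    · exact P.leftStart_mem.1
    · exact P.rightStart_mem.1
  targets_free := by
    rw [Finset.coe_pair]
    rintro x (rfl | rfl)
    · exact ht.1
    · exact (P.mirror_mem_rightComp P.rightStart_mem).1
  charge_eq_zero := by
    rw [P.freeComponents_eq, Finset.coe_pair, Finset.coe_pair]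
    rintro K (rfl | rfl)
    · rw [P.pair_inter_left P.leftStart_mem P.rightStart_mem,
        P.pair_inter_left ht (P.mirror_mem_rightComp P.rightStart_mem), ncard_singleton,
        ncard_singleton]
    · rw [P.pair_inter_right P.leftStart_mem P.rightStart_mem,
        P.pair_inter_right ht (P.mirror_mem_rightComp P.rightStart_mem), ncard_singleton,
        ncard_singleton]

variable {t : Plane} (ht : t ∈ P.leftComp)

lemma mem_starts {x : Plane} : x ∈ (P.inst ht).starts ↔ x = P.leftStart ∨ x = P.rightStart := by
  simp [inst]

lemma mem_targets {x : Plane} : x ∈ (P.inst ht).targets ↔ x = t ∨ x = mirror P.rightStart := by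
  simp [inst]

lemma inst_mono : (P.inst ht).MonochromaticSeparation 4 := by
  constructor
  · intro x hx y hy hne
    rcases (P.mem_starts ht).1 hx with rfl | rfl <;> rcases (P.mem_starts ht).1 hy with rfl | rfl
    · exact absurd rfl hne
    · exact P.four_le_dist_right P.leftStart_mem
    · rw [dist_comm]
      exact P.four_le_dist_right P.leftStart_mem
    · exact absurd rfl hne
  · intro x hx y hy hne
    rcases (P.mem_targets ht).1 hx with rfl | rfl <;> rcases (P.mem_targets ht).1 hy with rfl | rfl
    · exact absurd rfl hne
    · exact P.four_le_dist_right_mirror ht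
    · rw [dist_comm]
      exact P.four_le_dist_right_mirror ht
    · exact absurd rfl hne

lemma inst_bichrom (h3 : dist P.leftStart t ≤ 3) :
    (P.inst ht).BichromaticSeparation (dist P.leftStart t) := by
  intro x hx y hy
  rcases (P.mem_starts ht).1 hx with rfl | rfl <;> rcases (P.mem_targets ht).1 hy with rfl | rfl
  · exact le_rfl
  · linarith [P.four_le_dist_right_mirror P.leftStart_mem]
  · rw [dist_comm P.rightStart]
    linarith [P.four_le_dist_right ht]
  · linarith [P.three_le_dist_right]

/-- Paths stay in the component of their start, so the right robot must end at the only target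
there, and `alwaysBlocks` yields a collision. -/
lemma inst_not_solvable : ¬ (P.inst ht).Solvable := by
  rintro ⟨π, hπ⟩
  let s : (P.inst ht).starts := ⟨P.leftStart, (P.mem_starts ht).2 (Or.inl rfl)⟩
  let s' : (P.inst ht).starts := ⟨P.rightStart, (P.mem_starts ht).2 (Or.inr rfl)⟩
  have hne : s ≠ s' := fun h =>
    P.ne_of_left_right P.leftStart_mem P.rightStart_mem (congrArg Subtype.val h)
  have stay : ∀ r : (P.inst ht).starts, ∀ τ,
      π r τ ∈ connectedComponentIn P.free (r : Plane) := by
    intro r τ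
    refine (isPreconnected_range (π r).continuous).subset_connectedComponentIn
      ⟨0, hπ.start r⟩ ?_ ⟨τ, rfl⟩
    rintro _ ⟨σ, rfl⟩
    exact hπ.free r σ
  have hs : ∀ τ, π s τ ∈ P.leftComp := fun τ => by
    rw [← P.component_left P.leftStart_mem]
    exact stay s τ
  have hs' : ∀ τ, π s' τ ∈ P.rightComp := fun τ => by
    rw [← P.component_right P.rightStart_mem]
    exact stay s' τ
  have hend : π s' 1 = mirror P.rightStart := by
    have : π s' 1 ∈ ((P.inst ht).targets : Set Plane) := by
      rw [← hπ.target]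
      exact ⟨s', rfl⟩
    rcases (P.mem_targets ht).1 this with h | h
    · exact (P.left_right_disjoint (h ▸ ht) (hs' 1)).elim
    · exact h
  obtain ⟨τ, hτ⟩ := P.alwaysBlocks (π s) (π s') hs hs' (hπ.start s') hend
  exact hπ.collision_free s s' hne τ hτ

/-! ### Choice of the parameters and the main results -/

/-- There are workspaces in which the two ends of the left component are almost at distance
three. -/
lemma exists_params {ε : ℝ} (hε : 0 < ε) : ∃ P : Params, 3 - ε ≤ 2 * (2 * P.b + P.b') := by
  -- The angles will be π/6 - η and π/6 - 2η. As sine is 1-Lipschitz, 2(2b + b') ≥ 3 - 8η, and η ≤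
  -- 1/8 keeps sin φ at least 1/4.
  obtain ⟨η, hη, hηε, hη8⟩ : ∃ η : ℝ, 0 < η ∧ 8 * η ≤ ε ∧ η ≤ 1 / 8 :=
    ⟨min (ε / 8) (1 / 8), by positivity, by linarith [min_le_left (ε / 8) (1 / 8)],
      min_le_right _ _⟩
  have hsin : ∀ x : ℝ, 0 ≤ x → 1 / 2 - x ≤ Real.sin (Real.pi / 6 - x) := by
    intro x hx
    have := Real.abs_sin_sub_sin_le (Real.pi / 6) (Real.pi / 6 - x)
    rw [Real.sin_pi_div_six, sub_sub_cancel, abs_of_nonneg hx] at this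
    linarith [(abs_le.1 this).2]
  have h1 := hsin η hη.le
  have h2 := hsin (2 * η) (by linarith)
  have hcos : Real.cos η < 1 := by
    rw [← Real.cos_zero]
    exact Real.cos_lt_cos_of_nonneg_of_le_pi_div_two le_rfl
      (by linarith [Real.pi_gt_three]) hη
  -- As the polygonal arc is refined, `R` tends to 2 and the bound to 2 + 2 cos η < 4.
  have hlim : Filter.Tendsto (fun N : ℕ =>
      (2 / Real.cos ((Real.pi / 6 - 2 * η) / N / 2) - 1) ^ 2 + 1
        + 2 * (2 / Real.cos ((Real.pi / 6 - 2 * η) / N / 2) - 1) * Real.cos η) Filter.atTop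
      (nhds ((2 / Real.cos (0 / 2) - 1) ^ 2 + 1 + 2 * (2 / Real.cos (0 / 2) - 1) * Real.cos η)) := by
    have h0 : Filter.Tendsto (fun N : ℕ => (Real.pi / 6 - 2 * η) / N) Filter.atTop (nhds 0) :=
      tendsto_const_div_atTop_nhds_zero_nat _
    have h3 : Filter.Tendsto (fun N : ℕ => 2 / Real.cos ((Real.pi / 6 - 2 * η) / N / 2) - 1)
        Filter.atTop (nhds (2 / Real.cos (0 / 2) - 1)) :=
      (tendsto_const_nhds.div ((Real.continuous_cos.tendsto _).comp (h0.div_const 2))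
        (by simp)).sub_const 1
    exact ((h3.pow 2).add_const 1).add ((h3.const_mul 2).mul_const _)
  rw [zero_div, Real.cos_zero] at hlim
  obtain ⟨N, hN, hN0⟩ := ((hlim.eventually_lt_const (u := 4) (by linarith)).and
    (Filter.eventually_gt_atTop 0)).exists
  refine ⟨⟨Real.pi / 6 - η, Real.pi / 6 - 2 * η, N, by linarith [Real.pi_gt_three], by linarith,
    by linarith, by linarith, hN0, ?_⟩, ?_⟩
  · rw [show Real.pi / 6 - η - (Real.pi / 6 - 2 * η) = η by ring]
    exact hN
  · simp only [b, b']
    linarith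

end Params
end

/-- Below bichromatic separation three, there are instances without a solution in which a robot in
one free-space component always blocks the motion in the other one. -/
theorem exists_blocked_instance {ε : ℝ} (hε : 0 < ε) (hε3 : ε ≤ 3) :
    ∃ I : Instance, I.MonochromaticSeparation 4 ∧ I.BichromaticSeparation (3 - ε) ∧
      (∃ x ∈ I.starts, ∃ y ∈ I.targets, dist x y = 3 - ε) ∧
      (∃ K K' : Set Plane, K ≠ K' ∧ freeComponents I.workspace = {K, K'} ∧
        ∃ s t s' t' : Plane,
          (I.starts : Set Plane) ∩ K = {s} ∧ (I.targets : Set Plane) ∩ K = {t} ∧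
          (I.starts : Set Plane) ∩ K' = {s'} ∧ (I.targets : Set Plane) ∩ K' = {t'} ∧
          AlwaysBlocks K K' s' t') ∧
      ¬ I.Solvable := by
  obtain ⟨P, hP⟩ := Params.exists_params hε
  obtain ⟨t, ht, hd⟩ := P.exists_target (by linarith) hP
  have hR := P.mirror_mem_rightComp P.rightStart_mem
  have hst : ((P.inst ht).starts : Set Plane) = {P.leftStart, P.rightStart} := by
    ext x; simp [Params.mem_starts]
  have htt : ((P.inst ht).targets : Set Plane) = {t, mirror P.rightStart} := by
    ext x; simp [Params.mem_targets]
  refine ⟨P.inst ht, P.inst_mono ht, ?_, ⟨P.leftStart, (P.mem_starts ht).2 (Or.inl rfl), t,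
    (P.mem_targets ht).2 (Or.inl rfl), hd⟩, ⟨P.leftComp, P.rightComp, ?_, P.freeComponents_eq,
    P.leftStart, t, P.rightStart, mirror P.rightStart, ?_, ?_, ?_, ?_, P.alwaysBlocks⟩,
    P.inst_not_solvable ht⟩
  · rw [← hd]
    exact P.inst_bichrom ht (by linarith)
  · intro he
    exact P.left_right_disjoint P.leftStart_mem (he ▸ P.leftStart_mem)
  · rw [hst]; exact P.pair_inter_left P.leftStart_mem P.rightStart_mem
  · rw [htt]; exact P.pair_inter_left ht hR
  · rw [hst]; exact P.pair_inter_right P.leftStart_mem P.rightStart_mem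
  · rw [htt]; exact P.pair_inter_right ht hR

end UnlabeledMRMP

theorem mainTheorem5 :
    (∀ ε : ℝ, 0 < ε → ε ≤ 3 →
      ∃ I : UnlabeledMRMP.Instance,
        I.MonochromaticSeparation 4 ∧
        I.BichromaticSeparation (3 - ε) ∧
        (∃ x ∈ I.starts, ∃ y ∈ I.targets, dist x y = 3 - ε) ∧
        (∃ K K' : Set UnlabeledMRMP.Plane, K ≠ K' ∧
          UnlabeledMRMP.freeComponents I.workspace = {K, K'} ∧
          ∃ s t s' t' : UnlabeledMRMP.Plane,
            (I.starts : Set UnlabeledMRMP.Plane) ∩ K = {s} ∧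
            (I.targets : Set UnlabeledMRMP.Plane) ∩ K = {t} ∧
            (I.starts : Set UnlabeledMRMP.Plane) ∩ K' = {s'} ∧
            (I.targets : Set UnlabeledMRMP.Plane) ∩ K' = {t'} ∧
            UnlabeledMRMP.AlwaysBlocks K K' s' t') ∧
        ¬ I.Solvable) ∧
    (∀ β : ℝ,
      (∀ I : UnlabeledMRMP.Instance,
        I.MonochromaticSeparation 4 → I.BichromaticSeparation β → I.Solvable) →
      3 ≤ β) := by
  refine ⟨fun ε hε hε3 => UnlabeledMRMP.exists_blocked_instance hε hε3, fun β h => ?_⟩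
  by_contra! hlt
  -- The minimum with 3 covers negative β, for which 3 - β exceeds the admissible range of ε.
  obtain ⟨I, hmono, hbi, -, -, hns⟩ := UnlabeledMRMP.exists_blocked_instance
    (ε := min (3 - β) 3) (lt_min (by linarith) (by norm_num)) (min_le_right _ _)
  refine hns (h I hmono fun s hs t ht => le_trans ?_ (hbi s hs t ht))
  linarith [min_le_left (3 - β) 3]
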